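/- Let $k$ be a field. All tensor products are over $k$, and the symmetry of graded vector spaces is $\tau(v\otimes w)=(-1)^{|v||w|}\,w\otimes v$. **coHochschild homology.** For a graded coalgebra $(C,\Delta,\varepsilon)$ over $k$ let $X^n=C^{\otimes(n+1)}$, with cofaces $\delta_i=C^{\otimes i}\otimes\Delta\otimes C^{\otimes(n-i)}\colon X^n\to X^{n+1}$ for $0\le i\le n$, $\delta_{n+1}=\tau_{C,C^{\otimes(n+1)}}\circ(\Delta\otimes C^{\otimes n})$, and codegeneracies $\sigma_i=C^{\otimes(i+1)}\otimes\varepsilon\otimes C^{\otimes(n-i)}\colon X^{n+1}\to X^n$ for $0\le i\le n$. Then $\mathrm{coHH}_n(C)$ is the $n$-th cohomology of the normalized cochain complex $N^n=\bigcap_i\ker\sigma_i\subseteq X^n$ with differential $\sum_i(-1)^i\delta_i$, and $\mathrm{coHH}_*(C)=\bigoplus_n\mathrm{coHH}_n(C)$; a class in $\mathrm{coHH}_s(C)$ of a cocycle of internal degree $t$ has bidegree $(s,t)$. If $C$ is (graded) cocommutative, $X$ is a cosimplicial coalgebra, and the coproduct of $\mathrm{coHH}_*(C)$ is the composite of the map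 $$\mathrm{coHH}_*(C)\to H^*(N(\mathrm{diag}(X\otimes X)))$$ induced by the coproducts of the coalgebras $X^n$ with the inverse of the Alexander–Whitney isomorphism $$\mathrm{coHH}_*(C)\otimes\mathrm{coHH}_*(C)\xrightarrow{\ \cong\ }H^*(N(\mathrm{diag}(X\otimes X))),\qquad [x]\otimes[y]\mapsto[\delta_{p+q}\cdots\delta_{p+1}x\otimes\delta_0^{\,p}\,y]\quad(x\in N^p,\ y\in N^q).$$ The counit is induced by $\varepsilon$ on $\mathrm{coHH}_0(C)\subseteq C$ and is zero in positive cohomological degrees. **The coalgebras.** Let $I$ be a linearly ordered set (the order only serves to write monomials), and let $i\mapsto|i|\in\mathbb{Z}_{\ge 0}$ be degrees such that only finitely many $i\in I$ have any given degree. * $\Gamma_k[x_i]$ is the divided power Hopf algebra, with basis the monomials $\prod_i\gamma_{a_i}(x_i)$ ($a_i\ge0$, almost all zero), $\Delta(\prod_i\gamma_{a_i}(x_i))=\sum_{b+c=a}\prod_i\gamma_{b_i}(x_i)\otimes\prod_i\gamma_{c_i}(x_i)$, and counit zero on all monomials except $1$. * $\Lambda_k(y_i)$ is the exterior Hopf algebra,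 with $\Delta$ the map of graded algebras into $\Lambda\otimes\Lambda$ (with the Koszul sign in its product, the generators being odd) such that $\Delta(y_i)=y_i\otimes1+1\otimes y_i$, and with counit $\varepsilon(y_i)=0$, $\varepsilon(1)=1$. * $k[w_i]$ is the polynomial Hopf algebra, with $\Delta$ the algebra map such that $\Delta(w_i)=w_i\otimes1+1\otimes w_i$, so that $\Delta(w_i^j)=\sum_l\binom jl w_i^l\otimes w_i^{j-l}$, and with counit $\varepsilon(w_i)=0$, $\varepsilon(1)=1$. * The tensor product of two bigraded coalgebras $V$, $W$ has coproduct $(V\otimes\tau\otimes W)(\Delta_V\otimes\Delta_W)$, where $\tau(v\otimes w)=(-1)^{ss'+tt'}w\otimes v$ for $v$, $w$ of bidegrees $(s,t)$, $(s',t')$, and counit $\varepsilon_V\otimes\varepsilon_W$. **Proposition.** 1. Suppose that all $|i|$ are even, and give $x_i$ the degree $|i|$. Then the above composite is a well-defined coproduct on $\mathrm{coHH}_*(\Gamma_k[x_i])$, and there is an isomorphism of bigraded coalgebras $$\mathrm{coHH}_*(\Gamma_k[x_i : i\in I])\cong\Gamma_k[x_i : i\in I]\otimes\Lambda_k(z_i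 : i\in I),$$ with $x_i$ in bidegree $(0,|i|)$ and $z_i$ in bidegree $(1,|i|)$. 2. Suppose that all $|i|$ are odd, and give $y_i$ the degree $|i|$. Then the above composite is a well-defined coproduct on $\mathrm{coHH}_*(\Lambda_k(y_i))$, and there is an isomorphism of bigraded coalgebras $$\mathrm{coHH}_*(\Lambda_k(y_i : i\in I))\cong\Lambda_k(y_i : i\in I)\otimes k[w_i : i\in I],$$ with $y_i$ in bidegree $(0,|i|)$ and $w_i$ in bidegree $(1,|i|)$. -/

import Mathlib

open scoped TensorProduct DirectSum

namespace CoHochschild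
noncomputable section

section Graded

variable {k : Type*} [Field k]

/-- The degree `d` part of a vector space with a basis `b` whose members are homogeneous, the
basis vector `b i` having degree `deg i`. -/
def homogeneous {I D V : Type*} [AddCommGroup V] [Module k V] (b : Module.Basis I k V)
    (deg : I → D) (d : D) : Submodule k V :=
  Submodule.span k (b '' {i | deg i = d})

theorem basis_mem_homogeneous {I D V : Type*} [AddCommGroup V] [Module k V]
    (b : Module.Basis I k V) (deg : I → D) (i : I) : b i ∈ homogeneous b deg (deg i) :=
  Submodule.subset_span ⟨i, rfl, rfl⟩

instance homogeneousDecomposition {I D V : Type*} [DecidableEq D] [AddCommGroup V] [Module k V]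
    (b : Module.Basis I k V) (deg : I → D) :
    DirectSum.Decomposition (homogeneous b deg) :=
  DirectSum.Decomposition.ofLinearMap _
    (b.constr k fun i => DirectSum.lof k D (fun d => homogeneous b deg d) (deg i)
      ⟨b i, basis_mem_homogeneous b deg i⟩)
    (by
      refine b.ext fun i => ?_
      simp [Module.Basis.constr_basis])
    (by
      refine DirectSum.linearMap_ext _ fun d => LinearMap.ext fun x => ?_
      obtain ⟨x, hx⟩ := x
      simp only [LinearMap.comp_apply, DirectSum.coeLinearMap_lof, LinearMap.id_apply]
      induction hx using Submodule.span_induction with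
      | mem x h =>
        obtain ⟨i, rfl, rfl⟩ := h
        simp [Module.Basis.constr_basis]
      | zero => 
        rw [map_zero]; exact (map_zero _).symm
      | add x y hx hy h1 h2 =>
        rw [map_add, h1, h2, ← map_add]; rfl
      | smul a x hx h1 =>
        rw [map_smul, h1, ← map_smul]; rfl)

variable {D E V W : Type*} [DecidableEq D] [DecidableEq E]
  [AddCommGroup V] [Module k V] [AddCommGroup W] [Module k W]

/-- The symmetry isomorphism `V ⊗ W → W ⊗ V` of graded vector spaces for the sign rule `sgn`: it
sends `v ⊗ w` to `sgn i j • w ⊗ v` for `v` of degree `i` and `w` of degree `j` (see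
`symmetry_tmul`). -/
def symmetry (sgn : D → E → ℤˣ) (𝒱 : D → Submodule k V) (𝒲 : E → Submodule k W)
    [DirectSum.Decomposition 𝒱] [DirectSum.Decomposition 𝒲] : V ⊗[k] W →ₗ[k] W ⊗[k] V :=
  DirectSum.toModule k (D × E) _
      (fun ij => (sgn ij.1 ij.2 : ℤ) •
        ((TensorProduct.comm k V W).toLinearMap ∘ₗ
          TensorProduct.map (𝒱 ij.1).subtype (𝒲 ij.2).subtype))
    ∘ₗ (TensorProduct.directSum k k (fun i => 𝒱 i) (fun j => 𝒲 j)).toLinearMap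
    ∘ₗ TensorProduct.map (DirectSum.decomposeLinearEquiv 𝒱).toLinearMap
        (DirectSum.decomposeLinearEquiv 𝒲).toLinearMap

theorem symmetry_tmul (sgn : D → E → ℤˣ) (𝒱 : D → Submodule k V) (𝒲 : E → Submodule k W)
    [DirectSum.Decomposition 𝒱] [DirectSum.Decomposition 𝒲] {i : D} {j : E} {v : V} {w : W}
    (hv : v ∈ 𝒱 i) (hw : w ∈ 𝒲 j) :
    symmetry sgn 𝒱 𝒲 (v ⊗ₜ[k] w) = (sgn i j : ℤ) • (w ⊗ₜ[k] v) := by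
  lift v to 𝒱 i using hv
  lift w to 𝒲 j using hw
  simp only [symmetry, LinearMap.comp_apply, TensorProduct.map_tmul, LinearEquiv.coe_coe,
    DirectSum.decomposeLinearEquiv_apply_coe, TensorProduct.directSum_lof_tmul_lof,
    DirectSum.toModule_lof, LinearMap.smul_apply, Submodule.subtype_apply, TensorProduct.comm_tmul]

/-- The Koszul sign `(-1) ^ (s t)` of graded vector spaces. -/
def koszulSign (s t : ℕ) : ℤˣ := (-1) ^ (s * t)

/-- The Koszul sign `(-1) ^ (s s' + t t')` of bigraded vector spaces: the cohomological degrees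
`s`, `s'` and the internal degrees `t`, `t'` contribute separately. -/
def bigradedSign (a b : ℕ × ℕ) : ℤˣ := (-1) ^ (a.1 * b.1 + a.2 * b.2)

/-- `V ⊗ τ ⊗ W : (V ⊗ V) ⊗ (W ⊗ W) → (V ⊗ W) ⊗ (V ⊗ W)` -/
def interchange (τ : V ⊗[k] W →ₗ[k] W ⊗[k] V) :
    (V ⊗[k] V) ⊗[k] (W ⊗[k] W) →ₗ[k] (V ⊗[k] W) ⊗[k] (V ⊗[k] W) :=
  (TensorProduct.assoc k V W (V ⊗[k] W)).symm.toLinearMap ∘ₗ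
    LinearMap.lTensor V
      ((TensorProduct.assoc k W V W).toLinearMap ∘ₗ LinearMap.rTensor W τ ∘ₗ
        (TensorProduct.assoc k V W W).symm.toLinearMap) ∘ₗ
    (TensorProduct.assoc k V V (W ⊗[k] W)).toLinearMap

/-- The comultiplication `(V ⊗ τ ⊗ W) (Δ_V ⊗ Δ_W)` of the tensor product of two bigraded
coalgebras. -/
def bigradedComul (ΔV : V →ₗ[k] V ⊗[k] V) (ΔW : W →ₗ[k] W ⊗[k] W)
    (𝒱 : ℕ × ℕ → Submodule k V) (𝒲 : ℕ × ℕ → Submodule k W)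
    [DirectSum.Decomposition 𝒱] [DirectSum.Decomposition 𝒲] :
    V ⊗[k] W →ₗ[k] (V ⊗[k] W) ⊗[k] (V ⊗[k] W) :=
  interchange (symmetry bigradedSign 𝒱 𝒲) ∘ₗ TensorProduct.map ΔV ΔW

/-- The counit `ε_V ⊗ ε_W` of the tensor product of two coalgebras. -/
def tensorCounit (εV : V →ₗ[k] k) (εW : W →ₗ[k] k) : V ⊗[k] W →ₗ[k] k :=
  (TensorProduct.lid k k).toLinearMap ∘ₗ TensorProduct.map εV εW

end Graded

section DividedPower

/-- The underlying vector space of the divided power Hopf algebra `Γ_k[x_i : i ∈ ι]`, with basis the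
monomials `∏ i, γ_{a i}(x_i)`, one for each finitely supported `a : ι → ℕ`. -/
def DividedPower (k ι : Type*) [Field k] : Type _ := (ι →₀ ℕ) →₀ k

variable {k ι : Type*} [Field k]

instance : AddCommGroup (DividedPower k ι) := inferInstanceAs (AddCommGroup ((ι →₀ ℕ) →₀ k))
instance : Module k (DividedPower k ι) := inferInstanceAs (Module k ((ι →₀ ℕ) →₀ k))

/-- The monomial basis of `Γ_k[x_i]`: `γ k ι a` is `∏ i, γ_{a i}(x_i)`. -/
def γ (k ι : Type*) [Field k] : Module.Basis (ι →₀ ℕ) k (DividedPower k ι) :=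
  .ofRepr (LinearEquiv.refl k ((ι →₀ ℕ) →₀ k))

variable [DecidableEq ι]

/-- `Δ (∏ γ_{a i}(x_i)) = ∑_{b + c = a} ∏ γ_{b i}(x_i) ⊗ ∏ γ_{c i}(x_i)` and
`ε (∏ γ_{a i}(x_i)) = 0` unless `a = 0`. No signs occur, as the `x_i` have even degree. -/
instance : CoalgebraStruct k (DividedPower k ι) where
  comul := (γ k ι).constr k fun a => ∑ p ∈ Finset.HasAntidiagonal.antidiagonal a, γ k ι p.1 ⊗ₜ[k] γ k ι p.2
  counit := (γ k ι).constr k fun a => if a = 0 then 1 else 0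

theorem DividedPower.comul_γ (a : ι →₀ ℕ) : CoalgebraStruct.comul (R := k) (γ k ι a) =
    ∑ p ∈ Finset.HasAntidiagonal.antidiagonal a, γ k ι p.1 ⊗ₜ[k] γ k ι p.2 :=
  (γ k ι).constr_basis k _ a

theorem DividedPower.counit_γ (a : ι →₀ ℕ) :
    CoalgebraStruct.counit (R := k) (γ k ι a) = if a = 0 then 1 else 0 :=
  (γ k ι).constr_basis k _ a

instance : Coalgebra k (DividedPower k ι) where
  coassoc := by
    refine (γ k ι).ext fun a => ?_
    simp only [LinearMap.comp_apply, DividedPower.comul_γ, map_sum, LinearMap.rTensor_tmul,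
      LinearMap.lTensor_tmul, TensorProduct.sum_tmul, TensorProduct.tmul_sum, LinearEquiv.coe_coe,
      TensorProduct.assoc_tmul, Finset.sum_sigma']
    apply Finset.sum_nbij' (fun ⟨⟨_i, j⟩, ⟨k, l⟩⟩ ↦ ⟨(k, l + j), (l, j)⟩)
      (fun ⟨⟨i, _j⟩, ⟨k, l⟩⟩ ↦ ⟨(i + k, l), (i, k)⟩) <;> simp +contextual [add_assoc]
    all_goals grind
  rTensor_counit_comp_comul := by
    refine (γ k ι).ext fun a => ?_
    simp only [LinearMap.comp_apply, DividedPower.comul_γ, map_sum, LinearMap.rTensor_tmul,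
      DividedPower.counit_γ]
    rw [Finset.sum_eq_single (0, a)]
    · simp
    · rintro ⟨b, c⟩ h1 h2
      rw [if_neg, TensorProduct.zero_tmul]
      rintro rfl
      simp_all
    · simp
  lTensor_counit_comp_comul := by
    refine (γ k ι).ext fun a => ?_
    simp only [LinearMap.comp_apply, DividedPower.comul_γ, map_sum, LinearMap.lTensor_tmul,
      DividedPower.counit_γ]
    rw [Finset.sum_eq_single (a, 0)]
    · simp
    · rintro ⟨b, c⟩ h1 h2
      rw [if_neg, TensorProduct.tmul_zero]
      rintro rfl
      simp_all
    · simp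

end DividedPower

section Exterior

variable {k M : Type*} [Field k] [AddCommGroup M] [Module k M]

open ExteriorAlgebra

/-- The grading of the exterior algebra by word length. -/
abbrev wordGrading (k M : Type*) [Field k] [AddCommGroup M] [Module k M] : ℕ → Submodule k (ExteriorAlgebra k M) := fun n => ⋀[k]^n M

/-- The comultiplication of the exterior Hopf algebra: the algebra map `Λ M → Λ M ⊗ Λ M` sending
`m ∈ M` to `m ⊗ 1 + 1 ⊗ m`, the product of the target being
`(a ⊗ b) (a' ⊗ b') = (-1) ^ (|b| |a'|) a a' ⊗ b b'` with `|·|` the word length. If the generators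
all have odd degree then word length and degree have the same parity; if they all have bidegree
`(1, even)` then word length and bidegree define the same signs. -/
def exteriorComul (k M : Type*) [Field k] [AddCommGroup M] [Module k M] :
    ExteriorAlgebra k M →ₐ[k] GradedTensorProduct k (wordGrading k M) (wordGrading k M) :=
  ExteriorAlgebra.lift k
    ⟨(GradedTensorProduct.of k (wordGrading k M) (wordGrading k M)).toLinearMap ∘ₗ
        ((TensorProduct.mk k _ _).flip 1 ∘ₗ ExteriorAlgebra.ι k +
          TensorProduct.mk k _ _ 1 ∘ₗ ExteriorAlgebra.ι k), by
      intro m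
      have h1 : ExteriorAlgebra.ι k m ∈ wordGrading k M 1 := by
        simp [wordGrading, exteriorPower]
      have h0 : (1 : ExteriorAlgebra k M) ∈ wordGrading k M 0 := by
        simp [wordGrading, exteriorPower]
      have key := fun (a b c d : ExteriorAlgebra k M) {i j : ℕ} (hb : b ∈ wordGrading k M j)
        (hc : c ∈ wordGrading k M i) =>
          GradedTensorProduct.tmul_coe_mul_coe_tmul (R := k) (wordGrading k M) (wordGrading k M)
            a ⟨b, hb⟩ ⟨c, hc⟩ d
      have e1 := key (ExteriorAlgebra.ι k m) 1 (ExteriorAlgebra.ι k m) 1 h0 h1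
      have e2 := key (ExteriorAlgebra.ι k m) 1 1 (ExteriorAlgebra.ι k m) h0 h0
      have e3 := key 1 (ExteriorAlgebra.ι k m) (ExteriorAlgebra.ι k m) 1 h1 h1
      have e4 := key 1 (ExteriorAlgebra.ι k m) 1 (ExteriorAlgebra.ι k m) h1 h0
      simp only [LinearMap.comp_apply, LinearMap.add_apply, LinearMap.flip_apply,
        TensorProduct.mk_apply, map_add, add_mul, mul_add, LinearEquiv.coe_coe] at e1 e2 e3 e4 ⊢
      rw [e1, e2, e3, e4]
      simp [GradedTensorProduct.tmul]⟩


/-- The automorphism of the exterior algebra with `m ↦ -m` for `m ∈ M`. -/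
def gradeInvolution : ExteriorAlgebra k M →ₐ[k] ExteriorAlgebra k M :=
  ExteriorAlgebra.map (-LinearMap.id)

theorem gradeInvolution_of_mem {n : ℕ} {x : ExteriorAlgebra k M} (hx : x ∈ wordGrading k M n) :
    gradeInvolution x = ((-1 : ℤˣ) ^ n : ℤˣ) • x := by
  refine Submodule.pow_induction_on_left' (LinearMap.range (ExteriorAlgebra.ι k : M →ₗ[k] _))
    (C := fun n x _ => gradeInvolution x = ((-1 : ℤˣ) ^ n : ℤˣ) • x) ?_ ?_ ?_ hx
  · intro r; simp [gradeInvolution]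
  · intro x y i hx hy h1 h2; rw [map_add, h1, h2, smul_add]
  · rintro _ ⟨m, rfl⟩ i x hx h
    rw [map_mul, h]
    simp only [gradeInvolution, ExteriorAlgebra.map_apply_ι, LinearMap.neg_apply,
      LinearMap.id_apply, map_neg, pow_succ, Units.smul_def, mul_smul_comm]
    simp

/-- Left multiplication by `m ⊗ 1 + 1 ⊗ m`. -/
def exteriorStep (m : M) : ExteriorAlgebra k M ⊗[k] ExteriorAlgebra k M →ₗ[k]
    ExteriorAlgebra k M ⊗[k] ExteriorAlgebra k M :=
  LinearMap.rTensor _ (LinearMap.mulLeft k (ExteriorAlgebra.ι k m)) +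
    TensorProduct.map gradeInvolution.toLinearMap (LinearMap.mulLeft k (ExteriorAlgebra.ι k m))

/-- Left multiplication by `m ⊗ 1 ⊗ 1 + 1 ⊗ m ⊗ 1 + 1 ⊗ 1 ⊗ m`. -/
def exteriorStep₃ (m : M) :
    ExteriorAlgebra k M ⊗[k] (ExteriorAlgebra k M ⊗[k] ExteriorAlgebra k M) →ₗ[k]
    ExteriorAlgebra k M ⊗[k] (ExteriorAlgebra k M ⊗[k] ExteriorAlgebra k M) :=
  LinearMap.rTensor _ (LinearMap.mulLeft k (ExteriorAlgebra.ι k m)) +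
    TensorProduct.map gradeInvolution.toLinearMap (exteriorStep m)

/-- `exteriorComul` as a linear map to the ordinary tensor product. -/
def exteriorComulLinear : ExteriorAlgebra k M →ₗ[k] ExteriorAlgebra k M ⊗[k] ExteriorAlgebra k M :=
  (GradedTensorProduct.of k (wordGrading k M) (wordGrading k M)).symm.toLinearMap ∘ₗ
    (exteriorComul k M).toLinearMap

theorem exteriorComul_mul (m : M) (x : ExteriorAlgebra k M) :
    exteriorComulLinear (ExteriorAlgebra.ι k m * x) = exteriorStep m (exteriorComulLinear x) := by
  simp only [exteriorComulLinear, LinearMap.comp_apply, AlgHom.toLinearMap_apply, map_mul]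
  generalize exteriorComul k M x = t
  have h1 : ExteriorAlgebra.ι k m ∈ wordGrading k M 1 := by
    simp [wordGrading, exteriorPower]
  have h0 : (1 : ExteriorAlgebra k M) ∈ wordGrading k M 0 := by
    simp [wordGrading, exteriorPower]
  have key := fun (a b c d : ExteriorAlgebra k M) {i j : ℕ} (hb : b ∈ wordGrading k M j)
    (hc : c ∈ wordGrading k M i) =>
      GradedTensorProduct.tmul_coe_mul_coe_tmul (R := k) (wordGrading k M) (wordGrading k M)
        a ⟨b, hb⟩ ⟨c, hc⟩ d
  have e : exteriorComul k M (ExteriorAlgebra.ι k m) =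
      GradedTensorProduct.of k (wordGrading k M) (wordGrading k M)
        (ExteriorAlgebra.ι k m ⊗ₜ 1 + 1 ⊗ₜ ExteriorAlgebra.ι k m) := by
    simp [exteriorComul]
  rw [e]
  obtain ⟨t, rfl⟩ := (GradedTensorProduct.of k (wordGrading k M) (wordGrading k M)).surjective t
  simp only [LinearEquiv.coe_coe, GradedTensorProduct.of_symm_of]
  induction t using TensorProduct.induction_on with
  | zero => simp
  | add s t h1 h2 => simp only [map_add, mul_add] at h1 h2 ⊢; rw [h1, h2]
  | tmul a b =>
    induction a using DirectSum.Decomposition.inductionOn (wordGrading k M) with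
    | zero => simp
    | add s t h1 h2 =>
      simp only [map_add, mul_add, TensorProduct.add_tmul] at h1 h2 ⊢; rw [h1, h2]
    | homogeneous a =>
      rename_i i
      have e1 := key (ExteriorAlgebra.ι k m) 1 a b h0 a.2
      have e2 := key 1 (ExteriorAlgebra.ι k m) a b h1 a.2
      simp only [GradedTensorProduct.tmul] at e1 e2
      rw [map_add, add_mul, e1, e2]
      simp only [exteriorStep, LinearMap.add_apply, LinearMap.rTensor_tmul,
        TensorProduct.map_tmul, LinearMap.mulLeft_apply, AlgHom.toLinearMap_apply,
        gradeInvolution_of_mem a.2, map_add, one_mul, Units.smul_def, map_zsmul,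
        GradedTensorProduct.of_symm_of, zero_mul, uzpow_zero, Units.val_one, one_zsmul,
        TensorProduct.smul_tmul']

theorem exteriorComul_one : exteriorComulLinear (1 : ExteriorAlgebra k M) = 1 ⊗ₜ 1 := by
  simp [exteriorComulLinear]; rfl

theorem exteriorComul_algebraMap (r : k) :
    exteriorComulLinear (algebraMap k (ExteriorAlgebra k M) r) = r • (1 ⊗ₜ 1) := by
  rw [Algebra.algebraMap_eq_smul_one, map_smul, exteriorComul_one]

theorem exteriorComul_gradeInvolution (x : ExteriorAlgebra k M) :
    exteriorComulLinear (gradeInvolution x) =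
      TensorProduct.map gradeInvolution.toLinearMap gradeInvolution.toLinearMap
        (exteriorComulLinear x) := by
  induction x using CliffordAlgebra.left_induction with
  | algebraMap r => 
    erw [exteriorComul_algebraMap, AlgHom.commutes, exteriorComul_algebraMap]
    simp
  | add x y hx hy => simp only [map_add, hx, hy]
  | ι_mul x m hx =>
    change exteriorComulLinear (gradeInvolution (ExteriorAlgebra.ι k m * x)) =
      TensorProduct.map _ _ (exteriorComulLinear (ExteriorAlgebra.ι k m * x))
    have e : gradeInvolution (ExteriorAlgebra.ι k m) = - ExteriorAlgebra.ι k m := by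
      simp [gradeInvolution]
    rw [map_mul, e, neg_mul, map_neg, exteriorComul_mul, exteriorComul_mul, hx]
    generalize exteriorComulLinear x = t
    induction t using TensorProduct.induction_on with
    | zero => simp
    | add s t h1 h2 => rw [map_add, map_add, neg_add, h1, h2, ← map_add, ← map_add]
    | tmul a b =>
      simp [exteriorStep, e, TensorProduct.neg_tmul, TensorProduct.tmul_neg, add_comm]

instance : CoalgebraStruct k (ExteriorAlgebra k M) where
  comul := exteriorComulLinear
  counit := (ExteriorAlgebra.algebraMapInv : ExteriorAlgebra k M →ₐ[k] k).toLinearMap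

theorem exteriorCounit_mul (m : M) (x : ExteriorAlgebra k M) :
    CoalgebraStruct.counit (R := k) (ExteriorAlgebra.ι k m * x) = 0 := by
  change ExteriorAlgebra.algebraMapInv _ = 0
  simp [ExteriorAlgebra.algebraMapInv]

theorem exteriorCounit_one :
    CoalgebraStruct.counit (R := k) (1 : ExteriorAlgebra k M) = 1 :=
  map_one (ExteriorAlgebra.algebraMapInv : ExteriorAlgebra k M →ₐ[k] k)

theorem exteriorCounit_gradeInvolution (x : ExteriorAlgebra k M) :
    CoalgebraStruct.counit (R := k) (gradeInvolution x) = CoalgebraStruct.counit (R := k) x := by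
  change ExteriorAlgebra.algebraMapInv _ = ExteriorAlgebra.algebraMapInv _
  rw [← AlgHom.comp_apply]
  congr 1
  ext m
  simp [gradeInvolution, ExteriorAlgebra.algebraMapInv]

instance : Coalgebra k (ExteriorAlgebra k M) where
  coassoc := by
    refine LinearMap.ext fun x => ?_
    change TensorProduct.assoc k _ _ _ (LinearMap.rTensor _ exteriorComulLinear
      (exteriorComulLinear x)) = LinearMap.lTensor _ exteriorComulLinear (exteriorComulLinear x)
    induction x using CliffordAlgebra.left_induction with
    | algebraMap r =>
      erw [exteriorComul_algebraMap]
      simp [exteriorComul_one]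
    | add x y hx hy => simp only [map_add, hx, hy]
    | ι_mul x m hx =>
      erw [exteriorComul_mul]
      have hl : ∀ t, LinearMap.lTensor _ exteriorComulLinear (exteriorStep m t) =
          exteriorStep₃ (k := k) m
          (LinearMap.lTensor _ exteriorComulLinear t) := by
        intro t
        induction t using TensorProduct.induction_on with
        | zero => simp
        | add s t h1 h2 => simp only [map_add, h1, h2]
        | tmul a b => simp [exteriorStep, exteriorStep₃, exteriorComul_mul]
      have hr : ∀ t, TensorProduct.assoc k _ _ _
            (LinearMap.rTensor _ exteriorComulLinear (exteriorStep m t)) =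
          exteriorStep₃ (k := k) m
          (TensorProduct.assoc k _ _ _ (LinearMap.rTensor _ exteriorComulLinear t)) := by
        intro t
        induction t using TensorProduct.induction_on with
        | zero => simp
        | add s t h1 h2 => simp only [map_add, h1, h2]
        | tmul a b =>
          have e : exteriorStep m (a ⊗ₜ b) = (ExteriorAlgebra.ι k m * a) ⊗ₜ b +
              gradeInvolution a ⊗ₜ (ExteriorAlgebra.ι k m * b) := by
            simp [exteriorStep]
          rw [e, map_add, LinearMap.rTensor_tmul, LinearMap.rTensor_tmul, LinearMap.rTensor_tmul,
            exteriorComul_mul, exteriorComul_gradeInvolution]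
          generalize exteriorComulLinear a = s
          induction s using TensorProduct.induction_on with
          | zero => simp
          | add s t h1 h2 =>
            simp only [map_add, TensorProduct.add_tmul] at h1 h2 ⊢
            rw [← h1, ← h2]
            abel
          | tmul c d =>
            simp [exteriorStep, exteriorStep₃, TensorProduct.add_tmul, TensorProduct.tmul_add]
            abel
      rw [hl, hr, hx]
  rTensor_counit_comp_comul := by
    refine LinearMap.ext fun x => ?_
    change LinearMap.rTensor _ CoalgebraStruct.counit (exteriorComulLinear x) = 1 ⊗ₜ x
    induction x using CliffordAlgebra.left_induction with
    | algebraMap r =>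
      erw [exteriorComul_algebraMap]
      simp [exteriorCounit_one, Algebra.algebraMap_eq_smul_one]
    | add x y hx hy => simp only [map_add, hx, hy, TensorProduct.tmul_add]
    | ι_mul x m hx =>
      erw [exteriorComul_mul]
      have h : ∀ t, LinearMap.rTensor (ExteriorAlgebra k M) (CoalgebraStruct.counit (R := k))
          (exteriorStep m t) = LinearMap.lTensor _ (LinearMap.mulLeft k (ExteriorAlgebra.ι k m))
            (LinearMap.rTensor (ExteriorAlgebra k M) (CoalgebraStruct.counit (R := k)) t) := by
        intro t
        induction t using TensorProduct.induction_on with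
        | zero => simp
        | add s t h1 h2 => simp only [map_add, h1, h2]
        | tmul a b => simp [exteriorStep, exteriorCounit_mul, exteriorCounit_gradeInvolution]
      rw [h, hx]
      rfl
  lTensor_counit_comp_comul := by
    refine LinearMap.ext fun x => ?_
    change LinearMap.lTensor _ CoalgebraStruct.counit (exteriorComulLinear x) = x ⊗ₜ 1
    induction x using CliffordAlgebra.left_induction with
    | algebraMap r =>
      erw [exteriorComul_algebraMap]
      simp [exteriorCounit_one, Algebra.algebraMap_eq_smul_one, TensorProduct.smul_tmul']
    | add x y hx hy => simp only [map_add, hx, hy, TensorProduct.add_tmul]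
    | ι_mul x m hx =>
      erw [exteriorComul_mul]
      have h : ∀ t, LinearMap.lTensor (ExteriorAlgebra k M) (CoalgebraStruct.counit (R := k))
          (exteriorStep m t) = LinearMap.rTensor _ (LinearMap.mulLeft k (ExteriorAlgebra.ι k m))
            (LinearMap.lTensor (ExteriorAlgebra k M) (CoalgebraStruct.counit (R := k)) t) := by
        intro t
        induction t using TensorProduct.induction_on with
        | zero => simp
        | add s t h1 h2 => simp only [map_add, h1, h2]
        | tmul a b => simp [exteriorStep, exteriorCounit_mul]
      rw [h, hx]
      rfl

end Exterior

section Polynomial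

variable {k ι : Type*} [Field k]

/-- The comultiplication of the polynomial Hopf algebra `k[w_i : i ∈ ι]`: the algebra map with
`w_i ↦ w_i ⊗ 1 + 1 ⊗ w_i`, so that `Δ (w_i ^ j) = ∑ l, (j.choose l) w_i ^ l ⊗ w_i ^ (j - l)`. -/
def polynomialComul (k ι : Type*) [Field k] :
    MvPolynomial ι k →ₐ[k] MvPolynomial ι k ⊗[k] MvPolynomial ι k :=
  MvPolynomial.aeval fun i => MvPolynomial.X i ⊗ₜ 1 + 1 ⊗ₜ MvPolynomial.X i

/-- The counit `w_i ↦ 0` of the polynomial Hopf algebra. -/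
def polynomialCounit (k ι : Type*) [Field k] : MvPolynomial ι k →ₐ[k] k :=
  MvPolynomial.aeval fun _ => 0

end Polynomial

section Cosimplicial

universe u v

variable {k : Type u} [Field k] {X : ℕ → Type v} [∀ n, AddCommGroup (X n)] [∀ n, Module k (X n)]

/-- The normalized cochains `N^n = ⋂ i, ker (σ_i : X^n → X^{n-1})` of a cosimplicial vector space
`X` with codegeneracies `σ`. -/
def normalized (σ : ∀ n, Fin (n + 1) → X (n + 1) →ₗ[k] X n) : ∀ n, Submodule k (X n)
  | 0 => ⊤
  | n + 1 => ⨅ i, LinearMap.ker (σ n i)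

/-- The differential `∑ i, (-1)^i δ_i : X^n → X^{n+1}`. -/
def differential (δ : ∀ n, Fin (n + 2) → X n →ₗ[k] X (n + 1)) (n : ℕ) : X n →ₗ[k] X (n + 1) :=
  ∑ i : Fin (n + 2), (-1 : ℤ) ^ (i : ℕ) • δ n i

/-- The cocycles of the normalized cochain complex. -/
def cocycles (δ : ∀ n, Fin (n + 2) → X n →ₗ[k] X (n + 1))
    (σ : ∀ n, Fin (n + 1) → X (n + 1) →ₗ[k] X n) (n : ℕ) : Submodule k (X n) :=
  normalized σ n ⊓ LinearMap.ker (differential δ n)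

/-- The coboundaries of the normalized cochain complex. -/
def coboundaries (δ : ∀ n, Fin (n + 2) → X n →ₗ[k] X (n + 1))
    (σ : ∀ n, Fin (n + 1) → X (n + 1) →ₗ[k] X n) : ∀ n, Submodule k (X n)
  | 0 => ⊥
  | n + 1 => (normalized σ n).map (differential δ n)

/-- The cohomology of the normalized cochain complex. -/
abbrev Cohomology (δ : ∀ n, Fin (n + 2) → X n →ₗ[k] X (n + 1))
    (σ : ∀ n, Fin (n + 1) → X (n + 1) →ₗ[k] X n) (n : ℕ) : Type v :=
  cocycles δ σ n ⧸ (coboundaries δ σ n).submoduleOf (cocycles δ σ n)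

end Cosimplicial

section TensorPowers

universe u v

/-- `TensorPow k C n` is the tensor power `C^{⊗ (n+1)} = C ⊗ (C ⊗ (⋯ ⊗ C))`. -/
def TensorPow (k : Type u) [Field k] (C : Type v) [AddCommGroup C] [Module k C] :
    ℕ → ModuleCat.{v} k
  | 0 => ModuleCat.of k C
  | n + 1 => ModuleCat.of k (C ⊗[k] TensorPow k C n)

variable {k : Type u} [Field k] {C : Type v} [AddCommGroup C] [Module k C]

/-- The symmetry `τ_{C, C^{⊗ (n+1)}}`, built from `τ = τ_{C, C}` by moving the first factor past
the others one at a time. -/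
def braidPast (τ : C ⊗[k] C →ₗ[k] C ⊗[k] C) :
    ∀ n, C ⊗[k] TensorPow k C n →ₗ[k] TensorPow k C n ⊗[k] C
  | 0 => τ
  | n + 1 =>
    (TensorProduct.assoc k C (TensorPow k C n) C).symm.toLinearMap ∘ₗ
      LinearMap.lTensor C (braidPast τ n) ∘ₗ
      (TensorProduct.assoc k C C (TensorPow k C n)).toLinearMap ∘ₗ
      LinearMap.rTensor (TensorPow k C n) τ ∘ₗ
      (TensorProduct.assoc k C C (TensorPow k C n)).symm.toLinearMap

/-- The identification of `C^{⊗ (n+1)} ⊗ C` with `C^{⊗ (n+2)}`. -/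
def snoc (k : Type u) [Field k] (C : Type v) [AddCommGroup C] [Module k C] :
    ∀ n, TensorPow k C n ⊗[k] C →ₗ[k] TensorPow k C (n + 1)
  | 0 => LinearMap.id
  | n + 1 => LinearMap.lTensor C (snoc k C n) ∘ₗ
      (TensorProduct.assoc k C (TensorPow k C n) C).toLinearMap

/-- The identity, for propositionally equal exponents. -/
def castPow (k : Type u) [Field k] (C : Type v) [AddCommGroup C] [Module k C] {m n : ℕ}
    (h : m = n) : TensorPow k C m →ₗ[k] TensorPow k C n :=
  h ▸ LinearMap.id

/-- The part of `C^{⊗ (n+1)}` of total internal degree `t`, for a graded vector space `C`. -/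
def internalDegree (𝒞 : ℕ → Submodule k C) : ∀ n, ℕ → Submodule k (TensorPow k C n)
  | 0 => 𝒞
  | n + 1 => fun t => ⨆ p ∈ Finset.HasAntidiagonal.antidiagonal t,
      LinearMap.range (TensorProduct.map (𝒞 p.1).subtype (internalDegree 𝒞 n p.2).subtype)

end TensorPowers

section CoHH

universe u v

variable {k : Type u} [Field k] {C : Type v} [AddCommGroup C] [Module k C] [Coalgebra k C]

/-- `C^{⊗ i} ⊗ Δ ⊗ C^{⊗ (n-i)} : C^{⊗ (n+1)} → C^{⊗ (n+2)}` for `0 ≤ i ≤ n`. -/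
def comulAt (k : Type u) [Field k] (C : Type v) [AddCommGroup C] [Module k C] [Coalgebra k C] :
    ∀ n, Fin (n + 1) → (TensorPow k C n →ₗ[k] TensorPow k C (n + 1))
  | 0 => fun _ => (CoalgebraStruct.comul : C →ₗ[k] C ⊗[k] C)
  | n + 1 => Fin.cases
      ((TensorProduct.assoc k C C (TensorPow k C n)).toLinearMap ∘ₗ
        LinearMap.rTensor (TensorPow k C n) (CoalgebraStruct.comul : C →ₗ[k] C ⊗[k] C))
      fun i => LinearMap.lTensor C (comulAt k C n i)

/-- The cofaces `δ_i : C^{⊗ (n+1)} → C^{⊗ (n+2)}` of the cosimplicial coHochschild object: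
`C^{⊗ i} ⊗ Δ ⊗ C^{⊗ (n-i)}` for `i ≤ n`, and `τ_{C, C^{⊗ (n+1)}} (Δ ⊗ C^{⊗ n})` for `i = n + 1`. -/
def coface (τ : C ⊗[k] C →ₗ[k] C ⊗[k] C) (n : ℕ) :
    Fin (n + 2) → (TensorPow k C n →ₗ[k] TensorPow k C (n + 1)) :=
  Fin.lastCases (snoc k C n ∘ₗ braidPast τ n ∘ₗ comulAt k C n 0) (comulAt k C n)

/-- The codegeneracies `σ_i = C^{⊗ (i+1)} ⊗ ε ⊗ C^{⊗ (n-i)} : C^{⊗ (n+2)} → C^{⊗ (n+1)}` for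
`0 ≤ i ≤ n` of the cosimplicial coHochschild object. -/
def codegeneracy (k : Type u) [Field k] (C : Type v) [AddCommGroup C] [Module k C]
    [Coalgebra k C] : ∀ n, Fin (n + 1) → (TensorPow k C (n + 1) →ₗ[k] TensorPow k C n)
  | 0 => fun _ => (TensorProduct.rid k C).toLinearMap ∘ₗ
      LinearMap.lTensor C (CoalgebraStruct.counit : C →ₗ[k] k)
  | n + 1 => Fin.cases
      (LinearMap.lTensor C ((TensorProduct.lid k (TensorPow k C n)).toLinearMap ∘ₗ
        LinearMap.rTensor (TensorPow k C n) (CoalgebraStruct.counit : C →ₗ[k] k)))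
      fun i => LinearMap.lTensor C (codegeneracy k C n i)

/-- The comultiplication of the coalgebra `C^{⊗ (n+1)}`, where
`Δ_{C ⊗ D} = (C ⊗ τ_{C, D} ⊗ D) (Δ_C ⊗ Δ_D)`. -/
def comulPow (τ : C ⊗[k] C →ₗ[k] C ⊗[k] C) :
    ∀ n, TensorPow k C n →ₗ[k] TensorPow k C n ⊗[k] TensorPow k C n
  | 0 => (CoalgebraStruct.comul : C →ₗ[k] C ⊗[k] C)
  | n + 1 => interchange (braidPast τ n) ∘ₗ
      TensorProduct.map (CoalgebraStruct.comul : C →ₗ[k] C ⊗[k] C) (comulPow τ n)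

/-- `δ_{p+q} ⋯ δ_{p+2} δ_{p+1} : C^{⊗ (p+1)} → C^{⊗ (p+q+1)}` -/
def frontMap (τ : C ⊗[k] C →ₗ[k] C ⊗[k] C) (p : ℕ) :
    ∀ q, TensorPow k C p →ₗ[k] TensorPow k C (p + q)
  | 0 => LinearMap.id
  | q + 1 => coface τ (p + q) (Fin.last _) ∘ₗ frontMap τ p q

/-- `δ_0 ⋯ δ_0 : C^{⊗ (q+1)} → C^{⊗ (q+p+1)}` -/
def backMap (τ : C ⊗[k] C →ₗ[k] C ⊗[k] C) (q : ℕ) :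
    ∀ p, TensorPow k C q →ₗ[k] TensorPow k C (q + p)
  | 0 => LinearMap.id
  | p + 1 => coface τ (q + p) 0 ∘ₗ backMap τ q p

/-- The cosimplicial Alexander-Whitney map `X^p ⊗ X^q → X^{p+q} ⊗ X^{p+q}` for
`X^n = C^{⊗ (n+1)}`, given by `x ⊗ y ↦ δ_{p+q} ⋯ δ_{p+1} x ⊗ δ_0 ⋯ δ_0 y`. -/
def alexanderWhitney (τ : C ⊗[k] C →ₗ[k] C ⊗[k] C) (p q : ℕ) :
    TensorPow k C p ⊗[k] TensorPow k C q →ₗ[k]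
      TensorPow k C (p + q) ⊗[k] TensorPow k C (p + q) :=
  TensorProduct.map (frontMap τ p q) (castPow k C (Nat.add_comm q p) ∘ₗ backMap τ q p)

variable (𝒞 : ℕ → Submodule k C) [DirectSum.Decomposition 𝒞]

/-- The symmetry `c ⊗ d ↦ (-1) ^ (|c| |d|) d ⊗ c` of the graded vector space `C`. -/
abbrev koszul : C ⊗[k] C →ₗ[k] C ⊗[k] C := symmetry koszulSign 𝒞 𝒞

/-- Normalized cocycles of the coHochschild complex of a graded coalgebra. -/
abbrev Cocycles (n : ℕ) : Submodule k (TensorPow k C n) :=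
  cocycles (coface (koszul 𝒞)) (codegeneracy k C) n

/-- Normalized coboundaries of the coHochschild complex of a graded coalgebra. -/
abbrev Coboundaries (n : ℕ) : Submodule k (TensorPow k C n) :=
  coboundaries (coface (koszul 𝒞)) (codegeneracy k C) n

/-- The coHochschild homology `coHH_n(C)` of the graded coalgebra `C = ⨁ t, 𝒞 t`: the `n`-th
cohomology of the normalized cochain complex of the cosimplicial coHochschild object. -/
abbrev CoHHAt (n : ℕ) : Type v := Cohomology (coface (koszul 𝒞)) (codegeneracy k C) n

/-- The total coHochschild homology `⨁ n, coHH_n(C)`. -/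
abbrev CoHH : Type v := ⨁ n, CoHHAt 𝒞 n

/-- The map sending a (not necessarily homogeneous) cocycle to its class. -/
def classOf : (⨁ n, Cocycles 𝒞 n) →ₗ[k] CoHH 𝒞 :=
  DirectSum.lmap fun n => ((Coboundaries 𝒞 n).submoduleOf (Cocycles 𝒞 n)).mkQ

/-- The bidegree `(s, t)` part of `coHH(C)`: classes in `coHH_s(C)` of cocycles of internal
degree `t`. -/
def coHHDegree (d : ℕ × ℕ) : Submodule k (CoHH 𝒞) :=
  ((internalDegree 𝒞 d.1 d.2).submoduleOf (Cocycles 𝒞 d.1)).map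
    (classOf 𝒞 ∘ₗ DirectSum.lof k ℕ (fun n => Cocycles 𝒞 n) d.1)

/-- Normalized coboundaries of the diagonal cosimplicial vector space `[n] ↦ X^n ⊗ X^n`, where
`X^n = C^{⊗ (n+1)}`. -/
def diagonalCoboundaries (n : ℕ) : Submodule k (TensorPow k C n ⊗[k] TensorPow k C n) :=
  coboundaries (X := fun n => TensorPow k C n ⊗[k] TensorPow k C n)
    (fun n i => TensorProduct.map (coface (koszul 𝒞) n i) (coface (koszul 𝒞) n i))
    (fun n i => TensorProduct.map (codegeneracy k C n i) (codegeneracy k C n i)) n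

/-- The Alexander-Whitney map on (sums of) tensor products of cocycles. -/
def cocyclesAW : (⨁ n, Cocycles 𝒞 n) ⊗[k] (⨁ n, Cocycles 𝒞 n) →ₗ[k]
    ⨁ n, TensorPow k C n ⊗[k] TensorPow k C n :=
  DirectSum.toModule k (ℕ × ℕ) _
      (fun pq => DirectSum.lof k ℕ (fun n => TensorPow k C n ⊗[k] TensorPow k C n)
          (pq.1 + pq.2) ∘ₗ
        alexanderWhitney (koszul 𝒞) pq.1 pq.2 ∘ₗ
        TensorProduct.map (Cocycles 𝒞 pq.1).subtype (Cocycles 𝒞 pq.2).subtype) ∘ₗ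
    (TensorProduct.directSum k k (fun n => Cocycles 𝒞 n) (fun n => Cocycles 𝒞 n)).toLinearMap

/-- The comultiplications of the coalgebras `C^{⊗ (n+1)}`, applied to cocycles. -/
def cocyclesComul : (⨁ n, Cocycles 𝒞 n) →ₗ[k] ⨁ n, TensorPow k C n ⊗[k] TensorPow k C n :=
  DirectSum.lmap fun n => comulPow (koszul 𝒞) n ∘ₗ (Cocycles 𝒞 n).subtype

/-- `ψ` is the comultiplication of `coHH(C)` (for `C` cocommutative), that is, the composite
`coHH(C) → H(diag (X ⊗ X)) ≅ coHH(C) ⊗ coHH(C)` of the map induced by the comultiplication of the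
cosimplicial coalgebra `X^n = C^{⊗ (n+1)}` with the inverse of the Alexander-Whitney isomorphism:
every `ψ [c]` is represented by some `z` in the tensor square of the cocycles with
`[AW z] = [Δ c]` in `H(diag (X ⊗ X))`. -/
def IsCoHHComul (ψ : CoHH 𝒞 →ₗ[k] CoHH 𝒞 ⊗[k] CoHH 𝒞) : Prop :=
  ∀ c : ⨁ n, Cocycles 𝒞 n, ∃ z : (⨁ n, Cocycles 𝒞 n) ⊗[k] (⨁ n, Cocycles 𝒞 n),
    TensorProduct.map (classOf 𝒞) (classOf 𝒞) z = ψ (classOf 𝒞 c) ∧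
    ∀ n, (cocyclesAW 𝒞 z - cocyclesComul 𝒞 c) n ∈ diagonalCoboundaries 𝒞 n

/-- The counit of `coHH(C)`: induced by `ε` on `coHH_0(C) ⊆ C`, and zero in positive degrees. -/
def coHHCounit : CoHH 𝒞 →ₗ[k] k :=
  DirectSum.toModule k ℕ k fun n =>
    match n with
    | 0 => ((Coboundaries 𝒞 0).submoduleOf (Cocycles 𝒞 0)).liftQ
        ((CoalgebraStruct.counit : C →ₗ[k] k) ∘ₗ (Cocycles 𝒞 0).subtype) (by
          intro x hx
          have h : (x : TensorPow k C 0) = 0 := by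
            simpa [Submodule.submoduleOf, coboundaries] using hx
          change (CoalgebraStruct.counit : C →ₗ[k] k) (x : TensorPow k C 0) = 0
          rw [h]
          exact map_zero _)
    | _ + 1 => 0

/-- `coHH(C)` has exactly one comultiplication `ψ` in the sense of `IsCoHHComul`, and there is a
linear isomorphism from `coHH(C)` to the bigraded coalgebra `(T, ΔT, εT, 𝒯)` that preserves
comultiplication, counit and bidegree. -/
def CoHHIsomorphicTo {T : Type*} [AddCommGroup T] [Module k T] (ΔT : T →ₗ[k] T ⊗[k] T)
    (εT : T →ₗ[k] k) (𝒯 : ℕ × ℕ → Submodule k T) : Prop :=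
  ∃ ψ : CoHH 𝒞 →ₗ[k] CoHH 𝒞 ⊗[k] CoHH 𝒞,
    IsCoHHComul 𝒞 ψ ∧ (∀ ψ', IsCoHHComul 𝒞 ψ' → ψ' = ψ) ∧
    ∃ Φ : CoHH 𝒞 ≃ₗ[k] T,
      (∀ h, ΔT (Φ h) = TensorProduct.map Φ.toLinearMap Φ.toLinearMap (ψ h)) ∧
      (∀ h, εT (Φ h) = coHHCounit 𝒞 h) ∧
      ∀ d, (coHHDegree 𝒞 d).map Φ.toLinearMap = 𝒯 d

end CoHH

section Examples

variable (k : Type*) {ι : Type*} [Field k] [LinearOrder ι] (deg : ι → ℕ)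

/-- The basis of the exterior algebra `Λ_k(y_i : i ∈ ι)` formed by the increasing products
`y_{i_1} ⋯ y_{i_r}`, indexed by the finite sets `{i_1 < ⋯ < i_r}`. -/
def exteriorBasis (k ι : Type*) [Field k] [LinearOrder ι] :
    Module.Basis (Finset ι) k (ExteriorAlgebra k (ι →₀ k)) :=
  (Finsupp.basisSingleOne : Module.Basis ι k (ι →₀ k)).ExteriorAlgebra

/-- The internal degree of `Γ_k[x_i]`, with `x_i` of degree `deg i`. -/
abbrev dividedPowerGrading : ℕ → Submodule k (DividedPower k ι) :=
  homogeneous (γ k ι) fun a => Finsupp.weight deg a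

/-- The internal degree of `Λ_k(y_i)`, with `y_i` of degree `deg i`. -/
abbrev exteriorGrading : ℕ → Submodule k (ExteriorAlgebra k (ι →₀ k)) :=
  homogeneous (exteriorBasis k ι) fun S => ∑ i ∈ S, deg i

/-- Bidegree of a (divided power) monomial in generators of bidegree `(0, deg i)`. -/
abbrev bideg₀ (a : ι →₀ ℕ) : ℕ × ℕ := (0, Finsupp.weight deg a)

/-- Bidegree of a monomial in (polynomial) generators of bidegree `(1, deg i)`. -/
abbrev bideg₁ (a : ι →₀ ℕ) : ℕ × ℕ := (Finsupp.weight (fun _ => 1) a, Finsupp.weight deg a)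

/-- Bidegree of a monomial in exterior generators of bidegree `(0, deg i)`. -/
abbrev extBideg₀ (S : Finset ι) : ℕ × ℕ := (0, ∑ i ∈ S, deg i)

/-- Bidegree of a monomial in exterior generators of bidegree `(1, deg i)`. -/
abbrev extBideg₁ (S : Finset ι) : ℕ × ℕ := (S.card, ∑ i ∈ S, deg i)

/-- Comultiplication of `Γ_k[x_i] ⊗ Λ_k(z_i)`, with `x_i` in bidegree `(0, deg i)` and `z_i` in
bidegree `(1, deg i)`. -/
def dividedExteriorComul :
    DividedPower k ι ⊗[k] ExteriorAlgebra k (ι →₀ k) →ₗ[k]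
      (DividedPower k ι ⊗[k] ExteriorAlgebra k (ι →₀ k)) ⊗[k]
        (DividedPower k ι ⊗[k] ExteriorAlgebra k (ι →₀ k)) :=
  bigradedComul CoalgebraStruct.comul CoalgebraStruct.comul
    (homogeneous (γ k ι) (bideg₀ deg)) (homogeneous (exteriorBasis k ι) (extBideg₁ deg))

/-- Counit of `Γ_k[x_i] ⊗ Λ_k(z_i)`. -/
def dividedExteriorCounit (k ι : Type*) [Field k] [LinearOrder ι] :
    DividedPower k ι ⊗[k] ExteriorAlgebra k (ι →₀ k) →ₗ[k] k :=
  tensorCounit CoalgebraStruct.counit CoalgebraStruct.counit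

/-- Bigrading of `Γ_k[x_i] ⊗ Λ_k(z_i)`. -/
def dividedExteriorDegree :
    ℕ × ℕ → Submodule k (DividedPower k ι ⊗[k] ExteriorAlgebra k (ι →₀ k)) :=
  homogeneous ((γ k ι).tensorProduct (exteriorBasis k ι))
    fun p => bideg₀ deg p.1 + extBideg₁ deg p.2

/-- Comultiplication of `Λ_k(y_i) ⊗ k[w_i]`, with `y_i` in bidegree `(0, deg i)` and `w_i` in
bidegree `(1, deg i)`. -/
def exteriorPolynomialComul :
    ExteriorAlgebra k (ι →₀ k) ⊗[k] MvPolynomial ι k →ₗ[k]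
      (ExteriorAlgebra k (ι →₀ k) ⊗[k] MvPolynomial ι k) ⊗[k]
        (ExteriorAlgebra k (ι →₀ k) ⊗[k] MvPolynomial ι k) :=
  bigradedComul CoalgebraStruct.comul (polynomialComul k ι).toLinearMap
    (homogeneous (exteriorBasis k ι) (extBideg₀ deg))
    (homogeneous (MvPolynomial.basisMonomials ι k) (bideg₁ deg))

/-- Counit of `Λ_k(y_i) ⊗ k[w_i]`. -/
def exteriorPolynomialCounit (k ι : Type*) [Field k] [LinearOrder ι] :
    ExteriorAlgebra k (ι →₀ k) ⊗[k] MvPolynomial ι k →ₗ[k] k :=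
  tensorCounit CoalgebraStruct.counit (polynomialCounit k ι).toLinearMap

/-- Bigrading of `Λ_k(y_i) ⊗ k[w_i]`. -/
def exteriorPolynomialDegree :
    ℕ × ℕ → Submodule k (ExteriorAlgebra k (ι →₀ k) ⊗[k] MvPolynomial ι k) :=
  homogeneous ((exteriorBasis k ι).tensorProduct (MvPolynomial.basisMonomials ι k))
    fun p => extBideg₀ deg p.1 + bideg₁ deg p.2

end Examples

end

end CoHochschild

/-! A monomial of `C` is an exponent vector, and an element of `C^{⊗ (n+1)}` is described by its
coordinates at lists of `n + 1` exponent vectors. Comultiplication is dual to addition of exponents,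
so a coface evaluates a coordinate function at the list in which two neighbours have been added, and
the last coface adds the last entry to the first. In the exterior case exponents are at most one and
Koszul signs occur; rescaling the coordinates by `(-1)` to the number of inversions removes all of
them except the factor `dotSign` of the last coface. Hence a Boolean `odd` treats both cases at
once: `Admissible odd` describes the monomials of `C`, and `Admissible (!odd)` those of the new
factor (exterior if `C` is a divided power coalgebra, polynomial if `C` is exterior).

The linear statement is a Hochschild-Kostant-Rosenberg theorem. Fix the first entry `a` and take the
signed sum of the values of a cochain at `a` followed by all lists of `n` generators with sum `s`
(`evalAlt`). These evaluations kill coboundaries (`evalAlt_hochD`). Conversely, a normalized cocycle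
on which they all vanish is a coboundary (`IsNullHochCocycle.exists_hochD_eq`). To see this, filter
by the degree of the first entry. The faces that touch this entry raise its degree, so the leading
slice is a cocycle of the cobar complex of `C`, to which `isNullCoboundary` applies. That lemma is
Koszul duality: in an induction on the length, the leading terms form a cycle of a Koszul complex,
which is exact by contraction along the smallest generator that occurs (`koszul_exact`). No integer
is inverted, so the characteristic plays no role. Finally, every pair `(a, s)` is attained by an
explicit cocycle, obtained from a single monomial by repeatedly inserting generators (`insertGens`).
So the evaluations identify `coHH(C)` with the target.

For the coproduct, `diag (X ⊗ X)` is a model of the same kind on the doubled generating set `ι ⊕ₗ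
ι`, hence the same detection principle holds for it. Evaluations are multiplicative on
Alexander-Whitney products (`evalAlt_awFun`). On the coproduct of a cocycle they give `dualCoeff`
times the evaluation at the sum (`evalAlt_comulFun`), and `dualCoeff` is the structure constant of
the exterior or polynomial Hopf algebra: both obey the same recursion (`dualCoeff_step`, Pascal's
rule in the polynomial case). Two classes on the diagonal with equal evaluations agree, which gives
existence, uniqueness and the formula for the comultiplication.

The passage from tensor powers to coordinate functions is axiomatized by `IsCoord`,
`CoalgebraModel`, `CosimplicialModel` and `TargetModel`; `coHHIsomorphicTo_of_model` is the theorem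
for any such data, and the two coalgebras of the statement are instances. -/

namespace CoHochschild
noncomputable section

/-! ### Exponent vectors and sign bicharacters -/

section Signs

variable {ι : Type*}

/-- The exponent vector of a generator. -/
abbrev gen (i : ι) : ι →₀ ℕ := Finsupp.single i 1

/-- The pairing `∑ i, a i * b i` of exponent vectors. -/
def dot (a b : ι →₀ ℕ) : ℕ := a.sum fun i m => m * b i

theorem dot_add_left (a a' b : ι →₀ ℕ) : dot (a + a') b = dot a b + dot a' b := by
  classical
  exact Finsupp.sum_add_index' (by simp) (by intros; ring)

theorem dot_add_right (a b b' : ι →₀ ℕ) : dot a (b + b') = dot a b + dot a b' := by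
  simp only [dot, Finsupp.add_apply, mul_add, Finsupp.sum_add]

@[simp] theorem dot_zero_left (b : ι →₀ ℕ) : dot 0 b = 0 := by simp [dot]

@[simp] theorem dot_zero_right (a : ι →₀ ℕ) : dot a 0 = 0 := by simp [dot, Finsupp.sum]

theorem dot_gen_left (i : ι) (b : ι →₀ ℕ) : dot (gen i) b = b i := by simp [dot]

theorem dot_comm (a b : ι →₀ ℕ) : dot a b = dot b a := by
  classical
  induction a using Finsupp.induction_linear with
  | zero => simp
  | add f g hf hg => rw [dot_add_left, dot_add_right, hf, hg]
  | single i m =>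
    simp only [dot, zero_mul, Finsupp.sum_single_index]
    rw [Finsupp.sum, Finset.sum_eq_single i]
    · simp [mul_comm]
    · intro j _ hj; simp [hj.symm]
    · intro h; simp [Finsupp.notMem_support_iff.mp h]

theorem dot_gen_right (i : ι) (a : ι →₀ ℕ) : dot a (gen i) = a i := by
  rw [dot_comm, dot_gen_left]

/-- Exponent vectors of the monomials of a divided power (`odd = false`) or exterior
(`odd = true`) coalgebra. -/
def Admissible (odd : Bool) (a : ι →₀ ℕ) : Prop := odd = true → ∀ i, a i ≤ 1

theorem Admissible.of_le {odd : Bool} {a b : ι →₀ ℕ} (h : Admissible odd b) (hab : a ≤ b) :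
    Admissible odd a := fun ho i => (hab i).trans (h ho i)

theorem Admissible.left {odd : Bool} {a b : ι →₀ ℕ} (h : Admissible odd (a + b)) :
    Admissible odd a := h.of_le le_self_add

theorem Admissible.right {odd : Bool} {a b : ι →₀ ℕ} (h : Admissible odd (a + b)) :
    Admissible odd b := h.of_le le_add_self

theorem admissible_zero (odd : Bool) : Admissible odd (0 : ι →₀ ℕ) := fun _ _ => by simp

theorem admissible_gen (odd : Bool) (i : ι) : Admissible odd (gen i) := fun _ j => by
  classical
  rw [Finsupp.single_apply]; split <;> simp

/-- Entries of `a + b` bounded by one force `a` and `b` to have disjoint supports. -/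
theorem Admissible.dot_eq_zero {a b : ι →₀ ℕ} (h : Admissible true (a + b)) : dot a b = 0 := by
  refine Finset.sum_eq_zero fun i _ => ?_
  have := h rfl i
  simp only [Finsupp.add_apply] at this
  rcases Nat.eq_zero_or_pos (a i) with h0 | h0
  · simp [h0]
  · simp [show b i = 0 by omega]

theorem eq_add_gen {s : ι →₀ ℕ} {i : ι} (h : i ∈ s.support) : s = s - gen i + gen i := by
  classical
  refine (tsub_add_cancel_of_le ?_).symm
  rw [Finsupp.single_le_iff]
  exact Nat.one_le_iff_ne_zero.mpr (Finsupp.mem_support_iff.mp h)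

theorem degree_sub_gen {s : ι →₀ ℕ} {i : ι} (h : i ∈ s.support) :
    s.degree = (s - gen i).degree + 1 := by
  conv_lhs => rw [eq_add_gen h]
  simp

theorem degree_pos_of_ne_zero {b : ι →₀ ℕ} (h : ¬ 0 = b) : 0 < b.degree :=
  Nat.pos_of_ne_zero fun h0 => h ((Finsupp.degree_eq_zero_iff b).mp h0).symm

theorem degree_le_of_le {a b : ι →₀ ℕ} (h : a ≤ b) : a.degree ≤ b.degree := by
  obtain ⟨c, rfl⟩ := exists_add_of_le h
  simp

variable (k : Type*) [Field k]

/-- The sign `1` (`odd = false`) or `-1` (`odd = true`). -/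
def sigma (odd : Bool) : k := if odd then -1 else 1

/-- The sign with which `a` and `b` commute, up to the bicharacter `chi`. -/
def dotSign (odd : Bool) (a b : ι →₀ ℕ) : k := sigma k odd ^ dot a b

variable {k}

theorem sigma_mul_self (odd : Bool) : sigma k odd * sigma k odd = 1 := by
  cases odd <;> simp [sigma]

theorem dotSign_add_left (odd : Bool) (a a' b : ι →₀ ℕ) :
    dotSign k odd (a + a') b = dotSign k odd a b * dotSign k odd a' b := by
  simp only [dotSign, dot_add_left, pow_add]

theorem dotSign_add_right (odd : Bool) (a b b' : ι →₀ ℕ) :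
    dotSign k odd a (b + b') = dotSign k odd a b * dotSign k odd a b' := by
  simp only [dotSign, dot_add_right, pow_add]

theorem dotSign_comm (odd : Bool) (a b : ι →₀ ℕ) : dotSign k odd a b = dotSign k odd b a := by
  simp only [dotSign, dot_comm]

@[simp] theorem dotSign_zero_left (odd : Bool) (b : ι →₀ ℕ) : dotSign k odd 0 b = 1 := by
  simp [dotSign]

@[simp] theorem dotSign_zero_right (odd : Bool) (b : ι →₀ ℕ) : dotSign k odd b 0 = 1 := by
  simp [dotSign]

theorem dotSign_mul_self (odd : Bool) (a b : ι →₀ ℕ) :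
    dotSign k odd a b * dotSign k odd a b = 1 := by
  simp only [dotSign, ← mul_pow, sigma_mul_self, one_pow]

theorem dotSign_of_admissible {odd : Bool} {a b : ι →₀ ℕ} (h : Admissible odd (a + b)) :
    dotSign k odd a b = 1 := by
  cases odd
  · simp [dotSign, sigma]
  · simp [dotSign, h.dot_eq_zero]

theorem dotSign_gen_right (odd : Bool) (a : ι →₀ ℕ) (i : ι) :
    dotSign k odd a (gen i) = sigma k odd ^ a i := by
  rw [dotSign, dot_gen_right]

variable [LinearOrder ι]

/-- The number of inversions between two exponent vectors. -/
def inversions (a b : ι →₀ ℕ) : ℕ :=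
  a.sum fun i m => b.sum fun j n => if j < i then m * n else 0

theorem inversions_add_left (a a' b : ι →₀ ℕ) :
    inversions (a + a') b = inversions a b + inversions a' b := by
  refine Finsupp.sum_add_index' (by simp) fun i m m' => ?_
  rw [← Finsupp.sum_add]
  congr! 3 with j n
  split <;> ring

theorem inversions_add_right (a b b' : ι →₀ ℕ) :
    inversions a (b + b') = inversions a b + inversions a b' := by
  rw [inversions, inversions, inversions, ← Finsupp.sum_add]
  congr! 3 with i m
  refine Finsupp.sum_add_index' (by simp) fun i m m' => ?_
  split <;> ring

@[simp] theorem inversions_zero_left (b : ι →₀ ℕ) : inversions 0 b = 0 := by simp [inversions]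

@[simp] theorem inversions_zero_right (a : ι →₀ ℕ) : inversions a 0 = 0 := by
  simp [inversions, Finsupp.sum]

theorem inversions_single (i j : ι) (m n : ℕ) :
    inversions (Finsupp.single i m) (Finsupp.single j n) = if j < i then m * n else 0 := by
  simp [inversions]

/-- Each pair consisting of a factor of `a` and a factor of `b` is an inversion in one of the two
orders or has equal indices, and exactly one of the three happens. -/
theorem inversions_add_comm (a b : ι →₀ ℕ) :
    inversions a b + inversions b a + dot a b = a.degree * b.degree := by
  induction a using Finsupp.induction_linear with
  | zero => simp
  | add f g hf hg =>
    rw [inversions_add_left, inversions_add_right, dot_add_left, map_add, add_mul, ← hf, ← hg]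
    ring
  | single i m =>
    induction b using Finsupp.induction_linear with
    | zero => simp
    | add f g hf hg =>
      rw [inversions_add_left, inversions_add_right, dot_add_right, map_add, mul_add, ← hf, ← hg]
      ring
    | single j n =>
      rw [inversions_single, inversions_single]
      simp only [dot, zero_mul, Finsupp.sum_single_index, Finsupp.degree_single,
        Finsupp.single_apply]
      rcases lt_trichotomy i j with h | h | h
      · simp [h, h.not_gt, h.ne', mul_comm]
      · simp [h]
      · simp [h, h.not_gt, h.ne]

variable (k)

/-- The bicharacter `(-1) ^ inversions a b`. -/
def chi (a b : ι →₀ ℕ) : k := (-1) ^ inversions a b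

variable {k}

theorem chi_add_left (a a' b : ι →₀ ℕ) : chi k (a + a') b = chi k a b * chi k a' b := by
  simp only [chi, inversions_add_left, pow_add]

theorem chi_add_right (a b b' : ι →₀ ℕ) : chi k a (b + b') = chi k a b * chi k a b' := by
  simp only [chi, inversions_add_right, pow_add]

@[simp] theorem chi_zero_left (b : ι →₀ ℕ) : chi k 0 b = 1 := by simp [chi]

@[simp] theorem chi_zero_right (b : ι →₀ ℕ) : chi k b 0 = 1 := by simp [chi]

theorem chi_mul_self (a b : ι →₀ ℕ) : chi k a b * chi k a b = 1 := by
  simp only [chi, ← mul_pow]; simp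

theorem chi_mul_chi (a b : ι →₀ ℕ) :
    chi k a b * chi k b a = (-1) ^ (a.degree * b.degree) * (-1) ^ dot a b := by
  rw [← inversions_add_comm, chi, chi, ← pow_add, ← pow_add, add_assoc _ (dot a b), ← two_mul,
    pow_add _ _ (2 * dot a b)]
  simp

theorem chi_gen_gen {i j : ι} (h : i ≠ j) :
    chi k (gen i) (gen j) = - chi k (gen j) (gen i) := by
  simp only [chi, inversions_single]
  rcases lt_or_gt_of_ne h with h | h
  · simp [h, h.not_gt]
  · simp [h, h.not_gt]

theorem chi_ne_zero (a b : ι →₀ ℕ) : chi k a b ≠ 0 := fun h => by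
  simpa [h] using chi_mul_self (k := k) a b

theorem chi_gen_of_le {i : ι} {s : ι →₀ ℕ} (h : ∀ j ∈ s.support, i ≤ j) :
    chi k (gen i) s = 1 := by
  have : inversions (gen i) s = 0 := by
    rw [inversions, Finsupp.sum_single_index (by simp)]
    refine Finset.sum_eq_zero fun j hj => if_neg (h j hj).not_gt
  rw [chi, this, pow_zero]

end Signs

/-! ### The Hochschild differential on functions of lists of exponent vectors -/

section Cochains

variable {k ι : Type*} [Field k]

/-- `b :: y ↦ φ ((a + b) :: y)` -/
def addHead (a : ι →₀ ℕ) (φ : List (ι →₀ ℕ) → k) : List (ι →₀ ℕ) → k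
  | [] => 0
  | b :: y => φ ((a + b) :: y)

/-- The alternating sum of the values of `φ` at the lists obtained by adding two adjacent members
of a list. -/
def mid (φ : List (ι →₀ ℕ) → k) : List (ι →₀ ℕ) → k
  | [] => 0
  | a :: x => addHead a φ x - mid (fun y => φ (a :: y)) x

@[simp] theorem mid_nil (φ : List (ι →₀ ℕ) → k) : mid φ [] = 0 := rfl

theorem mid_cons (φ : List (ι →₀ ℕ) → k) (a : ι →₀ ℕ) (x : List (ι →₀ ℕ)) :
    mid φ (a :: x) = addHead a φ x - mid (fun y => φ (a :: y)) x := rfl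

@[simp] theorem mid_singleton (φ : List (ι →₀ ℕ) → k) (a : ι →₀ ℕ) : mid φ [a] = 0 := by
  simp [mid_cons, addHead]

theorem mid_cons_cons (φ : List (ι →₀ ℕ) → k) (a b : ι →₀ ℕ) (x : List (ι →₀ ℕ)) :
    mid φ (a :: b :: x) = φ ((a + b) :: x) - mid (fun y => φ (a :: y)) (b :: x) := rfl

theorem addHead_sub (a : ι →₀ ℕ) (φ ψ : List (ι →₀ ℕ) → k) (x : List (ι →₀ ℕ)) :
    addHead a (fun y => φ y - ψ y) x = addHead a φ x - addHead a ψ x := by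
  cases x <;> simp [addHead]

theorem mid_sub (φ ψ : List (ι →₀ ℕ) → k) (x : List (ι →₀ ℕ)) :
    mid (fun y => φ y - ψ y) x = mid φ x - mid ψ x := by
  induction x generalizing φ ψ with
  | nil => simp
  | cons a x ih => rw [mid_cons, mid_cons, mid_cons, ih, addHead_sub]; ring

theorem mid_const_mul (c : k) (φ : List (ι →₀ ℕ) → k) (x : List (ι →₀ ℕ)) :
    mid (fun y => c * φ y) x = c * mid φ x := by
  induction x generalizing φ with
  | nil => simp
  | cons a x ih => rw [mid_cons, mid_cons, ih]; cases x <;> simp [addHead]; ring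

theorem mid_zero (x : List (ι →₀ ℕ)) : mid (fun _ => (0 : k)) x = 0 := by
  simpa using mid_const_mul (0 : k) (fun _ => 0) x

/-- A list obtained by adding two adjacent members. -/
inductive Merge : List (ι →₀ ℕ) → List (ι →₀ ℕ) → Prop
  | head (a b : ι →₀ ℕ) (x : List (ι →₀ ℕ)) : Merge (a :: b :: x) ((a + b) :: x)
  | cons (a : ι →₀ ℕ) {x y : List (ι →₀ ℕ)} : Merge x y → Merge (a :: x) (a :: y)

theorem mid_congr {φ ψ : List (ι →₀ ℕ) → k} {x : List (ι →₀ ℕ)}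
    (h : ∀ y, Merge x y → φ y = ψ y) : mid φ x = mid ψ x := by
  induction x generalizing φ ψ with
  | nil => rfl
  | cons a x ih =>
    rw [mid_cons, mid_cons, ih fun y hy => h _ (Merge.cons a hy)]
    cases x with
    | nil => rfl
    | cons b x => rw [addHead, addHead, h _ (Merge.head a b x)]

theorem mid_eq_zero {φ : List (ι →₀ ℕ) → k} {x : List (ι →₀ ℕ)}
    (h : ∀ y, Merge x y → φ y = 0) : mid φ x = 0 := by
  rw [mid_congr h, mid_zero]

theorem Merge.sum_eq {x y : List (ι →₀ ℕ)} (h : Merge x y) : y.sum = x.sum := by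
  induction h with
  | head a b x => simp [add_assoc]
  | cons a _ ih => simp [ih]

theorem Merge.length_eq {x y : List (ι →₀ ℕ)} (h : Merge x y) : x.length = y.length + 1 := by
  induction h with
  | head a b x => simp
  | cons a _ ih => simp [ih]

theorem Merge.zero_notMem {x y : List (ι →₀ ℕ)} (h : Merge x y) (hx : 0 ∉ x) : 0 ∉ y := by
  induction h with
  | head a b x =>
    simp only [List.mem_cons, not_or] at hx ⊢
    refine ⟨fun h0 => hx.1 ?_, hx.2.2⟩
    exact (add_eq_zero.mp h0.symm).1.symm
  | cons a _ ih =>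
    simp only [List.mem_cons, not_or] at hx ⊢
    exact ⟨hx.1, ih hx.2⟩

/-- Summands of an admissible vector are admissible, so admissibility passes from the merged list
back to the original one. This is why the differential preserves `AdmissibleFun`. -/
theorem Merge.admissible {odd : Bool} {x y : List (ι →₀ ℕ)} (h : Merge x y)
    (hy : ∀ a ∈ y, Admissible odd a) : ∀ a ∈ x, Admissible odd a := by
  induction h with
  | head a b x =>
    simp only [List.mem_cons, forall_eq_or_imp] at hy ⊢
    exact ⟨hy.1.left, hy.1.right, hy.2⟩
  | cons a _ ih =>
    simp only [List.mem_cons, forall_eq_or_imp] at hy ⊢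
    exact ⟨hy.1, ih hy.2⟩

theorem mid_mid (φ : List (ι →₀ ℕ) → k) (x : List (ι →₀ ℕ)) : mid (mid φ) x = 0 := by
  induction x generalizing φ with
  | nil => rfl
  | cons a x ih =>
    rw [mid_cons]
    simp only [mid_cons φ]
    rw [mid_sub, ih, sub_zero]
    cases x with
    | nil => simp [addHead]
    | cons b y =>
      rw [mid_cons, addHead, mid_cons]
      cases y <;> simp [addHead, add_assoc]

/-- `mid` is defined by recursion from the left. This recursion from the right isolates the merge of
the last two entries, which has to be compared with the last face. -/
theorem mid_append (φ : List (ι →₀ ℕ) → k) (x : List (ι →₀ ℕ)) (b c : ι →₀ ℕ) :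
    mid φ (x ++ [b, c]) = mid (fun y => φ (y ++ [c])) (x ++ [b]) +
      (-1) ^ x.length * φ (x ++ [b + c]) := by
  induction x generalizing φ with
  | nil => simp [mid_cons_cons]
  | cons a x ih =>
    rw [List.cons_append, mid_cons, ih, List.cons_append, mid_cons]
    cases x <;> simp [addHead, pow_succ] <;> ring

/-- `(a :: x ++ [l]) ↦ ± Z ((l + a) :: x)` -/
def lastFace (odd : Bool) (Z : List (ι →₀ ℕ) → k) : List (ι →₀ ℕ) → k
  | [] => 0
  | a :: x => if x = [] then 0 else
      dotSign k odd (x.getLastD 0) x.dropLast.sum * Z ((x.getLastD 0 + a) :: x.dropLast)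

@[simp] theorem lastFace_nil (odd : Bool) (Z : List (ι →₀ ℕ) → k) : lastFace odd Z [] = 0 := rfl

@[simp] theorem lastFace_singleton (odd : Bool) (Z : List (ι →₀ ℕ) → k) (a : ι →₀ ℕ) :
    lastFace odd Z [a] = 0 := by simp [lastFace]

theorem lastFace_append (odd : Bool) (Z : List (ι →₀ ℕ) → k) (a l : ι →₀ ℕ)
    (x : List (ι →₀ ℕ)) :
    lastFace odd Z (a :: (x ++ [l])) = dotSign k odd l x.sum * Z ((l + a) :: x) := by
  simp [lastFace]

/-- The coHochschild differential on coordinate functions. -/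
def hochD (odd : Bool) (Z : List (ι →₀ ℕ) → k) (w : List (ι →₀ ℕ)) : k :=
  mid Z w + (-1) ^ (w.length + 1) * lastFace odd Z w

/-- The support consists of lists of admissible vectors. -/
def AdmissibleFun (odd : Bool) (φ : List (ι →₀ ℕ) → k) : Prop :=
  ∀ x, φ x ≠ 0 → ∀ a ∈ x, Admissible odd a

theorem AdmissibleFun.cons {odd : Bool} {φ : List (ι →₀ ℕ) → k} (h : AdmissibleFun odd φ)
    (a : ι →₀ ℕ) : AdmissibleFun odd fun x => φ (a :: x) :=
  fun _ hx b hb => h _ hx b (List.mem_cons_of_mem _ hb)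

theorem AdmissibleFun.mid {odd : Bool} {φ : List (ι →₀ ℕ) → k} (h : AdmissibleFun odd φ) :
    AdmissibleFun odd (mid φ) := by
  intro x hx
  by_contra hc
  refine hx (mid_eq_zero fun y hy => ?_)
  by_contra h0
  exact hc (hy.admissible (h y h0))

theorem AdmissibleFun.lastFace {odd : Bool} {φ : List (ι →₀ ℕ) → k} (h : AdmissibleFun odd φ) :
    AdmissibleFun odd (lastFace odd φ) := by
  intro x hx
  rcases x with _ | ⟨a, x⟩
  · simp at hx
  rcases List.eq_nil_or_concat' x with rfl | ⟨x, l, rfl⟩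
  · simp at hx
  rw [lastFace_append] at hx
  have := h _ (right_ne_zero_of_mul hx)
  simp only [List.mem_cons, forall_eq_or_imp] at this
  simp only [List.mem_cons, forall_eq_or_imp, List.mem_append, List.not_mem_nil, or_false]
  exact ⟨this.1.right, fun b hb => hb.elim (this.2 b) fun h => h ▸ this.1.left⟩

theorem AdmissibleFun.hochD {odd : Bool} {φ : List (ι →₀ ℕ) → k} (h : AdmissibleFun odd φ) :
    AdmissibleFun odd (hochD odd φ) := by
  intro x hx
  by_cases h1 : CoHochschild.mid φ x = 0
  · refine h.lastFace x fun h2 => hx ?_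
    simp [CoHochschild.hochD, h1, h2]
  · exact h.mid x h1

theorem AdmissibleFun.eq_zero {odd : Bool} {φ : List (ι →₀ ℕ) → k} (h : AdmissibleFun odd φ)
    {x : List (ι →₀ ℕ)} {a : ι →₀ ℕ} (ha : a ∈ x) (hna : ¬ Admissible odd a) : φ x = 0 := by
  by_contra h0
  exact hna (h x h0 a ha)

/-- All faces preserve the sum of a list and change its length by one. Problems about `hochD` may
therefore be solved separately in each multidegree. -/
theorem hochD_congr {odd : Bool} {φ ψ : List (ι →₀ ℕ) → k} {w : List (ι →₀ ℕ)}
    (h : ∀ y, y.sum = w.sum → w.length = y.length + 1 → φ y = ψ y) :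
    hochD odd φ w = hochD odd ψ w := by
  rw [hochD, hochD, mid_congr fun y hy => h y hy.sum_eq hy.length_eq]
  congr 2
  rcases w with _ | ⟨a, x⟩
  · rfl
  rcases List.eq_nil_or_concat' x with rfl | ⟨x, l, rfl⟩
  · simp
  rw [lastFace_append, lastFace_append, h]
  · simp only [List.sum_cons, List.sum_append, List.sum_nil]; abel
  · simp

theorem hochD_sub (odd : Bool) (φ ψ : List (ι →₀ ℕ) → k) (w : List (ι →₀ ℕ)) :
    hochD odd (fun y => φ y - ψ y) w = hochD odd φ w - hochD odd ψ w := by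
  rw [hochD, hochD, hochD, mid_sub]
  rcases w with _ | ⟨a, x⟩
  · simp
  rcases List.eq_nil_or_concat' x with rfl | ⟨x, l, rfl⟩
  · simp
  simp only [lastFace_append]
  ring

theorem hochD_zero (odd : Bool) (w : List (ι →₀ ℕ)) :
    hochD odd (fun _ => (0 : k)) w = 0 := by
  simpa using hochD_sub (k := k) odd (fun _ => 0) (fun _ => 0) w

theorem hochD_const_mul (odd : Bool) (c : k) (φ : List (ι →₀ ℕ) → k) (w : List (ι →₀ ℕ)) :
    hochD odd (fun y => c * φ y) w = c * hochD odd φ w := by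
  rw [hochD, hochD, mid_const_mul]
  rcases w with _ | ⟨a, x⟩
  · simp
  rcases List.eq_nil_or_concat' x with rfl | ⟨x, l, rfl⟩
  · simp
  simp only [lastFace_append]
  ring

theorem hochD_indicator (odd : Bool) (p : (ι →₀ ℕ) → ℕ → Prop) [∀ a n, Decidable (p a n)]
    (φ : List (ι →₀ ℕ) → k) (w : List (ι →₀ ℕ)) :
    hochD odd (fun y => if p y.sum (y.length + 1) then φ y else 0) w =
      if p w.sum w.length then hochD odd φ w else 0 := by
  split_ifs with h
  · exact hochD_congr fun y h1 h2 => by rw [h1, ← h2, if_pos h]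
  · exact (hochD_congr fun y h1 h2 => by rw [h1, ← h2, if_neg h]).trans (hochD_zero odd w)

/-- The sign of the last face involves the sum of the intermediate entries, which inner merges do
not change. Only the merge of `a` with the next entry `b` changes it, by `dotSign l b`; this is `1`
wherever `Z` is nonzero, because there `l + a + b` is admissible. -/
theorem mid_lastFace {odd : Bool} {Z : List (ι →₀ ℕ) → k} (hZ : AdmissibleFun odd Z)
    (a l : ι →₀ ℕ) (x : List (ι →₀ ℕ)) :
    mid (fun y => lastFace odd Z (y ++ [l])) (a :: x) =
      dotSign k odd l x.sum * mid Z ((l + a) :: x) := by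
  have key : ∀ y, lastFace odd Z (a :: y ++ [l]) = dotSign k odd l y.sum * Z ((l + a) :: y) :=
    fun y => lastFace_append odd Z a l y
  rw [mid_cons, mid_cons, mul_sub]
  congr 1
  · rcases x with _ | ⟨b, x⟩
    · simp [addHead]
    · simp only [addHead, List.cons_append, lastFace_append, List.sum_cons, dotSign_add_right]
      by_cases h : Z ((l + a + b) :: x) = 0
      · rw [← add_assoc, h]; simp
      · have := hZ _ h _ List.mem_cons_self
        have h1 : Admissible odd (l + b) :=
          this.of_le (by rw [add_right_comm]; exact le_self_add)
        rw [dotSign_of_admissible h1, one_mul, add_assoc]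
  · rw [← mid_const_mul]
    refine mid_congr fun y hy => ?_
    rw [key, hy.sum_eq]

theorem hochD_hochD {odd : Bool} {Z : List (ι →₀ ℕ) → k} (hZ : AdmissibleFun odd Z)
    (w : List (ι →₀ ℕ)) : hochD odd (hochD odd Z) w = 0 := by
  rcases w with _ | ⟨a, x⟩
  · simp [hochD]
  rcases List.eq_nil_or_concat' x with rfl | ⟨x, l, rfl⟩
  · simp [hochD]
  -- The double merges cancel by `mid_mid`, so only the last face inside survives; its sign is
  -- constant because all merged lists have the same length.
  have e1 : mid (hochD odd Z) (a :: (x ++ [l])) = (-1) ^ x.length *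
      mid (lastFace odd Z) (a :: (x ++ [l])) := by
    rw [← mid_const_mul, ← sub_zero (mid (hochD odd Z) _), ← mid_mid Z (a :: (x ++ [l])),
      ← mid_sub]
    refine mid_congr fun y hy => ?_
    have := hy.length_eq
    simp only [List.length_cons, List.length_append, List.length_nil] at this
    rw [hochD, ← this]
    ring
  rw [hochD, e1, lastFace_append, hochD]
  rcases List.eq_nil_or_concat' x with rfl | ⟨x, b, rfl⟩
  · simp [mid_cons_cons]
  have e2 : mid (lastFace odd Z) (a :: (x ++ [b] ++ [l])) = _ :=
    (by simp : a :: (x ++ [b] ++ [l]) = (a :: x) ++ [b, l]) ▸ mid_append _ (a :: x) b l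
  rw [e2, List.cons_append, List.cons_append, mid_lastFace hZ, lastFace_append, lastFace_append]
  simp only [List.length_append, List.length_cons, List.length_nil, List.sum_append, List.sum_cons,
    List.sum_nil, add_zero, dotSign_add_right, dotSign_add_left]
  -- Moving `b` and `l` to the front one after the other, or merging them first, differs by the sign
  -- of exchanging them, which is trivial on the support of `Z`.
  have e3 : dotSign k odd l b * Z ((b + (l + a)) :: x) = Z ((b + l + a) :: x) := by
    rw [← add_assoc]
    by_cases h : Z ((b + l + a) :: x) = 0
    · simp [h]
    · have := (hZ _ h _ List.mem_cons_self).left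
      rw [add_comm] at this
      rw [dotSign_of_admissible this, one_mul]
  rw [← e3]
  have e4 : ((-1 : k) ^ x.length) * (-1) ^ x.length = 1 := by rw [← mul_pow]; simp
  simp only [pow_add, pow_one]
  linear_combination (-dotSign k odd l x.sum * dotSign k odd l b * dotSign k odd b x.sum *
    Z ((b + (l + a)) :: x) + dotSign k odd b x.sum * dotSign k odd l x.sum * dotSign k odd l b *
    Z ((b + (l + a)) :: x)) * e4

/-- `Z` vanishes at the lists with a zero after the first position. -/
def NormalizedTail (Z : List (ι →₀ ℕ) → k) : Prop := ∀ a x, 0 ∈ x → Z (a :: x) = 0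

/-- The two merges that absorb the zero give the same list with opposite signs; every other merge
leaves a zero behind the first entry. -/
theorem mid_of_zero_mem {Z : List (ι →₀ ℕ) → k} (hZ : NormalizedTail Z) (a b : ι →₀ ℕ)
    (x y : List (ι →₀ ℕ)) : mid Z (a :: (x ++ 0 :: b :: y)) = 0 := by
  induction x generalizing Z a with
  | nil =>
    rw [List.nil_append, mid_cons_cons, mid_cons_cons, add_zero, zero_add, sub_sub_cancel]
    exact mid_eq_zero fun y _ => hZ a _ (by simp)
  | cons c x ih =>
    rw [List.cons_append, mid_cons_cons, ih, hZ _ _ (by simp), sub_zero]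
    exact fun d z hz => hZ _ _ (by simp [hz])

/-- Here only one merge absorbs the final zero. In `hochD` this term is cancelled by the last face.
-/
theorem mid_append_zero {Z : List (ι →₀ ℕ) → k} (hZ : NormalizedTail Z) (a : ι →₀ ℕ)
    (x : List (ι →₀ ℕ)) : mid Z (a :: (x ++ [0])) = (-1) ^ x.length * Z (a :: x) := by
  induction x generalizing Z a with
  | nil => simp [mid_cons_cons]
  | cons c x ih =>
    rw [List.cons_append, mid_cons_cons, ih, hZ _ _ (by simp)]
    · simp [pow_succ]
    · exact fun d z hz => hZ _ _ (by simp [hz])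

theorem NormalizedTail.hochD {odd : Bool} {Z : List (ι →₀ ℕ) → k} (hZ : NormalizedTail Z) :
    NormalizedTail (hochD odd Z) := by
  intro a x hx
  obtain ⟨x, y, rfl⟩ := List.append_of_mem hx
  rcases y with _ | ⟨b, y⟩
  · rw [CoHochschild.hochD, mid_append_zero hZ, lastFace_append]
    simp [pow_succ]
  · rw [CoHochschild.hochD, mid_of_zero_mem hZ, zero_add]
    rcases List.eq_nil_or_concat' (b :: y) with h | ⟨z, l, h⟩
    · simp at h
    · rw [h, show a :: (x ++ 0 :: (z ++ [l])) = a :: (x ++ 0 :: z ++ [l]) by simp,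
        lastFace_append, hZ _ _ (by simp)]
      simp

/-- `φ` vanishes at the lists with a zero. -/
def Normalized (φ : List (ι →₀ ℕ) → k) : Prop := ∀ x, 0 ∈ x → φ x = 0

theorem zero_notMem_map_gen (L : List ι) : (0 : ι →₀ ℕ) ∉ L.map gen := by
  simp

/-- The sum of two nonzero vectors has degree at least two, so it is not a generator. -/
theorem mid_eq_zero_of_gen {φ : List (ι →₀ ℕ) → k}
    (hφ : ∀ x, φ x ≠ 0 → ∃ L : List ι, x = L.map gen) {x : List (ι →₀ ℕ)} (hx : 0 ∉ x) :
    mid φ x = 0 := by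
  refine mid_eq_zero fun y hy => ?_
  by_contra h
  obtain ⟨L, hL⟩ := hφ y h
  have hgen : ∀ a ∈ y, a.degree = 1 := by
    rw [hL]
    simp
  clear hL h
  induction hy with
  | head a b x =>
    simp only [List.mem_cons, not_or] at hx
    have := hgen _ List.mem_cons_self
    have h1 : a.degree ≠ 0 := fun h => hx.1 ((Finsupp.degree_eq_zero_iff a).mp h).symm
    have h2 : b.degree ≠ 0 := fun h => hx.2.1 ((Finsupp.degree_eq_zero_iff b).mp h).symm
    rw [map_add] at this
    omega
  | cons a _ ih =>
    exact ih (fun h => hx (List.mem_cons_of_mem _ h))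
      fun b hb => hgen b (List.mem_cons_of_mem _ hb)

theorem addHead_ne_zero {a : ι →₀ ℕ} {φ : List (ι →₀ ℕ) → k} {x : List (ι →₀ ℕ)}
    (h : addHead a φ x ≠ 0) : ∃ b y, x = b :: y ∧ φ ((a + b) :: y) ≠ 0 := by
  rcases x with _ | ⟨b, y⟩
  · exact absurd rfl h
  · exact ⟨b, y, rfl, h⟩

end Cochains

/-! ### Alternating evaluation at lists of generators -/

section Evaluation

variable {k ι : Type*} [Field k] [LinearOrder ι]

/-- The signed sum of the values of `φ` at the lists of `n` generators with sum `s`. -/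
def evalAlt : ℕ → (List (ι →₀ ℕ) → k) → (ι →₀ ℕ) → k
  | 0, φ, _ => φ []
  | n + 1, φ, s => ∑ i ∈ s.support,
      chi k (gen i) (s - gen i) * evalAlt n (fun x => φ (gen i :: x)) (s - gen i)

theorem evalAlt_succ (n : ℕ) (φ : List (ι →₀ ℕ) → k) (s : ι →₀ ℕ) :
    evalAlt (n + 1) φ s = ∑ i ∈ s.support,
      chi k (gen i) (s - gen i) * evalAlt n (fun x => φ (gen i :: x)) (s - gen i) := rfl

theorem evalAlt_congr {n : ℕ} {φ ψ : List (ι →₀ ℕ) → k} {s : ι →₀ ℕ} (hs : s.degree = n)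
    (h : ∀ L : List ι, L.length = n → (L.map gen).sum = s → φ (L.map gen) = ψ (L.map gen)) :
    evalAlt n φ s = evalAlt n ψ s := by
  induction n generalizing φ ψ s with
  | zero => exact h [] rfl (by simpa using ((Finsupp.degree_eq_zero_iff s).mp hs).symm)
  | succ n ih =>
    refine Finset.sum_congr rfl fun i hi => ?_
    have := degree_sub_gen hi
    congr 1
    refine ih (by omega) fun L hL hs => h (i :: L) (by simp [hL]) ?_
    rw [List.map_cons, List.sum_cons, hs, add_comm, ← eq_add_gen hi]

theorem evalAlt_sub (n : ℕ) (φ ψ : List (ι →₀ ℕ) → k) (s : ι →₀ ℕ) :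
    evalAlt n (fun x => φ x - ψ x) s = evalAlt n φ s - evalAlt n ψ s := by
  induction n generalizing φ ψ s with
  | zero => rfl
  | succ n ih => simp only [evalAlt_succ, ih, mul_sub, Finset.sum_sub_distrib]

theorem evalAlt_const_mul (n : ℕ) (c : k) (φ : List (ι →₀ ℕ) → k) (s : ι →₀ ℕ) :
    evalAlt n (fun x => c * φ x) s = c * evalAlt n φ s := by
  induction n generalizing φ s with
  | zero => rfl
  | succ n ih => simp only [evalAlt_succ, ih, Finset.mul_sum, mul_left_comm]

theorem evalAlt_zero_fun (n : ℕ) (s : ι →₀ ℕ) : evalAlt n (fun _ => (0 : k)) s = 0 := by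
  simpa using evalAlt_const_mul n (0 : k) (fun _ => 0) s

theorem evalAlt_eq_zero {n : ℕ} {φ : List (ι →₀ ℕ) → k} {s : ι →₀ ℕ} (hs : s.degree = n)
    (h : ∀ L : List ι, L.length = n → (L.map gen).sum = s → φ (L.map gen) = 0) :
    evalAlt n φ s = 0 :=
  (evalAlt_congr hs h).trans (evalAlt_zero_fun n s)

theorem evalAlt_of_forall_eq_zero (n : ℕ) {φ : List (ι →₀ ℕ) → k} {s : ι →₀ ℕ}
    (h : ∀ x, φ x = 0) : evalAlt n φ s = 0 := by
  rw [show φ = fun _ => 0 from funext h, evalAlt_zero_fun]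

theorem evalAlt_add (n : ℕ) (φ ψ : List (ι →₀ ℕ) → k) (s : ι →₀ ℕ) :
    evalAlt n (fun x => φ x + ψ x) s = evalAlt n φ s + evalAlt n ψ s := by
  induction n generalizing φ ψ s with
  | zero => rfl
  | succ n ih => simp only [evalAlt_succ, ih, mul_add, Finset.sum_add_distrib]

theorem mem_support_sub_gen_comm {s : ι →₀ ℕ} {i j : ι} (hi : i ∈ s.support)
    (hj : j ∈ (s - gen i).support) : j ∈ s.support ∧ i ∈ (s - gen j).support := by
  simp only [Finsupp.mem_support_iff, Finsupp.tsub_apply, Finsupp.single_apply] at *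
  by_cases h : i = j
  · subst h; simp_all
  · simp_all [Ne.symm h]

theorem sum_support_comm (s : ι →₀ ℕ) (F : ι → ι → (ι →₀ ℕ) → k) :
    ∑ i ∈ s.support, ∑ j ∈ (s - gen i).support, F i j (s - gen i - gen j) =
      ∑ j ∈ s.support, ∑ i ∈ (s - gen j).support, F i j (s - gen j - gen i) := by
  rw [Finset.sum_sigma', Finset.sum_sigma']
  refine Finset.sum_nbij' (fun p => ⟨p.2, p.1⟩) (fun p => ⟨p.2, p.1⟩) ?_ ?_ (fun _ _ => rfl)
    (fun _ _ => rfl) fun p _ => ?_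
  · intro p hp
    rw [Finset.mem_sigma] at hp ⊢
    exact mem_support_sub_gen_comm hp.1 hp.2
  · intro p hp
    rw [Finset.mem_sigma] at hp ⊢
    exact mem_support_sub_gen_comm hp.1 hp.2
  · rw [tsub_right_comm]

/-- The signed sum may be expanded along the last generator instead of the first. Expanding at both
ends and exchanging the two summations gives the induction step. -/
theorem evalAlt_last {n : ℕ} {s : ι →₀ ℕ} (hs : s.degree = n + 1) (φ : List (ι →₀ ℕ) → k) :
    evalAlt (n + 1) φ s = ∑ i ∈ s.support,
      chi k (s - gen i) (gen i) * evalAlt n (fun x => φ (x ++ [gen i])) (s - gen i) := by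
  induction n generalizing φ s with
  | zero =>
    refine Finset.sum_congr rfl fun i hi => ?_
    have := degree_sub_gen hi
    have h0 : s - gen i = 0 := (Finsupp.degree_eq_zero_iff _).mp (by omega)
    simp [h0, evalAlt]
  | succ n ih =>
    have e : evalAlt (n + 1 + 1) φ s = ∑ i ∈ s.support, ∑ j ∈ (s - gen i).support,
        chi k (gen i) (gen j) * chi k (gen i) (s - gen i - gen j) *
          chi k (s - gen i - gen j) (gen j) *
          evalAlt n (fun x => φ (gen i :: (x ++ [gen j]))) (s - gen i - gen j) := by
      refine Finset.sum_congr rfl fun i hi => ?_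
      have := degree_sub_gen hi
      rw [ih (by omega), Finset.mul_sum]
      refine Finset.sum_congr rfl fun j hj => ?_
      rw [eq_add_gen hj, chi_add_right, ← eq_add_gen hj]
      ring
    rw [e, sum_support_comm s fun i j r => chi k (gen i) (gen j) * chi k (gen i) r *
      chi k r (gen j) * evalAlt n (fun x => φ (gen i :: (x ++ [gen j]))) r]
    refine Finset.sum_congr rfl fun j hj => ?_
    rw [evalAlt_succ, Finset.mul_sum]
    refine Finset.sum_congr rfl fun i hi => ?_
    conv_rhs => rw [eq_add_gen hi, chi_add_left, ← eq_add_gen hi]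
    simp only [List.cons_append]
    ring

/-- A merge replaces adjacent `gen i`, `gen j` by their symmetric sum, while `chi` is antisymmetric
on distinct generators. For `i = j` there is nothing to cancel: in the even case `s` has no repeated
generator, and in the odd case `φ` vanishes at lists containing `gen i + gen i`. -/
theorem evalAlt_mid {odd : Bool} (n : ℕ) {φ : List (ι →₀ ℕ) → k} (hφ : AdmissibleFun odd φ)
    {s : ι →₀ ℕ} (hs : Admissible (!odd) s) : evalAlt n (mid φ) s = 0 := by
  induction n generalizing φ s with
  | zero => rfl
  | succ n ih =>
    rw [evalAlt_succ]
    simp only [mid_cons φ]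
    have e : ∀ i ∈ s.support, chi k (gen i) (s - gen i) *
        evalAlt n (fun x => addHead (gen i) φ x - mid (fun y => φ (gen i :: y)) x) (s - gen i) =
        chi k (gen i) (s - gen i) * evalAlt n (addHead (gen i) φ) (s - gen i) := by
      intro i hi
      rw [evalAlt_sub, ih (hφ.cons _) (hs.of_le tsub_le_self), sub_zero]
    rw [Finset.sum_congr rfl e]
    rcases n with _ | n
    · simp [evalAlt, addHead]
    simp only [evalAlt_succ, addHead, Finset.mul_sum]
    rw [Finset.sum_sigma']
    -- The involution exchanges the two generators that are merged.
    refine Finset.sum_involution (fun p _ => ⟨p.2, p.1⟩) ?_ ?_ ?_ (fun _ _ => rfl)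
    · rintro ⟨i, j⟩ hp
      rw [Finset.mem_sigma] at hp
      have hj := eq_add_gen hp.2
      have hij : s - gen j - gen i = s - gen i - gen j := tsub_right_comm
      have hi : s - gen j = s - gen i - gen j + gen i := by
        rw [← hij]
        exact eq_add_gen (mem_support_sub_gen_comm hp.1 hp.2).2
      dsimp only at hj ⊢
      rw [hij, hi, hj, chi_add_right, chi_add_right, ← hj]
      by_cases hne : i = j
      · subst hne
        cases odd
        · have h1 := hs rfl i
          have h2 := hp.2
          simp at h2
          omega
        · rw [evalAlt_of_forall_eq_zero n fun x => hφ.eq_zero (List.mem_cons_self) fun h => ?_]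
          · simp
          · have := h rfl i
            simp at this
      · rw [chi_gen_gen hne, add_comm (gen j)]
        ring
    · rintro ⟨i, j⟩ hp hne h
      have hij : j = i := congrArg Sigma.fst h
      subst hij
      rw [Finset.mem_sigma] at hp
      refine hne ?_
      cases odd
      · have h1 := hs rfl j
        have h2 := hp.2
        simp at h2
        omega
      · dsimp only
        rw [evalAlt_of_forall_eq_zero n fun x => hφ.eq_zero (List.mem_cons_self) fun h => ?_]
        · simp
        · have := h rfl j
          simp at this
    · rintro ⟨i, j⟩ hp
      rw [Finset.mem_sigma] at hp ⊢
      exact mem_support_sub_gen_comm hp.1 hp.2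

/-- Reduced alternating evaluation of the differential vanishes. -/
theorem evalAlt_hochD {odd : Bool} {n : ℕ} {Z : List (ι →₀ ℕ) → k} (hZ : AdmissibleFun odd Z)
    {s : ι →₀ ℕ} (hs : Admissible (!odd) s) (hn : s.degree = n) (a : ι →₀ ℕ) :
    evalAlt n (fun x => hochD odd Z (a :: x)) s = 0 := by
  rcases n with _ | n
  · simp [evalAlt, hochD]
  -- Among the merges only those of `a` with the following generator survive, by `evalAlt_mid`. They
  -- are compared with the last face by expanding the latter along the final generator.
  have e1 : evalAlt (n + 1) (fun x => hochD odd Z (a :: x)) s =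
      evalAlt (n + 1) (addHead a Z) s +
        (-1) ^ (n + 1) * evalAlt (n + 1) (fun x => lastFace odd Z (a :: x)) s := by
    rw [← sub_zero (evalAlt (n + 1) (addHead a Z) s), ← evalAlt_mid (n + 1) (hZ.cons a) hs,
      ← evalAlt_const_mul, ← evalAlt_sub, ← evalAlt_add]
    refine evalAlt_congr hn fun L hL _ => ?_
    rw [hochD, mid_cons, List.length_cons, List.length_map, hL, pow_succ, pow_succ, pow_succ]
    ring
  rw [e1, evalAlt_last hn (fun x => lastFace odd Z (a :: x)), evalAlt_succ, Finset.mul_sum,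
    ← Finset.sum_add_distrib]
  refine Finset.sum_eq_zero fun i hi => ?_
  have hd := degree_sub_gen hi
  have e2 : evalAlt n (fun x => lastFace odd Z (a :: (x ++ [gen i]))) (s - gen i) =
      dotSign k odd (gen i) (s - gen i) * evalAlt n (fun x => Z ((a + gen i) :: x)) (s - gen i) := by
    rw [← evalAlt_const_mul]
    refine evalAlt_congr (by omega) fun L _ hL => ?_
    rw [lastFace_append, hL, add_comm a]
  rw [e2]
  -- Moving `gen i` from the front to the back costs `(-1)^n`, up to a correction for further copies
  -- of `gen i`. The factor `dotSign` of the last face equals this correction, so the two kinds of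
  -- terms cancel.
  have e3 : chi k (gen i) (s - gen i) * chi k (s - gen i) (gen i) =
      (-1) ^ n * (-1) ^ (s - gen i) i := by
    rw [chi_mul_chi, dot_gen_left]
    congr 2
    simp; omega
  have e4 : dotSign k odd (gen i) (s - gen i) = (-1) ^ (s - gen i) i := by
    rw [dotSign_comm, dotSign_gen_right]
    cases odd
    · have h1 := hs rfl i
      have : (s - gen i) i = 0 := by simp; omega
      simp [this]
    · rfl
  simp only [addHead]
  rw [e4]
  have e5 := chi_mul_self (k := k) (gen i) (s - gen i)
  have e6 : ((-1 : k) ^ (s - gen i) i) * (-1) ^ (s - gen i) i = 1 := by rw [← mul_pow]; simp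
  have e7 : ((-1 : k) ^ n) * (-1) ^ n = 1 := by rw [← mul_pow]; simp
  rw [pow_succ]
  have e8 : chi k (s - gen i) (gen i) =
      chi k (gen i) (s - gen i) * ((-1) ^ n * (-1) ^ (s - gen i) i) := by
    rw [← e3, ← mul_assoc, e5, one_mul]
  rw [e8]
  generalize evalAlt n (fun x => Z ((a + gen i) :: x)) (s - gen i) = E
  linear_combination (- chi k (gen i) (s - gen i) * E * (-1) ^ n * (-1) ^ n) * e6 -
    chi k (gen i) (s - gen i) * E * e7

end Evaluation

/-! ### Exactness of the Koszul complex in every characteristic -/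

section Koszul

variable {k ι : Type*} [Field k] [LinearOrder ι]

/-- The differential of the Koszul complex, on coordinate functions. -/
def koszulD (t : (ι →₀ ℕ) → (ι →₀ ℕ) → k) (a s : ι →₀ ℕ) : k :=
  ∑ i ∈ s.support, chi k (gen i) (s - gen i) * t (a + gen i) (s - gen i)

open Classical in
/-- The contraction of the Koszul complex in the direction of the generator `i`. -/
def koszulContraction (odd : Bool) (t : (ι →₀ ℕ) → (ι →₀ ℕ) → k) (i : ι) (a s : ι →₀ ℕ) : k :=
  if Admissible odd a ∧ 1 ≤ a i then t (a - gen i) (s + gen i) else 0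

theorem admissible_add_gen {odd : Bool} {a : ι →₀ ℕ} {i : ι} (ha : Admissible odd a)
    (h : odd = true → a i = 0) : Admissible odd (a + gen i) := by
  intro ho j
  have h1 := ha ho j
  have h2 := h ho
  rw [Finsupp.add_apply, Finsupp.single_apply]
  split_ifs with hij
  · subst hij; omega
  · omega

/-- Because `i` is the smallest index, `chi (gen i)` is trivial on everything that occurs, and `gen
j` anticommutes past `gen i` with sign `-1`. If `a i = 0`, only the term `j = i` of the sum
survives. Otherwise the terms with `j ≠ i` are those of the cycle condition one step back, with the
opposite sign, unless `s + gen i` is not admissible. -/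
theorem koszulD_koszulContraction {odd : Bool} {t : (ι →₀ ℕ) → (ι →₀ ℕ) → k}
    (ht : ∀ a s, t a s ≠ 0 → Admissible odd a ∧ Admissible (!odd) s)
    (hK : ∀ a s, Admissible (!odd) s → koszulD t a s = 0) {a s : ι →₀ ℕ}
    (ha : Admissible odd a) {i : ι} (hi : i ∈ (a + s).support)
    (hmin : ∀ j ∈ (a + s).support, i ≤ j) (hs : Admissible (!odd) s) :
    koszulD (koszulContraction odd t i) a s = t a s := by
  classical
  have hchi : ∀ r ≤ s, chi k (gen i) r = 1 := fun r hr => chi_gen_of_le fun j hj => hmin j <| by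
    have := hr j
    simp only [Finsupp.mem_support_iff, Finsupp.add_apply] at hj ⊢
    omega
  have hterm : ∀ j ∈ s.support, j ≠ i → koszulContraction odd t i (a + gen j) (s - gen j) =
      if 1 ≤ a i then t (a - gen i + gen j) (s + gen i - gen j) else 0 := by
    intro j hj hji
    have e1 : (a + gen j) i = a i := by simp [hji]
    rw [koszulContraction, e1]
    by_cases hai : 1 ≤ a i
    · have e2 : a + gen j - gen i = a - gen i + gen j :=
        tsub_add_eq_add_tsub (Finsupp.single_le_iff.mpr hai) |>.symm
      have e3 : s - gen j + gen i = s + gen i - gen j := by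
        refine tsub_add_eq_add_tsub ?_
        rw [Finsupp.single_le_iff]
        exact Nat.one_le_iff_ne_zero.mpr (Finsupp.mem_support_iff.mp hj)
      rw [if_pos hai, e2, e3]
      by_cases h0 : t (a - gen i + gen j) (s + gen i - gen j) = 0
      · rw [h0, ite_self]
      · rw [if_pos]
        refine ⟨admissible_add_gen ha fun ho => ?_, hai⟩
        have := (ht _ _ h0).1 ho j
        simp [hji.symm] at this
        exact this
    · rw [if_neg hai, if_neg fun h => hai h.2]
  have hself : i ∈ s.support → koszulContraction odd t i (a + gen i) (s - gen i) =
      if odd = true → a i = 0 then t a s else 0 := by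
    intro his
    rw [koszulContraction, add_tsub_cancel_right, ← eq_add_gen his]
    by_cases h : odd = true → a i = 0
    · rw [if_pos h, if_pos ⟨admissible_add_gen ha h, by simp⟩]
    · rw [if_neg h, if_neg]
      rintro ⟨h1, -⟩
      refine h fun ho => ?_
      have := h1 ho i
      simp at this
      exact this
  rw [koszulD]
  by_cases hai : 1 ≤ a i
  swap
  · have hai : a i = 0 := by omega
    have his : i ∈ s.support := by simpa [hai] using hi
    rw [Finset.sum_eq_single_of_mem i his fun j hj hji => by rw [hterm j hj hji]; simp [hai],
      hself his, if_pos fun _ => hai, hchi _ tsub_le_self, one_mul]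
  -- If `s + gen i` is admissible, the cycle condition at `(a - gen i, s + gen i)` expresses `t a s`
  -- by the remaining terms.
  by_cases hsi : Admissible (!odd) (s + gen i)
  · have hK1 := hK (a - gen i) (s + gen i) hsi
    have hmem : i ∈ (s + gen i).support := by simp
    have e1 : a - gen i + gen i = a := tsub_add_cancel_of_le (Finsupp.single_le_iff.mpr hai)
    rw [koszulD, ← Finset.add_sum_erase _ _ hmem, add_tsub_cancel_right, hchi _ le_rfl, one_mul,
      e1] at hK1
    have hsupp : (s + gen i).support.erase i = s.support.erase i := by
      ext j
      simp only [Finset.mem_erase, Finsupp.mem_support_iff, Finsupp.add_apply]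
      refine and_congr_right fun hji => ?_
      simp [Ne.symm hji]
    rw [hsupp] at hK1
    have e2 : ∑ j ∈ s.support.erase i, chi k (gen j) (s - gen j) *
        koszulContraction odd t i (a + gen j) (s - gen j) = t a s := by
      rw [← sub_eq_zero, ← neg_eq_zero, neg_sub, sub_eq_add_neg, ← hK1, ← Finset.sum_neg_distrib]
      congr 1
      refine Finset.sum_congr rfl fun j hj => ?_
      obtain ⟨hji, hj⟩ := Finset.mem_erase.mp hj
      have e3 : s + gen i - gen j = s - gen j + gen i := by
        refine (tsub_add_eq_add_tsub ?_).symm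
        rw [Finsupp.single_le_iff]
        exact Nat.one_le_iff_ne_zero.mpr (Finsupp.mem_support_iff.mp hj)
      have e4 : chi k (gen j) (gen i) = -1 := by
        have h1 : i ≤ j := hmin j (by simp at hj ⊢; omega)
        rw [chi, inversions_single, if_pos (lt_of_le_of_ne h1 hji.symm)]
        simp
      rw [hterm j hj hji, if_pos hai, e3, chi_add_right, e4]
      ring
    by_cases his : i ∈ s.support
    · rw [← Finset.add_sum_erase _ _ his, e2, hself his, if_neg, mul_zero, zero_add]
      intro h
      cases odd
      · have := hsi rfl i
        simp at this his
        omega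
      · have := h rfl
        omega
    · rwa [Finset.erase_eq_of_notMem his] at e2
  -- Now `i` occurs in `s`, which is squarefree. For `j ≠ i` the vector `s + gen i - gen j` still
  -- contains `i` twice, so `t` vanishes there and the term `j = i` alone gives `t a s`.
  · have ho : odd = false := by
      cases odd
      · rfl
      · exact absurd (fun h => by simp at h) hsi
    subst ho
    have his : i ∈ s.support := by
      by_contra h
      exact hsi (admissible_add_gen hs fun _ => by simpa using h)
    rw [Finset.sum_eq_single_of_mem i his, hself his, if_pos (by simp), hchi _ tsub_le_self,
      one_mul]
    intro j hj hji
    rw [hterm j hj hji, if_pos hai]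
    by_contra h0
    have := (ht _ _ (right_ne_zero_of_mul h0)).2 rfl i
    simp [hji] at this his
    omega

/-- The contraction uses the smallest generator of `a + s`. The Koszul differential preserves `a +
s`, so this choice is consistent along the whole sum. A homotopy summed over all generators would
require division by the degree; a single direction does not. -/
theorem koszul_exact {odd : Bool} {t : (ι →₀ ℕ) → (ι →₀ ℕ) → k} {d : ℕ} (hd : d ≠ 0)
    (ht : ∀ a s, t a s ≠ 0 → Admissible odd a ∧ Admissible (!odd) s ∧ a.degree = d)
    (hK : ∀ a s, Admissible (!odd) s → koszulD t a s = 0) :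
    ∃ u : (ι →₀ ℕ) → (ι →₀ ℕ) → k,
      (∀ a s, u a s ≠ 0 → Admissible odd a ∧ a.degree = d + 1) ∧
      ∀ a s, Admissible odd a → Admissible (!odd) s → a.degree = d →
        koszulD u a s = t a s := by
  classical
  refine ⟨fun a s => if h : (a + s).support.Nonempty then
    koszulContraction odd t ((a + s).support.min' h) a s else 0, ?_, ?_⟩
  · intro a s h
    dsimp only at h
    split_ifs at h with h1
    · rw [koszulContraction] at h
      split_ifs at h with h2
      · refine ⟨h2.1, ?_⟩
        have := (ht _ _ h).2.2
        rw [degree_sub_gen (Finsupp.mem_support_iff.mpr (Nat.one_le_iff_ne_zero.mp h2.2)), this]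
      · exact absurd rfl h
    · exact absurd rfl h
  · intro a s ha hs had
    have hne : (a + s).support.Nonempty := by
      rw [Finsupp.support_nonempty_iff]
      intro h
      rw [(add_eq_zero.mp h).1] at had
      simp at had
      exact hd had.symm
    rw [← koszulD_koszulContraction (fun a s h => ⟨(ht a s h).1, (ht a s h).2.1⟩) hK ha
      (Finset.min'_mem _ hne) (fun j hj => Finset.min'_le _ j hj) hs]
    refine Finset.sum_congr rfl fun i hi => ?_
    have e : a + gen i + (s - gen i) = a + s := by
      rw [add_assoc, add_comm (gen i), ← eq_add_gen hi]
    simp only [e, dif_pos hne]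

end Koszul

/-! ### The cobar complex: vanishing evaluations imply exactness -/

section Exactness

variable {k ι : Type*} [Field k] [LinearOrder ι]

/-- The value `t s` is placed at the one list in which the generators of `s` appear in increasing
order; its sign is `1`. -/
theorem exists_section_evalAlt (n : ℕ) (t : (ι →₀ ℕ) → k) :
    ∃ φ : List (ι →₀ ℕ) → k, (∀ x, φ x ≠ 0 → ∃ L : List ι, x = L.map gen) ∧
      ∀ s, s.degree = n → evalAlt n φ s = t s := by
  classical
  induction n generalizing t with
  | zero =>
    refine ⟨fun x => if x = [] then t 0 else 0, fun x hx => ⟨[], ?_⟩, fun s hs => ?_⟩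
    · by_contra h
      exact hx (if_neg h)
    · rw [(Finsupp.degree_eq_zero_iff s).mp hs]
      rfl
  | succ n ih =>
    -- `f i` carries the values at lists that begin with `gen i`, and is zero unless `i` is minimal.
    choose f hf1 hf2 using fun i : ι =>
      ih fun r => if ∀ j ∈ r.support, i ≤ j then t (r + gen i) else 0
    have hgen : Function.Injective (gen : ι → ι →₀ ℕ) := Finsupp.single_left_injective one_ne_zero
    refine ⟨fun x => match x with
      | [] => 0
      | a :: y => if h : ∃ i, gen i = a then f h.choose y else 0, ?_, fun s hs => ?_⟩
    · rintro (_ | ⟨a, y⟩) hx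
      · exact absurd rfl hx
      · dsimp only at hx
        split_ifs at hx with h
        · obtain ⟨L, rfl⟩ := hf1 _ _ hx
          exact ⟨h.choose :: L, by rw [List.map_cons, h.choose_spec]⟩
        · exact absurd rfl hx
    · have hne : s.support.Nonempty := by
        rw [Finsupp.support_nonempty_iff]
        rintro rfl
        simp at hs
      have hmin := Finset.min'_mem _ hne
      have hle : ∀ j ∈ s.support, s.support.min' hne ≤ j := fun j hj => Finset.min'_le _ _ hj
      generalize s.support.min' hne = i at hmin hle
      have e : ∀ j, evalAlt n (fun x => if h : ∃ i, gen i = gen j then f h.choose x else 0)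
          (s - gen j) = evalAlt n (f j) (s - gen j) := by
        intro j
        congr 1
        funext x
        rw [dif_pos ⟨j, rfl⟩]
        congr
        exact hgen (Exists.choose_spec (⟨j, rfl⟩ : ∃ i : ι, gen i = gen j))
      have hsub : ∀ j ∈ (s - gen i).support, j ∈ s.support := by
        intro j hj
        simp only [Finsupp.mem_support_iff, Finsupp.tsub_apply] at hj ⊢
        omega
      simp only [evalAlt_succ, e]
      rw [Finset.sum_eq_single_of_mem i hmin, hf2, if_pos fun j hj => hle j (hsub j hj),
        ← eq_add_gen hmin, chi_gen_of_le fun j hj => hle j (hsub j hj), one_mul]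
      · have := degree_sub_gen hmin
        omega
      · intro j hj hji
        rw [hf2 _ _ (by have := degree_sub_gen hj; omega), if_neg, mul_zero]
        intro h
        refine hji (le_antisymm (h i ?_) (hle j hj))
        simp only [Finsupp.mem_support_iff, Finsupp.tsub_apply] at hmin ⊢
        simpa [hji] using hmin

/-- Normalized cocycles of length `n` of the cobar complex on which `evalAlt` vanishes. -/
structure IsNullCocycle (odd : Bool) (n : ℕ) (φ : List (ι →₀ ℕ) → k) : Prop where
  admissible : AdmissibleFun odd φ
  normalized : Normalized φ
  mid_eq : ∀ x, 0 ∉ x → x.length = n + 1 → mid φ x = 0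
  eval_eq : ∀ s, Admissible (!odd) s → s.degree = n → evalAlt n φ s = 0

/-- `φ` is the coboundary of a normalized cochain. -/
def IsNullCoboundary (odd : Bool) (n : ℕ) (φ : List (ι →₀ ℕ) → k) : Prop :=
  ∃ ψ : List (ι →₀ ℕ) → k, AdmissibleFun odd ψ ∧ Normalized ψ ∧
    ∀ x, 0 ∉ x → x.length = n → mid ψ x = φ x

/-- One step of the descent on the degree of the first entry. The slices of `φ` with first entry of
degree `m + 1` need not have zero evaluations, but these evaluations form a Koszul cycle. Its
primitive is realized by a correction in degree `m + 2`, after which the slices are null cocycles of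
smaller length and `IH` applies. -/
theorem IsNullCocycle.lower_bound {odd : Bool} {n : ℕ}
    (IH : ∀ θ : List (ι →₀ ℕ) → k, IsNullCocycle odd n θ → IsNullCoboundary odd n θ)
    {φ : List (ι →₀ ℕ) → k} (hφ : IsNullCocycle odd (n + 1) φ) {m : ℕ}
    (hm : ∀ a x, x.length = n → 0 ∉ x → m + 1 < a.degree → φ (a :: x) = 0) :
    ∃ ψ : List (ι →₀ ℕ) → k, AdmissibleFun odd ψ ∧ Normalized ψ ∧
      ∀ a x, x.length = n → 0 ∉ x → m < a.degree → mid ψ (a :: x) = φ (a :: x) := by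
  classical
  let t : (ι →₀ ℕ) → (ι →₀ ℕ) → k := fun a s =>
    if Admissible (!odd) s ∧ a.degree = m + 1 ∧ s.degree = n then
      evalAlt n (fun x => φ (a :: x)) s else 0
  have ht : ∀ a s, t a s ≠ 0 → Admissible odd a ∧ Admissible (!odd) s ∧ a.degree = m + 1 := by
    intro a s h
    simp only [t] at h
    split_ifs at h with h1
    · refine ⟨?_, h1.1, h1.2.1⟩
      by_contra h2
      exact h (evalAlt_of_forall_eq_zero n fun x => hφ.admissible.eq_zero List.mem_cons_self h2)
    · exact absurd rfl h
  -- For `a = 0` the sum is an evaluation of `φ` itself, zero by hypothesis. For `a ≠ 0` the cocycle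
  -- condition turns the sum of the values at `a + b` into a sum of merges, which evaluation kills.
  have hK : ∀ a s, Admissible (!odd) s → koszulD t a s = 0 := by
    intro a s hs
    by_cases hd : a.degree = m ∧ s.degree = n + 1
    · have e1 : koszulD t a s = evalAlt (n + 1) (addHead a φ) s := by
        refine Finset.sum_congr rfl fun i hi => ?_
        have := degree_sub_gen hi
        simp only [t, addHead]
        rw [if_pos ⟨hs.of_le tsub_le_self, by simp [hd.1], by omega⟩]
      rw [e1]
      by_cases ha : a = 0
      · rw [← hφ.eval_eq s hs hd.2]
        refine evalAlt_congr hd.2 fun L hL _ => ?_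
        rcases L with _ | ⟨i, L⟩
        · simp at hL
        · simp [addHead, ha]
      · rw [← evalAlt_mid (n + 1) (hφ.admissible.cons a) hs]
        refine evalAlt_congr hd.2 fun L hL _ => ?_
        rw [← sub_eq_zero, ← mid_cons]
        refine hφ.mid_eq _ ?_ (by simp [hL])
        simpa using Ne.symm ha
    · refine Finset.sum_eq_zero fun i hi => ?_
      have := degree_sub_gen hi
      simp only [t]
      rw [if_neg, mul_zero]
      rintro ⟨-, h1, h2⟩
      rw [map_add, Finsupp.degree_single] at h1
      exact hd ⟨by omega, by omega⟩
  obtain ⟨u, hu1, hu2⟩ := koszul_exact (Nat.succ_ne_zero m) ht hK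
  -- The lists have length `n - 1`, since `koszulD u a s` with `s` of degree `n` uses `u` at vectors
  -- of degree `n - 1`. For `n = 0` the sum is empty and the truncated value does not matter.
  choose f hf1 hf2 using fun a => exists_section_evalAlt (n - 1) (u a)
  let top : List (ι →₀ ℕ) → k := fun w => match w with
    | [] => 0
    | c :: y => if Admissible odd c ∧ c.degree = m + 2 then f c y else 0
  have htop : ∀ c y, top (c :: y) ≠ 0 →
      Admissible odd c ∧ c.degree = m + 2 ∧ ∃ L : List ι, y = L.map gen := by
    intro c y h
    simp only [top] at h
    split_ifs at h with h1
    · exact ⟨h1.1, h1.2, hf1 _ _ h⟩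
    · exact absurd rfl h
  -- The slice of `φ` corrected by `top`. It is again a cocycle: lists with a first entry of degree
  -- above `m + 1` do not contribute for `φ`, and merging generators leaves the support of `top`.
  -- Its evaluations are `t a s - koszulD u a s = 0`.
  let θ : (ι →₀ ℕ) → List (ι →₀ ℕ) → k := fun a x => φ (a :: x) - addHead a top x
  have hθ : ∀ a : ι →₀ ℕ, Admissible odd a → a.degree = m + 1 → IsNullCocycle odd n (θ a) := by
    intro a ha hd
    have ha0 : a ≠ 0 := by rintro rfl; simp at hd
    refine ⟨fun x hx => ?_, fun x hx => ?_, fun x hx hl => ?_, fun s hs hsd => ?_⟩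
    · by_cases h : addHead a top x = 0
      · simp only [θ, h, sub_zero] at hx
        exact fun b hb => hφ.admissible _ hx b (List.mem_cons_of_mem _ hb)
      · obtain ⟨b, y, rfl, h⟩ := addHead_ne_zero h
        obtain ⟨h1, -, L, rfl⟩ := htop _ _ h
        simp only [List.mem_cons, List.mem_map]
        rintro c (rfl | ⟨i, -, rfl⟩)
        · exact h1.right
        · exact admissible_gen odd i
    · simp only [θ]
      rw [hφ.normalized _ (List.mem_cons_of_mem _ hx), zero_sub, neg_eq_zero]
      by_contra h
      obtain ⟨b, y, rfl, h⟩ := addHead_ne_zero h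
      obtain ⟨-, h2, L, rfl⟩ := htop _ _ h
      rcases List.mem_cons.mp hx with h3 | h3
      · rw [← h3, add_zero] at h2
        omega
      · exact zero_notMem_map_gen L h3
    · have e1 : mid (fun x => φ (a :: x)) x = 0 := by
        have h1 := hφ.mid_eq (a :: x) (by simp [hx, Ne.symm ha0]) (by simp [hl])
        rcases x with _ | ⟨b, y⟩
        · simp at hl
        simp only [List.mem_cons, not_or] at hx
        rw [mid_cons, addHead, hm _ _ (by simpa using hl) hx.2, zero_sub, neg_eq_zero] at h1
        · exact h1
        · have := degree_pos_of_ne_zero hx.1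
          rw [map_add]
          omega
      have e2 : mid (addHead a top) x = 0 := by
        rcases x with _ | ⟨b, y⟩
        · rfl
        simp only [List.mem_cons, not_or] at hx
        rw [mid_cons]
        have h1 : addHead b (addHead a top) y = 0 := by
          by_contra h
          obtain ⟨c, z, rfl, h⟩ := addHead_ne_zero h
          have h2 := (htop _ _ h).2.1
          simp only [List.mem_cons, not_or] at hx
          have h3 := degree_pos_of_ne_zero hx.1
          have h4 := degree_pos_of_ne_zero hx.2.1
          simp only [map_add] at h2
          omega
        rw [h1, zero_sub, neg_eq_zero]
        exact mid_eq_zero_of_gen (fun y h => (htop _ _ h).2.2) hx.2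
      simp only [θ]
      rw [mid_sub, e1, e2, sub_zero]
    · have e1 : evalAlt n (fun x => φ (a :: x)) s = t a s := (if_pos ⟨hs, hd, hsd⟩).symm
      simp only [θ]
      rw [evalAlt_sub, e1, ← hu2 a s ha hs hd, sub_eq_zero]
      rcases n with _ | n
      · have h0 := (Finsupp.degree_eq_zero_iff s).mp hsd
        subst h0
        simp [koszulD, evalAlt, addHead]
      · refine Finset.sum_congr rfl fun i hi => ?_
        simp only [addHead, top]
        congr 1
        by_cases h : Admissible odd (a + gen i)
        · have h1 : (a + gen i).degree = m + 2 := by simp [hd]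
          simp only [h, h1, true_and, if_true]
          refine ((hf2 _ _ ?_).symm)
          have := degree_sub_gen hi
          omega
        · rw [evalAlt_of_forall_eq_zero n fun x => if_neg fun h1 => h h1.1]
          by_contra h1
          exact h (hu1 _ _ h1).1
  have hex : ∀ a : ι →₀ ℕ, ∃ ψ : List (ι →₀ ℕ) → k, AdmissibleFun odd ψ ∧ Normalized ψ ∧
      (Admissible odd a → a.degree = m + 1 → ∀ x, 0 ∉ x → x.length = n → mid ψ x = θ a x) := by
    intro a
    by_cases h : Admissible odd a ∧ a.degree = m + 1
    · obtain ⟨ψ, h1, h2, h3⟩ := IH _ (hθ a h.1 h.2)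
      exact ⟨ψ, h1, h2, fun _ _ => h3⟩
    · exact ⟨fun _ => 0, fun x hx => absurd rfl hx, fun _ _ => rfl,
        fun h1 h2 => absurd ⟨h1, h2⟩ h⟩
  choose g hg1 hg2 hg3 using hex
  -- The minus sign compensates the one with which `mid` passes the first entry: on a slice of
  -- degree `m + 1` one gets `addHead a top + mid (g a)`, which is `φ`.
  let ψ : List (ι →₀ ℕ) → k := fun w => match w with
    | [] => 0
    | c :: y => if Admissible odd c then
        if c.degree = m + 2 then f c y else if c.degree = m + 1 then - g c y else 0
      else 0
  have hψ1 : ∀ c, c.degree = m + 2 → ∀ y, ψ (c :: y) = top (c :: y) := by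
    intro c h y
    simp [ψ, top, h]
  have hψ2 : ∀ c, Admissible odd c → c.degree = m + 1 → ∀ y, ψ (c :: y) = - g c y := by
    intro c h1 h2 y
    simp [ψ, h1, h2]
  have hψ3 : ∀ c, m + 2 < c.degree → ∀ y, ψ (c :: y) = 0 := by
    intro c h2 y
    simp only [ψ]
    rw [if_neg (by omega : ¬ c.degree = m + 2), if_neg (by omega : ¬ c.degree = m + 1), ite_self]
  have hψ4 : ∀ c, ¬ Admissible odd c → ∀ y, ψ (c :: y) = 0 := fun c h y => if_neg h
  have htop3 : ∀ c, m + 2 < c.degree → ∀ y, top (c :: y) = 0 := fun c h y =>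
    if_neg fun h1 => by omega
  refine ⟨ψ, ?_, ?_, ?_⟩
  · rintro (_ | ⟨c, y⟩) h
    · simp
    simp only [ψ] at h
    split_ifs at h with h1 h2 h3
    · obtain ⟨L, rfl⟩ := hf1 _ _ h
      simp only [List.mem_cons, List.mem_map]
      rintro b (rfl | ⟨i, -, rfl⟩)
      · exact h1
      · exact admissible_gen odd i
    · simp only [List.mem_cons]
      rintro b (rfl | hb)
      · exact h1
      · exact hg1 c y (neg_ne_zero.mp h) b hb
    · exact absurd rfl h
    · exact absurd rfl h
  · rintro (_ | ⟨c, y⟩) h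
    · simp at h
    by_contra h0
    simp only [ψ] at h0
    rw [List.mem_cons] at h
    split_ifs at h0 with h1 h2 h3
    · obtain ⟨L, rfl⟩ := hf1 _ _ h0
      rcases h with rfl | h
      · simp at h2
      · exact zero_notMem_map_gen L h
    · rcases h with rfl | h
      · simp at h3
      · exact h0 (by rw [hg2 c y h, neg_zero])
    · exact absurd rfl h0
    · exact absurd rfl h0
  · intro a x hl hx hd
    rw [mid_cons]
    have hadd : m + 1 ≤ a.degree → addHead a ψ x = addHead a top x := by
      intro h
      rcases x with _ | ⟨b, y⟩
      · rfl
      simp only [List.mem_cons, not_or] at hx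
      have h1 := degree_pos_of_ne_zero hx.1
      have h2 : (a + b).degree = a.degree + b.degree := map_add _ a b
      rw [addHead, addHead]
      rcases (by omega : (a + b).degree = m + 2 ∨ m + 2 < (a + b).degree) with h3 | h3
      · exact hψ1 _ h3 y
      · rw [hψ3 _ h3, htop3 _ h3]
    have hadd0 : m + 1 < a.degree → addHead a top x = 0 := by
      intro h
      rcases x with _ | ⟨b, y⟩
      · rfl
      simp only [List.mem_cons, not_or] at hx
      have h1 := degree_pos_of_ne_zero hx.1
      have h2 : (a + b).degree = a.degree + b.degree := map_add _ a b
      exact htop3 _ (by omega) y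
    rw [hadd hd]
    rcases (by omega : a.degree = m + 1 ∨ a.degree = m + 2 ∨ m + 2 < a.degree) with h | h | h
    · by_cases ha : Admissible odd a
      · have e : mid (fun y => ψ (a :: y)) x = - mid (g a) x := by
          rw [← neg_one_mul, ← mid_const_mul]
          refine mid_congr fun y _ => ?_
          rw [hψ2 a ha h, neg_one_mul]
        rw [e, hg3 a ha h x hx hl]
        simp only [θ]
        ring
      · rw [mid_eq_zero fun y _ => hψ4 a ha y, sub_zero,
          hφ.admissible.eq_zero List.mem_cons_self ha]
        by_contra h0
        obtain ⟨b, y, rfl, h0⟩ := addHead_ne_zero h0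
        exact ha (htop _ _ h0).1.left
    · rw [hadd0 (by omega), hm a x hl hx (by omega), mid_congr fun y _ => hψ1 a h y,
        mid_eq_zero_of_gen (fun y h0 => (htop _ _ h0).2.2) hx, sub_zero]
    · rw [hadd0 (by omega), hm a x hl hx (by omega), mid_eq_zero fun y _ => hψ3 a h y, sub_zero]

/-- Repeated use of `IsNullCocycle.lower_bound` lowers the bound on the degree of the first entry to
zero, where a normalized function has no values left. -/
theorem IsNullCocycle.isNullCoboundary_of_bound {odd : Bool} {n : ℕ}
    (IH : ∀ θ : List (ι →₀ ℕ) → k, IsNullCocycle odd n θ → IsNullCoboundary odd n θ) (m : ℕ)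
    {φ : List (ι →₀ ℕ) → k} (hφ : IsNullCocycle odd (n + 1) φ)
    (hm : ∀ a x, x.length = n → 0 ∉ x → m < a.degree → φ (a :: x) = 0) :
    IsNullCoboundary odd (n + 1) φ := by
  classical
  induction m generalizing φ with
  | zero =>
    refine ⟨fun _ => 0, fun x hx => absurd rfl hx, fun _ _ => rfl, fun x hx hl => ?_⟩
    rcases x with _ | ⟨a, x⟩
    · simp at hl
    simp only [List.mem_cons, not_or] at hx
    rw [mid_zero, hm a x (by simpa using hl) hx.2 (degree_pos_of_ne_zero hx.1)]
  | succ m ih =>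
    obtain ⟨ψ, h1, h2, h3⟩ := hφ.lower_bound IH hm
    -- Values at lists with a zero are discarded to stay normalized; merges of a list without zeros
    -- never produce one.
    let φ' : List (ι →₀ ℕ) → k := fun x => if 0 ∈ x then 0 else φ x - mid ψ x
    have hφ' : IsNullCocycle odd (n + 1) φ' := by
      refine ⟨fun x hx => ?_, fun x hx => if_pos hx, fun x hx hl => ?_, fun s hs hd => ?_⟩
      · simp only [φ'] at hx
        split_ifs at hx with h0
        · exact absurd rfl hx
        · by_cases h4 : φ x = 0
          · exact h1.mid x fun h5 => hx (by rw [h4, h5, sub_zero])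
          · exact hφ.admissible x h4
      · rw [mid_congr fun y hy => if_neg (hy.zero_notMem hx), mid_sub, hφ.mid_eq x hx hl, mid_mid,
          sub_zero]
      · have e := evalAlt_sub (n + 1) φ (mid ψ) s
        rw [hφ.eval_eq s hs hd, evalAlt_mid (n + 1) h1 hs, sub_zero] at e
        rw [← e]
        refine evalAlt_congr hd fun L _ _ => if_neg (zero_notMem_map_gen L)
    obtain ⟨χ, h4, h5, h6⟩ := ih hφ' fun a x hl hx hd => by
      simp only [φ']
      rw [h3 a x hl hx hd, sub_self, ite_self]
    refine ⟨fun x => χ x - (-1) * ψ x, fun x hx => ?_, fun x hx => by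
      simp [h5 x hx, h2 x hx], fun x hx hl => ?_⟩
    · by_cases h7 : χ x = 0
      · exact h1 x fun h8 => hx (by simp [h7, h8])
      · exact h4 x h7
    · rw [mid_sub, mid_const_mul, h6 x hx hl]
      simp only [φ']
      rw [if_neg hx]
      ring

theorem evalAlt_indicator_sum (n : ℕ) {s : ι →₀ ℕ} (hs : s.degree = n)
    (p : (ι →₀ ℕ) → Prop) [DecidablePred p] (φ : List (ι →₀ ℕ) → k) :
    evalAlt n (fun x => if p x.sum then φ x else 0) s = if p s then evalAlt n φ s else 0 := by
  split_ifs with h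
  · exact evalAlt_congr hs fun L _ hL => by rw [hL, if_pos h]
  · exact evalAlt_eq_zero hs fun L _ hL => by rw [hL, if_neg h]

/-- The part of `φ` at lists with sum `b` is again a null cocycle, and there the degree of the first
entry is at most that of `b`. The solutions for the various `b` do not interact, so they can be
assembled. -/
theorem isNullCoboundary (odd : Bool) (n : ℕ) {φ : List (ι →₀ ℕ) → k}
    (hφ : IsNullCocycle odd n φ) : IsNullCoboundary odd n φ := by
  classical
  induction n generalizing φ with
  | zero =>
    refine ⟨fun _ => 0, fun x hx => absurd rfl hx, fun _ _ => rfl, fun x hx hl => ?_⟩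
    rw [List.length_eq_zero_iff.mp hl]
    exact (hφ.eval_eq 0 (admissible_zero _) (by simp)).symm
  | succ n ih =>
    have key : ∀ b : ι →₀ ℕ, IsNullCoboundary odd (n + 1) fun x => if x.sum = b then φ x else 0 := by
      intro b
      refine IsNullCocycle.isNullCoboundary_of_bound (fun θ => ih) b.degree ⟨?_, ?_, ?_, ?_⟩ ?_
      · intro x hx
        exact hφ.admissible x fun h => hx (by simp [h])
      · intro x hx
        simp [hφ.normalized x hx]
      · intro x hx hl
        by_cases h : x.sum = b
        · rw [mid_congr fun y hy => if_pos (hy.sum_eq.trans h), hφ.mid_eq x hx hl]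
        · exact mid_eq_zero fun y hy => if_neg fun h1 => h (hy.sum_eq ▸ h1)
      · intro s hs hd
        rw [evalAlt_indicator_sum (n + 1) hd (· = b), hφ.eval_eq s hs hd, ite_self]
      · intro a x _ _ hd
        refine if_neg ?_
        rintro rfl
        refine absurd (degree_le_of_le (?_ : a ≤ (a :: x).sum)) (not_le.mpr hd)
        rw [List.sum_cons]
        exact le_self_add
    choose ψ h1 h2 h3 using key
    refine ⟨fun x => ψ x.sum x, fun x hx => h1 _ x hx, fun x hx => h2 _ x hx, fun x hx hl => ?_⟩
    rw [mid_congr (ψ := ψ x.sum) fun y hy => by rw [hy.sum_eq], h3 _ x hx hl]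
    exact if_pos rfl

end Exactness

/-! ### Finiteness of sets of lists with prescribed sum -/

section FiniteLists

variable {ι : Type*}

theorem finite_lists_of_mem {T : Set (ι →₀ ℕ)} (hT : T.Finite) (n : ℕ) :
    {w : List (ι →₀ ℕ) | w.length = n ∧ ∀ a ∈ w, a ∈ T}.Finite := by
  induction n with
  | zero => exact (Set.finite_singleton []).subset fun w hw => List.length_eq_zero_iff.mp hw.1
  | succ n ih =>
    refine (hT.image2 List.cons ih).subset ?_
    rintro (_ | ⟨a, w⟩) ⟨h1, h2⟩
    · simp at h1
    · exact ⟨a, h2 a (by simp), w, ⟨by simpa using h1, fun b hb => h2 b (by simp [hb])⟩, rfl⟩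

/-- Each entry lies below the sum, and only finitely many exponent vectors lie below a given one. -/
theorem finite_lists_of_sum_mem {S : Set (ι →₀ ℕ)} (hS : S.Finite) (n : ℕ) :
    {w : List (ι →₀ ℕ) | w.length = n ∧ w.sum ∈ S}.Finite := by
  classical
  refine (finite_lists_of_mem (hS.biUnion fun b _ => Set.finite_Iic b) n).subset ?_
  rintro w ⟨h1, h2⟩
  exact ⟨h1, fun a ha => Set.mem_biUnion h2 (List.single_le_sum (fun _ _ => bot_le) a ha)⟩

theorem exists_list_sum_gen (s : ι →₀ ℕ) :
    ∃ L : List ι, (L.map gen).sum = s ∧ L.length = s.degree := by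
  induction s using Finsupp.induction_linear with
  | zero => exact ⟨[], by simp⟩
  | add f g hf hg =>
    obtain ⟨L, rfl, h⟩ := hf
    obtain ⟨L', rfl, h'⟩ := hg
    exact ⟨L ++ L', by simp, by simp [h, h']⟩
  | single i n => exact ⟨List.replicate n i, by simp, by simp⟩

end FiniteLists

/-! ### From the cobar complex to the coHochschild complex -/

section HochschildExactness

variable {k ι : Type*} [Field k] [LinearOrder ι]

/-- Normalized cocycles of degree `n` of the coHochschild complex on which the reduced
evaluations vanish. -/
structure IsNullHochCocycle (odd : Bool) (n : ℕ) (Z : List (ι →₀ ℕ) → k) : Prop where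
  admissible : AdmissibleFun odd Z
  normalized : NormalizedTail Z
  hochD_eq : ∀ w, w.length = n + 2 → hochD odd Z w = 0
  eval_eq : ∀ a s, Admissible (!odd) s → s.degree = n → evalAlt n (fun x => Z (a :: x)) s = 0

/-- Induction on a strict bound `B` for the degree of the first entry. The first and the last face
raise this degree when the other entries are nonzero, so on the slices of top degree the
differential is, up to sign, that of the cobar complex. -/
theorem IsNullHochCocycle.exists_of_bound {odd : Bool} {n : ℕ} (B : ℕ)
    {Z : List (ι →₀ ℕ) → k} (hZ : IsNullHochCocycle odd n Z)
    (hB : ∀ a x, x.length = n → B ≤ a.degree → Z (a :: x) = 0) :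
    ∃ Y : List (ι →₀ ℕ) → k, AdmissibleFun odd Y ∧ NormalizedTail Y ∧
      ∀ w, w.length = n + 1 → hochD odd Y w = Z w := by
  classical
  induction B generalizing Z with
  | zero =>
    refine ⟨fun _ => 0, fun x hx => absurd rfl hx, fun _ _ _ => rfl, fun w hw => ?_⟩
    rcases w with _ | ⟨a, x⟩
    · simp at hw
    rw [hochD_zero, hB a x (by simpa using hw) (Nat.zero_le _)]
  | succ B ih =>
    have hex : ∀ a : ι →₀ ℕ, ∃ ψ : List (ι →₀ ℕ) → k, AdmissibleFun odd ψ ∧ Normalized ψ ∧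
        (a.degree = B → ∀ x, 0 ∉ x → x.length = n → mid ψ x = Z (a :: x)) := by
      intro a
      by_cases ha : a.degree = B
      -- The two faces that change the head vanish by the bound, so the cocycle condition for `Z`
      -- reduces to the one for its slice.
      · have : IsNullCocycle odd n fun x => Z (a :: x) := by
          refine ⟨hZ.admissible.cons a, fun x => hZ.normalized a x, fun x hx hl => ?_,
            hZ.eval_eq a⟩
          have h := hZ.hochD_eq (a :: x) (by simp [hl])
          have h1 : addHead a Z x = 0 := by
            rcases x with _ | ⟨b, y⟩
            · rfl
            simp only [List.mem_cons, not_or] at hx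
            have := degree_pos_of_ne_zero hx.1
            exact hB _ _ (by simpa using hl) (by rw [map_add]; omega)
          have h2 : lastFace odd Z (a :: x) = 0 := by
            rcases List.eq_nil_or_concat' x with rfl | ⟨y, l, rfl⟩
            · simp
            have h0 : ¬ 0 = l := fun h => hx (by simp [h])
            have := degree_pos_of_ne_zero h0
            rw [lastFace_append, hB _ _ (by simpa using hl) (by rw [map_add]; omega), mul_zero]
          rw [hochD, mid_cons, h1, h2] at h
          simpa using h
        obtain ⟨ψ, h1, h2, h3⟩ := isNullCoboundary odd n this
        exact ⟨ψ, h1, h2, fun _ => h3⟩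
      · exact ⟨fun _ => 0, fun x hx => absurd rfl hx, fun _ _ => rfl, fun h => absurd h ha⟩
    choose ψ h1 h2 h3 using hex
    -- The factor `-1` undoes the sign of `mid` behind the first entry. On the top slices `hochD Y`
    -- is then `Z`, and subtracting it lowers the bound.
    let Y : List (ι →₀ ℕ) → k := fun w => match w with
      | [] => 0
      | c :: y => if Admissible odd c ∧ c.degree = B then -1 * ψ c y else 0
    have hY1 : AdmissibleFun odd Y := by
      rintro (_ | ⟨c, y⟩) h
      · simp
      simp only [Y] at h
      split_ifs at h with h4
      · simp only [List.mem_cons]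
        rintro b (rfl | hb)
        · exact h4.1
        · exact h1 c y (right_ne_zero_of_mul h) b hb
      · exact absurd rfl h
    have hY2 : NormalizedTail Y := by
      intro c y hy
      simp only [Y]
      rw [h2 c y hy, mul_zero, ite_self]
    have hY3 : ∀ c, c.degree ≠ B → ∀ y, Y (c :: y) = 0 := fun c hc y => if_neg fun h => hc h.2
    have hZ' : IsNullHochCocycle odd n fun w => Z w - hochD odd Y w := by
      refine ⟨fun x hx => ?_, fun a x hx => ?_, fun w hw => ?_, fun a s hs hd => ?_⟩
      · by_cases h4 : Z x = 0
        · exact hY1.hochD x fun h5 => hx (by simp [h4, h5])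
        · exact hZ.admissible x h4
      · simp [hZ.normalized a x hx, hY2.hochD a x hx]
      · rw [hochD_sub, hochD_hochD hY1, hZ.hochD_eq w hw, sub_zero]
      · rw [evalAlt_sub, hZ.eval_eq a s hs hd, evalAlt_hochD hY1 hs hd, sub_zero]
    obtain ⟨X, h4, h5, h6⟩ := ih hZ' fun a x hl hd => by
      rw [sub_eq_zero]
      by_cases hx : 0 ∈ x
      · rw [hZ.normalized a x hx, hY2.hochD a x hx]
      have e1 : addHead a Y x = 0 := by
        rcases x with _ | ⟨b, y⟩
        · rfl
        simp only [List.mem_cons, not_or] at hx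
        have := degree_pos_of_ne_zero hx.1
        exact hY3 _ (by rw [map_add]; omega) _
      have e2 : lastFace odd Y (a :: x) = 0 := by
        rcases List.eq_nil_or_concat' x with rfl | ⟨y, l, rfl⟩
        · simp
        have h0 : ¬ 0 = l := fun h => hx (by simp [h])
        have := degree_pos_of_ne_zero h0
        rw [lastFace_append, hY3 _ (by rw [map_add]; omega), mul_zero]
      rw [hochD, mid_cons, e1, e2, mul_zero, add_zero, zero_sub]
      by_cases ha : Admissible odd a
      · by_cases hd' : a.degree = B
        · rw [mid_congr fun y _ => if_pos ⟨ha, hd'⟩, mid_const_mul, h3 a hd' x hx hl]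
          ring
        · rw [hB a x hl (by omega), mid_eq_zero fun y _ => hY3 a hd' y, neg_zero]
      · rw [hZ.admissible.eq_zero List.mem_cons_self ha,
          mid_eq_zero fun y _ => hY1.eq_zero List.mem_cons_self ha, neg_zero]
    refine ⟨fun x => X x - (-1) * Y x, fun x hx => ?_, fun a x hx => by
      simp [h5 a x hx, hY2 a x hx], fun w hw => ?_⟩
    · by_cases h7 : X x = 0
      · exact hY1 x fun h8 => hx (by simp [h7, h8])
      · exact h4 x h7
    · rw [hochD_sub, hochD_const_mul, h6 w hw]
      ring

/-- The bound needed for the descent exists in each multidegree. Solving there separately and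
keeping only the finitely many multidegrees of `Z` gives a solution of finite support, hence one
that comes from an element of the tensor power. -/
theorem IsNullHochCocycle.exists_hochD_eq {odd : Bool} {n : ℕ} {Z : List (ι →₀ ℕ) → k}
    (hZ : IsNullHochCocycle odd n Z) (hlen : ∀ w, Z w ≠ 0 → w.length = n + 1)
    (hfin : (Function.support Z).Finite) :
    ∃ Y : List (ι →₀ ℕ) → k, AdmissibleFun odd Y ∧ NormalizedTail Y ∧
      (Function.support Y).Finite ∧ (∀ w, Y w ≠ 0 → w.length = n) ∧
      ∀ w, hochD odd Y w = Z w := by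
  classical
  have key : ∀ b : ι →₀ ℕ, ∃ Y : List (ι →₀ ℕ) → k, AdmissibleFun odd Y ∧ NormalizedTail Y ∧
      ∀ w, w.length = n + 1 → hochD odd Y w = if w.sum = b then Z w else 0 := by
    intro b
    refine IsNullHochCocycle.exists_of_bound (b.degree + 1) ⟨?_, ?_, ?_, ?_⟩ ?_
    · intro x hx
      exact hZ.admissible x fun h => hx (by simp [h])
    · intro a x hx
      simp [hZ.normalized a x hx]
    · intro w hw
      rw [hochD_indicator odd (fun c _ => c = b), hZ.hochD_eq w hw, ite_self]
    · intro a s hs hd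
      refine (evalAlt_congr hd fun L _ _ => ?_).trans ((evalAlt_indicator_sum n hd
        (fun c => a + c = b) fun x => Z (a :: x)).trans ?_)
      · by_cases h : (a :: L.map gen).sum = b
        · exact (if_pos h).trans (if_pos h).symm
        · exact (if_neg h).trans (if_neg h).symm
      · rw [hZ.eval_eq a s hs hd, ite_self]
    · intro a x _ hd
      refine if_neg ?_
      rintro rfl
      have : a ≤ (a :: x).sum := by
        rw [List.sum_cons]
        exact le_self_add
      have := degree_le_of_le this
      omega
  choose Y h1 h2 h3 using key
  -- The sums at which `Z` is nonzero. The solution is cut off outside `S`, which is compatible with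
  -- `hochD` because faces preserve sums.
  let S : Set (ι →₀ ℕ) := List.sum '' Function.support Z
  have hS : S.Finite := hfin.image _
  refine ⟨fun w => if w.sum ∈ S ∧ w.length + 1 = n + 1 then Y w.sum w else 0, fun w hw => ?_,
    fun a x hx => ?_, (finite_lists_of_sum_mem hS n).subset fun w hw => ?_, fun w hw => ?_,
    fun w => ?_⟩
  · exact h1 w.sum w fun h => hw (by simp [h])
  · simp [h2 _ a x hx]
  · have := (ite_ne_right_iff.mp hw).1
    exact ⟨by omega, this.1⟩
  · have := (ite_ne_right_iff.mp hw).1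
    omega
  · rw [hochD_indicator odd (fun c m => c ∈ S ∧ m = n + 1) (fun w => Y w.sum w)]
    split_ifs with h
    · rw [hochD_congr (ψ := Y w.sum) fun y hy _ => by rw [hy], h3 _ w h.2, if_pos rfl]
    · by_contra h0
      exact h ⟨⟨w, Ne.symm h0, rfl⟩, hlen w (Ne.symm h0)⟩

end HochschildExactness

/-! ### Explicit cocycles by insertion of generators -/

section Insertion

variable (k : Type*) {ι : Type*} [Field k]

/-- The number `1 + σ + ⋯ + σ ^ (n - 1)`, where `σ` is the sign `sigma`. -/
def signedNat (odd : Bool) (n : ℕ) : k := ∑ j ∈ Finset.range n, sigma k odd ^ j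

variable {k}

@[simp] theorem signedNat_zero (odd : Bool) : signedNat k odd 0 = 0 := rfl

@[simp] theorem signedNat_one (odd : Bool) : signedNat k odd 1 = 1 := by simp [signedNat]

/-- The twisted additivity that makes `b ↦ signedNat (b i)` behave as a derivation, that is, a
one-cocycle. -/
theorem signedNat_add (odd : Bool) (m n : ℕ) :
    signedNat k odd (m + n) = signedNat k odd m + sigma k odd ^ m * signedNat k odd n := by
  simp only [signedNat, Finset.sum_range_add, Finset.mul_sum, pow_add]

theorem signedNat_two_of_odd : signedNat k true 2 = 0 := by
  simp [signedNat, sigma, Finset.sum_range_succ]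

/-- The insertion of a generator in the second position: the cap product with the corresponding
class of degree one. -/
def insertGen (odd : Bool) (i : ι) (Z : List (ι →₀ ℕ) → k) : List (ι →₀ ℕ) → k
  | a :: b :: x => sigma k odd ^ a i * signedNat k odd (b i) * Z ((a + b - gen i) :: x)
  | _ => 0

theorem insertGen_cons_cons (odd : Bool) (i : ι) (Z : List (ι →₀ ℕ) → k) (a b : ι →₀ ℕ)
    (x : List (ι →₀ ℕ)) : insertGen odd i Z (a :: b :: x) =
      sigma k odd ^ a i * signedNat k odd (b i) * Z ((a + b - gen i) :: x) := rfl

theorem insertGen_ne_zero {odd : Bool} {i : ι} {Z : List (ι →₀ ℕ) → k} {w : List (ι →₀ ℕ)}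
    (h : insertGen odd i Z w ≠ 0) : ∃ a b x, w = a :: (b + gen i) :: x ∧
      signedNat k odd (b i + 1) ≠ 0 ∧ Z ((a + b) :: x) ≠ 0 := by
  rcases w with _ | ⟨a, _ | ⟨b, x⟩⟩
  · exact absurd rfl h
  · exact absurd rfl h
  rw [insertGen_cons_cons] at h
  have h1 := right_ne_zero_of_mul (left_ne_zero_of_mul h)
  have h2 := right_ne_zero_of_mul h
  have hb : i ∈ b.support := by
    rw [Finsupp.mem_support_iff]
    intro h0
    rw [h0] at h1
    exact h1 rfl
  have e := eq_add_gen hb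
  refine ⟨a, b - gen i, x, by rw [← e], ?_, ?_⟩
  · have := Finsupp.mem_support_iff.mp hb
    have : (b - gen i) i + 1 = b i := by
      rw [Finsupp.tsub_apply, Finsupp.single_eq_same]
      omega
    rwa [this]
  · rw [e, ← add_assoc, add_tsub_cancel_right] at h2
    exact h2

/-- In the odd case inserting `gen i` next to an existing copy would break admissibility, but then
the coefficient is `signedNat 2 = 0`. -/
theorem AdmissibleFun.insertGen {odd : Bool} {Z : List (ι →₀ ℕ) → k} (hZ : AdmissibleFun odd Z)
    (i : ι) : AdmissibleFun odd (insertGen odd i Z) := by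
  intro w hw
  obtain ⟨a, b, x, rfl, h1, h2⟩ := insertGen_ne_zero hw
  have h3 := hZ _ h2
  simp only [List.mem_cons, forall_eq_or_imp] at h3 ⊢
  refine ⟨h3.1.left, fun ho j => ?_, h3.2⟩
  subst ho
  have h4 := h3.1.right rfl j
  by_cases hij : i = j
  · subst hij
    have : b i ≠ 1 := by
      intro h5
      rw [h5] at h1
      exact h1 signedNat_two_of_odd
    simp
    omega
  · simpa [hij] using h4

theorem NormalizedTail.insertGen {odd : Bool} {Z : List (ι →₀ ℕ) → k} (hZ : NormalizedTail Z)
    (i : ι) : NormalizedTail (insertGen odd i Z) := by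
  intro a x hx
  rcases x with _ | ⟨b, x⟩
  · rfl
  rw [insertGen_cons_cons]
  rcases List.mem_cons.mp hx with h | h
  · simp [← h]
  · rw [hZ _ x h, mul_zero]

/-- Carrying `l` to the front changes the prefactor by `σ ^ l i`. The sign of the last face changes
by the same amount, since the entry passed by `l` contains one more copy of `gen i`. -/
theorem lastFace_insertGen {odd : Bool} {Z : List (ι →₀ ℕ) → k} (hZ : AdmissibleFun odd Z)
    (i : ι) (w : List (ι →₀ ℕ)) :
    lastFace odd (insertGen odd i Z) w = insertGen odd i (lastFace odd Z) w := by
  rcases w with _ | ⟨a, _ | ⟨b, x⟩⟩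
  · rfl
  · rfl
  rcases List.eq_nil_or_concat' x with rfl | ⟨x, l, rfl⟩
  · rw [insertGen_cons_cons, lastFace_singleton, mul_zero]
    exact (lastFace_append odd _ a b []).trans (by simp [insertGen])
  rw [insertGen_cons_cons, lastFace_append, ← List.cons_append, lastFace_append,
    insertGen_cons_cons]
  rcases Nat.eq_zero_or_pos (b i) with hb | hb
  · simp [hb]
  have e := eq_add_gen (Finsupp.mem_support_iff.mpr hb.ne')
  generalize b - gen i = c at e
  subst e
  rw [← add_assoc, ← add_assoc, add_tsub_cancel_right, add_tsub_cancel_right, ← add_assoc]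
  by_cases h : Z ((l + a + c) :: x) = 0
  · simp [h]
  have h1 : dotSign k odd l c = 1 := dotSign_of_admissible
    ((hZ _ h _ List.mem_cons_self).of_le (by rw [add_right_comm]; exact le_self_add))
  have h2 : sigma k odd ^ l i * sigma k odd ^ l i = 1 := by
    rw [← mul_pow, sigma_mul_self, one_pow]
  simp only [List.sum_cons, dotSign_add_right, h1, dotSign_gen_right, Finsupp.add_apply, pow_add]
  linear_combination (sigma k odd ^ a i * signedNat k odd (c i + gen i i) *
    dotSign k odd l x.sum * Z ((l + a + c) :: x)) * h2

/-- The first two merges involve the prefactors `σ^{(a+b) i} [c i]` and `σ^{a i} [(b+c) i]` with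
`[·] = signedNat`. By `signedNat_add` their difference is `-σ^{a i} [b i]`. -/
theorem mid_insertGen (odd : Bool) (i : ι) (Z : List (ι →₀ ℕ) → k) (w : List (ι →₀ ℕ)) :
    mid (insertGen odd i Z) w = - insertGen odd i (mid Z) w := by
  rcases w with _ | ⟨a, _ | ⟨b, _ | ⟨c, x⟩⟩⟩
  · simp [insertGen]
  · simp [insertGen]
  · simp [insertGen, mid_cons_cons]
  have e : mid (fun y => insertGen odd i Z (a :: b :: y)) (c :: x) =
      sigma k odd ^ a i * signedNat k odd (b i) *
        mid (fun y => Z ((a + b - gen i) :: y)) (c :: x) := mid_const_mul _ _ _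
  rw [mid_cons_cons, mid_cons_cons, e, insertGen_cons_cons, insertGen_cons_cons,
    insertGen_cons_cons, mid_cons_cons, Finsupp.add_apply, Finsupp.add_apply, signedNat_add,
    pow_add]
  rcases Nat.eq_zero_or_pos (b i) with hb | hb
  · simp [hb, add_assoc]
  · have hc : a + b - gen i + c = a + b + c - gen i := by
      refine tsub_add_eq_add_tsub ?_
      rw [Finsupp.single_le_iff, Finsupp.add_apply]
      omega
    rw [hc, ← add_assoc]
    ring

theorem hochD_insertGen {odd : Bool} {Z : List (ι →₀ ℕ) → k} (hZ : AdmissibleFun odd Z)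
    (i : ι) (w : List (ι →₀ ℕ)) :
    hochD odd (insertGen odd i Z) w = - insertGen odd i (hochD odd Z) w := by
  rw [hochD, mid_insertGen, lastFace_insertGen hZ]
  rcases w with _ | ⟨a, _ | ⟨b, x⟩⟩
  · simp [insertGen]
  · simp [insertGen]
  · simp only [insertGen_cons_cons, hochD, List.length_cons, pow_succ]
    ring

/-- The function supported on lists of length one. -/
def single₁ (c : (ι →₀ ℕ) → k) : List (ι →₀ ℕ) → k
  | [a] => c a
  | _ => 0

/-- Cocommutativity: in degree zero both cofaces evaluate at `a + b`, so every element of `C` is a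
cocycle. -/
theorem hochD_single₁ (odd : Bool) (c : (ι →₀ ℕ) → k) (w : List (ι →₀ ℕ)) :
    hochD odd (single₁ c) w = 0 := by
  rcases w with _ | ⟨a, _ | ⟨b, _ | ⟨d, x⟩⟩⟩
  · simp [hochD]
  · simp [hochD]
  · have := lastFace_append odd (single₁ c) a b []
    rw [List.nil_append] at this
    rw [hochD, this, mid_cons_cons]
    simp [single₁, add_comm, pow_succ]
  · rw [hochD, mid_eq_zero]
    · rcases List.eq_nil_or_concat' (b :: d :: x) with h | ⟨y, l, h⟩
      · simp at h
      · rw [h, lastFace_append]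
        have : y ≠ [] := by rintro rfl; simp at h
        rcases y with _ | ⟨e, y⟩
        · exact absurd rfl this
        · simp [single₁]
    · intro y hy
      have := hy.length_eq
      rcases y with _ | ⟨e, _ | ⟨f, y⟩⟩
      · rfl
      · simp at this
      · rfl

/-- Insertion of several generators. -/
def insertGens (odd : Bool) (Z : List (ι →₀ ℕ) → k) : List ι → List (ι →₀ ℕ) → k
  | [] => Z
  | i :: L => insertGen odd i (insertGens odd Z L)

theorem insertGens_support {odd : Bool} {a : ι →₀ ℕ} {c : (ι →₀ ℕ) → k}
    (hc : ∀ b, c b ≠ 0 → b = a) (L : List ι) {w : List (ι →₀ ℕ)}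
    (h : insertGens odd (single₁ c) L w ≠ 0) : w.length = L.length + 1 ∧ w.sum = a + (L.map gen).sum := by
  induction L generalizing w with
  | nil =>
    rcases w with _ | ⟨b, _ | ⟨d, x⟩⟩
    · exact absurd rfl h
    · simp [hc b h]
    · exact absurd rfl h
  | cons i L ih =>
    obtain ⟨b, d, x, rfl, -, h2⟩ := insertGen_ne_zero h
    obtain ⟨h3, h4⟩ := ih h2
    simp only [List.length_cons, List.sum_cons, List.map_cons] at h3 h4 ⊢
    refine ⟨by omega, ?_⟩
    rw [add_left_comm a, ← h4]
    abel

theorem AdmissibleFun.insertGens {odd : Bool} {Z : List (ι →₀ ℕ) → k} (hZ : AdmissibleFun odd Z)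
    (L : List ι) : AdmissibleFun odd (insertGens odd Z L) := by
  induction L with
  | nil => exact hZ
  | cons i L ih => exact ih.insertGen i

theorem admissibleFun_single₁ {odd : Bool} {c : (ι →₀ ℕ) → k}
    (hc : ∀ b, c b ≠ 0 → Admissible odd b) : AdmissibleFun odd (single₁ c) := by
  rintro (_ | ⟨b, _ | ⟨d, x⟩⟩) hw
  · simp
  · simpa using hc b hw
  · exact absurd rfl hw

theorem insertGens_normalized (odd : Bool) (c : (ι →₀ ℕ) → k) (L : List ι) :
    NormalizedTail (insertGens odd (single₁ c) L) := by
  induction L with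
  | nil =>
    intro a x hx
    rcases x with _ | ⟨d, x⟩
    · simp at hx
    · rfl
  | cons i L ih => exact ih.insertGen i

theorem hochD_insertGens {odd : Bool} {c : (ι →₀ ℕ) → k}
    (hc : ∀ b, c b ≠ 0 → Admissible odd b) (L : List ι) (w : List (ι →₀ ℕ)) :
    hochD odd (insertGens odd (single₁ c) L) w = 0 := by
  induction L generalizing w with
  | nil => exact hochD_single₁ odd c w
  | cons i L ih =>
    rw [insertGens, hochD_insertGen ((admissibleFun_single₁ hc).insertGens L)]
    rcases w with _ | ⟨a, _ | ⟨b, x⟩⟩ <;> simp [insertGen, ih]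

variable [LinearOrder ι]

/-- At a generator `gen j` in second position the coefficient `signedNat (gen j i)` is one for `j =
i` and zero otherwise. Evaluation thus strips off the inserted generator. -/
theorem evalAlt_insertGen (odd : Bool) (i : ι) (Z : List (ι →₀ ℕ) → k) (n : ℕ) (a s : ι →₀ ℕ) :
    evalAlt (n + 1) (fun x => insertGen odd i Z (a :: x)) s = if i ∈ s.support then
      chi k (gen i) (s - gen i) * (sigma k odd ^ a i * evalAlt n (fun x => Z (a :: x)) (s - gen i))
      else 0 := by
  have key : ∀ j, evalAlt n (fun x => insertGen odd i Z (a :: gen j :: x)) (s - gen j) =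
      if j = i then sigma k odd ^ a i * evalAlt n (fun x => Z (a :: x)) (s - gen i) else 0 := by
    intro j
    simp only [insertGen_cons_cons]
    split_ifs with h
    · subst h
      simp only [add_tsub_cancel_right, Finsupp.single_eq_same, signedNat_one, mul_one]
      rw [evalAlt_const_mul]
    · exact evalAlt_of_forall_eq_zero n fun x => by simp [Ne.symm h]
  simp only [evalAlt_succ, key, mul_ite, mul_zero, Finset.sum_ite_eq']

/-- The inserted cocycles are dual to the evaluations up to a nonzero factor, a product of signs
that depends on `a` and on the list but not on `s`. -/
theorem evalAlt_insertGens (odd : Bool) (c : (ι →₀ ℕ) → k) (L : List ι) :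
    ∀ a : ι →₀ ℕ, ∃ ε : k, ε ≠ 0 ∧ ∀ s : ι →₀ ℕ, s.degree = L.length →
      evalAlt L.length (fun x => insertGens odd (single₁ c) L (a :: x)) s =
        if s = (L.map gen).sum then ε * c a else 0 := by
  intro a
  induction L with
  | nil =>
    refine ⟨1, one_ne_zero, fun s hs => ?_⟩
    rw [(Finsupp.degree_eq_zero_iff s).mp hs]
    simp [evalAlt, insertGens, single₁]
  | cons i L ih =>
    obtain ⟨ε, h1, h2⟩ := ih
    refine ⟨chi k (gen i) (L.map gen).sum * (sigma k odd ^ a i * ε),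
      mul_ne_zero (chi_ne_zero _ _) (mul_ne_zero (pow_ne_zero _ fun h => ?_) h1), fun s hs => ?_⟩
    · simpa [h] using sigma_mul_self (k := k) odd
    · rw [List.length_cons, insertGens, evalAlt_insertGen, List.map_cons, List.sum_cons]
      by_cases hi : i ∈ s.support
      · have := degree_sub_gen hi
        rw [if_pos hi, h2 _ (by rw [List.length_cons] at hs; omega)]
        have e : s - gen i = (L.map gen).sum ↔ s = gen i + (L.map gen).sum := by
          conv_rhs => rw [eq_add_gen hi, add_comm, add_right_inj]
        by_cases h : s - gen i = (L.map gen).sum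
        · rw [if_pos h, if_pos (e.mp h), h]
          ring
        · rw [if_neg h, if_neg fun h3 => h (e.mpr h3)]
          ring
      · rw [if_neg hi, if_neg]
        rintro rfl
        simp at hi

end Insertion

/-! ### The doubled generating set `ι ⊕ₗ ι` -/

section Doubling

variable {ι : Type*}

/-- The left copy of the generators. -/
def inL (i : ι) : ι ⊕ₗ ι := toLex (.inl i)

/-- The right copy of the generators. -/
def inR (i : ι) : ι ⊕ₗ ι := toLex (.inr i)

theorem inL_injective : Function.Injective (inL : ι → ι ⊕ₗ ι) :=
  toLex.injective.comp Sum.inl_injective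

theorem inR_injective : Function.Injective (inR : ι → ι ⊕ₗ ι) :=
  toLex.injective.comp Sum.inr_injective

theorem inL_ne_inR (i j : ι) : inL i ≠ inR j := fun h => Sum.inl_ne_inr (toLex.injective h)

theorem inL_or_inR (x : ι ⊕ₗ ι) : (∃ i, x = inL i) ∨ ∃ j, x = inR j := by
  rcases h : ofLex x with i | j
  · exact Or.inl ⟨i, by rw [inL, ← h, toLex_ofLex]⟩
  · exact Or.inr ⟨j, by rw [inR, ← h, toLex_ofLex]⟩

/-- The exponents of the left generators. -/
def leftPart : (ι ⊕ₗ ι →₀ ℕ) →+ (ι →₀ ℕ) := Finsupp.comapDomain.addMonoidHom inL_injective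

/-- The exponents of the right generators. -/
def rightPart : (ι ⊕ₗ ι →₀ ℕ) →+ (ι →₀ ℕ) := Finsupp.comapDomain.addMonoidHom inR_injective

@[simp] theorem leftPart_apply (v : ι ⊕ₗ ι →₀ ℕ) (i : ι) : leftPart v i = v (inL i) := rfl

@[simp] theorem rightPart_apply (v : ι ⊕ₗ ι →₀ ℕ) (i : ι) : rightPart v i = v (inR i) := rfl

theorem ext_parts {v w : ι ⊕ₗ ι →₀ ℕ} (h1 : leftPart v = leftPart w)
    (h2 : rightPart v = rightPart w) : v = w := by
  ext x
  rcases inL_or_inR x with ⟨i, rfl⟩ | ⟨i, rfl⟩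
  · exact DFunLike.congr_fun h1 i
  · exact DFunLike.congr_fun h2 i

@[simp] theorem leftPart_single_inL (i : ι) (m : ℕ) :
    leftPart (Finsupp.single (inL i) m) = Finsupp.single i m :=
  Finsupp.comapDomain_single _ _ _ _

@[simp] theorem rightPart_single_inR (i : ι) (m : ℕ) :
    rightPart (Finsupp.single (inR i) m) = Finsupp.single i m :=
  Finsupp.comapDomain_single _ _ _ _

@[simp] theorem leftPart_single_inR (i : ι) (m : ℕ) :
    leftPart (Finsupp.single (inR i) m) = 0 := by
  ext j
  simp [inL_ne_inR]

@[simp] theorem rightPart_single_inL (i : ι) (m : ℕ) :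
    rightPart (Finsupp.single (inL i) m) = 0 := by
  ext j
  simp [(inL_ne_inR _ _).symm]

/-- The exponent vector with given left and right parts. -/
def joinParts (a b : ι →₀ ℕ) : ι ⊕ₗ ι →₀ ℕ := a.mapDomain inL + b.mapDomain inR

@[simp] theorem leftPart_joinParts (a b : ι →₀ ℕ) : leftPart (joinParts a b) = a := by
  ext i
  rw [leftPart_apply, joinParts, Finsupp.add_apply, Finsupp.mapDomain_apply inL_injective,
    Finsupp.mapDomain_of_notMem_range, add_zero]
  rintro ⟨j, hj⟩
  exact inL_ne_inR _ _ hj.symm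

@[simp] theorem rightPart_joinParts (a b : ι →₀ ℕ) : rightPart (joinParts a b) = b := by
  ext i
  rw [rightPart_apply, joinParts, Finsupp.add_apply, Finsupp.mapDomain_apply inR_injective,
    Finsupp.mapDomain_of_notMem_range, zero_add]
  rintro ⟨j, hj⟩
  exact inL_ne_inR _ _ hj

theorem joinParts_parts (v : ι ⊕ₗ ι →₀ ℕ) : joinParts (leftPart v) (rightPart v) = v :=
  ext_parts (by simp) (by simp)

theorem leftPart_sub (v w : ι ⊕ₗ ι →₀ ℕ) : leftPart (v - w) = leftPart v - leftPart w := by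
  ext; simp

theorem rightPart_sub (v w : ι ⊕ₗ ι →₀ ℕ) : rightPart (v - w) = rightPart v - rightPart w := by
  ext; simp

theorem admissible_iff_parts {odd : Bool} {v : ι ⊕ₗ ι →₀ ℕ} :
    Admissible odd v ↔ Admissible odd (leftPart v) ∧ Admissible odd (rightPart v) := by
  refine ⟨fun h => ⟨fun ho i => h ho _, fun ho i => h ho _⟩, fun h ho x => ?_⟩
  rcases inL_or_inR x with ⟨i, rfl⟩ | ⟨i, rfl⟩
  · exact h.1 ho i
  · exact h.2 ho i

theorem degree_parts (v : ι ⊕ₗ ι →₀ ℕ) :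
    v.degree = (leftPart v).degree + (rightPart v).degree := by
  induction v using Finsupp.induction_linear with
  | zero => simp
  | add f g hf hg => simp only [map_add, hf, hg]; ring
  | single x m => rcases inL_or_inR x with ⟨i, rfl⟩ | ⟨i, rfl⟩ <;> simp

theorem dot_parts (v w : ι ⊕ₗ ι →₀ ℕ) :
    dot v w = dot (leftPart v) (leftPart w) + dot (rightPart v) (rightPart w) := by
  induction v using Finsupp.induction_linear with
  | zero => simp
  | add f g hf hg => simp only [map_add, dot_add_left, hf, hg]; ring
  | single x m => rcases inL_or_inR x with ⟨i, rfl⟩ | ⟨i, rfl⟩ <;> simp [dot]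

theorem dotSign_parts {k : Type*} [Field k] (odd : Bool) (v w : ι ⊕ₗ ι →₀ ℕ) :
    dotSign k odd v w = dotSign k odd (leftPart v) (leftPart w) *
      dotSign k odd (rightPart v) (rightPart w) := by
  rw [dotSign, dot_parts, pow_add]
  rfl

theorem sum_support_parts {k : Type*} [AddCommMonoid k] (v : ι ⊕ₗ ι →₀ ℕ) (F : ι ⊕ₗ ι → k) :
    ∑ x ∈ v.support, F x =
      ∑ i ∈ (leftPart v).support, F (inL i) + ∑ i ∈ (rightPart v).support, F (inR i) := by
  classical
  have e : v.support = (leftPart v).support.map ⟨inL, inL_injective⟩ ∪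
      (rightPart v).support.map ⟨inR, inR_injective⟩ := by
    ext x
    simp only [Finset.mem_union, Finset.mem_map, Function.Embedding.coeFn_mk,
      Finsupp.mem_support_iff, leftPart_apply, rightPart_apply]
    constructor
    · intro h
      rcases inL_or_inR x with ⟨i, rfl⟩ | ⟨i, rfl⟩
      · exact Or.inl ⟨i, h, rfl⟩
      · exact Or.inr ⟨i, h, rfl⟩
    · rintro (⟨i, h, rfl⟩ | ⟨i, h, rfl⟩) <;> exact h
  rw [e, Finset.sum_union, Finset.sum_map, Finset.sum_map]
  · rfl
  · rw [Finset.disjoint_left]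
    rintro x h1 h2
    obtain ⟨i, -, rfl⟩ := Finset.mem_map.mp h1
    obtain ⟨j, -, h⟩ := Finset.mem_map.mp h2
    exact inL_ne_inR _ _ h.symm

theorem mem_support_inL {v : ι ⊕ₗ ι →₀ ℕ} {i : ι} (h : i ∈ (leftPart v).support) :
    inL i ∈ v.support := by simpa using h

theorem mem_support_inR {v : ι ⊕ₗ ι →₀ ℕ} {i : ι} (h : i ∈ (rightPart v).support) :
    inR i ∈ v.support := by simpa using h

variable [LinearOrder ι] {k : Type*} [Field k]

theorem inL_lt_inL {i j : ι} : inL i < inL j ↔ i < j := Sum.Lex.inl_lt_inl_iff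

theorem inR_lt_inR {i j : ι} : inR i < inR j ↔ i < j := Sum.Lex.inr_lt_inr_iff

theorem inL_lt_inR (i j : ι) : inL i < inR j := Sum.Lex.inl_lt_inr i j

/-- In the lexicographic order every left generator precedes every right one, so the right part
creates no inversion. -/
theorem chi_inL (i : ι) (w : ι ⊕ₗ ι →₀ ℕ) : chi k (gen (inL i)) w = chi k (gen i) (leftPart w) := by
  rw [chi, chi]
  congr 1
  induction w using Finsupp.induction_linear with
  | zero => simp
  | add f g hf hg => rw [inversions_add_right, hf, hg, map_add, inversions_add_right]
  | single x m =>
    rcases inL_or_inR x with ⟨j, rfl⟩ | ⟨j, rfl⟩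
    · simp [inversions_single, inL_lt_inL]
    · simp [inversions_single, (inL_lt_inR i j).not_gt]

/-- Every left factor precedes `inR i` and contributes one inversion. -/
theorem chi_inR (i : ι) (w : ι ⊕ₗ ι →₀ ℕ) : chi k (gen (inR i)) w =
    (-1) ^ (leftPart w).degree * chi k (gen i) (rightPart w) := by
  rw [chi, chi, ← pow_add]
  congr 1
  induction w using Finsupp.induction_linear with
  | zero => simp
  | add f g hf hg =>
    rw [inversions_add_right, hf, hg, map_add, map_add, map_add, inversions_add_right]
    ring
  | single x m =>
    rcases inL_or_inR x with ⟨j, rfl⟩ | ⟨j, rfl⟩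
    · simp [inversions_single, inL_lt_inR]
    · simp [inversions_single, inR_lt_inR]

theorem evalAlt_succ_parts (n : ℕ) (F : List (ι ⊕ₗ ι →₀ ℕ) → k) (v : ι ⊕ₗ ι →₀ ℕ) :
    evalAlt (n + 1) F v =
      ∑ i ∈ (leftPart v).support, chi k (gen i) (leftPart v - gen i) *
        evalAlt n (fun x => F (gen (inL i) :: x)) (v - gen (inL i)) +
      ∑ i ∈ (rightPart v).support, (-1) ^ (leftPart v).degree *
        (chi k (gen i) (rightPart v - gen i) *
          evalAlt n (fun x => F (gen (inR i) :: x)) (v - gen (inR i))) := by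
  rw [evalAlt_succ, sum_support_parts]
  congr 1
  · refine Finset.sum_congr rfl fun i _ => ?_
    rw [chi_inL, leftPart_sub, leftPart_single_inL]
  · refine Finset.sum_congr rfl fun i _ => ?_
    rw [chi_inR, leftPart_sub, rightPart_sub, leftPart_single_inR, rightPart_single_inR, tsub_zero,
      mul_assoc]

theorem evalAlt_prod_right (q : ℕ) {F : List (ι ⊕ₗ ι →₀ ℕ) → k} {c : k}
    {B : List (ι →₀ ℕ) → k}
    (h1 : ∀ Y : List (ι ⊕ₗ ι), Y.length = q → (∃ i, inL i ∈ Y) → F (Y.map gen) = 0)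
    (h2 : ∀ L : List ι, L.length = q → F (L.map fun i => gen (inR i)) = c * B (L.map gen))
    {v : ι ⊕ₗ ι →₀ ℕ} (hv : v.degree = q) :
    evalAlt q F v = if (leftPart v).degree = 0 then c * evalAlt q B (rightPart v) else 0 := by
  induction q generalizing F B v with
  | zero =>
    rw [(Finsupp.degree_eq_zero_iff v).mp hv]
    simpa [evalAlt] using h2 [] rfl
  | succ q ih =>
    have hR : ∀ i ∈ (rightPart v).support,
        evalAlt q (fun x => F (gen (inR i) :: x)) (v - gen (inR i)) =
        if (leftPart v).degree = 0 then
          c * evalAlt q (fun x => B (gen i :: x)) (rightPart v - gen i) else 0 := by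
      intro i hi
      have := degree_sub_gen (mem_support_inR hi)
      rw [ih (B := fun x => B (gen i :: x)) (fun Y hY hmem => ?_) (fun L hL => ?_) (by omega)]
      · simp [leftPart_sub, rightPart_sub]
      · exact h1 (inR i :: Y) (by simp [hY]) (by obtain ⟨j, hj⟩ := hmem; exact ⟨j, by simp [hj]⟩)
      · exact h2 (i :: L) (by simp [hL])
    rw [evalAlt_succ_parts, Finset.sum_eq_zero, zero_add, Finset.sum_congr rfl fun i hi => by
      rw [hR i hi]]
    · split_ifs with h
      · rw [evalAlt_succ, Finset.mul_sum, h]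
        exact Finset.sum_congr rfl fun i _ => by ring
      · simp
    · intro i hi
      have := degree_sub_gen (mem_support_inL hi)
      rw [evalAlt_eq_zero (by omega), mul_zero]
      exact fun L hL _ => h1 (inL i :: L) (by simp [hL]) ⟨i, by simp⟩

/-- Of all orderings of the generators of `v`, only those with the left ones in the first `p` places
contribute. They carry no mixed sign, because left generators are the smaller ones; so the sum
factors. -/
theorem evalAlt_prod (p q : ℕ) {F : List (ι ⊕ₗ ι →₀ ℕ) → k} {A B : List (ι →₀ ℕ) → k}
    (h1 : ∀ X Y : List (ι ⊕ₗ ι), X.length = p → Y.length = q →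
      ((∃ i, inR i ∈ X) ∨ ∃ i, inL i ∈ Y) → F (X.map gen ++ Y.map gen) = 0)
    (h2 : ∀ L L' : List ι, L.length = p → L'.length = q →
      F ((L.map fun i => gen (inL i)) ++ L'.map fun i => gen (inR i)) =
        A (L.map gen) * B (L'.map gen))
    {v : ι ⊕ₗ ι →₀ ℕ} (hv : v.degree = p + q) :
    evalAlt (p + q) F v = if (leftPart v).degree = p then
      evalAlt p A (leftPart v) * evalAlt q B (rightPart v) else 0 := by
  induction p generalizing F A v with
  | zero =>
    rw [Nat.zero_add] at hv ⊢
    exact evalAlt_prod_right q (fun Y hY h => h1 [] Y rfl hY (Or.inr h))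
      (fun L hL => h2 [] L rfl hL) hv
  | succ p ih =>
    have hL : ∀ i ∈ (leftPart v).support,
        evalAlt (p + q) (fun x => F (gen (inL i) :: x)) (v - gen (inL i)) =
        if (leftPart v).degree = p + 1 then
          evalAlt p (fun x => A (gen i :: x)) (leftPart v - gen i) *
            evalAlt q B (rightPart v) else 0 := by
      intro i hi
      have := degree_sub_gen (mem_support_inL hi)
      rw [ih (A := fun x => A (gen i :: x)) (fun X Y hX hY hmem => ?_) (fun L L' hL hL' => ?_)
        (by omega)]
      · simp only [leftPart_sub, rightPart_sub, leftPart_single_inL, rightPart_single_inL,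
          tsub_zero, degree_sub_gen hi, Nat.add_right_cancel_iff]
      · refine h1 (inL i :: X) Y (by simp [hX]) hY ?_
        exact hmem.imp (fun ⟨j, hj⟩ => ⟨j, by simp [hj]⟩) id
      · exact h2 (i :: L) L' (by simp [hL]) hL'
    rw [Nat.add_right_comm, evalAlt_succ_parts, add_comm, Finset.sum_eq_zero, zero_add,
      Finset.sum_congr rfl fun i hi => by rw [hL i hi]]
    · split_ifs with h
      · rw [evalAlt_succ, Finset.sum_mul]
        exact Finset.sum_congr rfl fun i _ => by ring
      · simp
    · intro i hi
      have := degree_sub_gen (mem_support_inR hi)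
      rw [evalAlt_eq_zero (by omega), mul_zero, mul_zero]
      intro L hL _
      have := h1 (inR i :: L.take p) (L.drop p) (by simp; omega) (by simp; omega)
        (Or.inl ⟨i, by simp⟩)
      simpa [← List.map_take, ← List.map_drop, ← List.map_append] using this

end Doubling

/-! ### Alexander-Whitney products in coordinates -/

section AlexanderWhitney

variable {k ι : Type*} [Field k]

/-- `(a :: b :: x) ↦ Z ((a + b) :: x)` -/
def zeroFace (Z : List (ι →₀ ℕ) → k) : List (ι →₀ ℕ) → k
  | [] => 0
  | a :: x => addHead a Z x

@[simp] theorem zeroFace_cons_cons (Z : List (ι →₀ ℕ) → k) (a b : ι →₀ ℕ) (x : List (ι →₀ ℕ)) :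
    zeroFace Z (a :: b :: x) = Z ((a + b) :: x) := rfl

theorem zeroFace_iterate_append (Z : List (ι →₀ ℕ) → k) (a : ι →₀ ℕ) (x y : List (ι →₀ ℕ)) :
    zeroFace^[x.length] Z (a :: (x ++ y)) = Z ((a + x.sum) :: y) := by
  induction x generalizing a with
  | nil => simp
  | cons b x ih =>
    rw [List.length_cons, Function.iterate_succ', Function.comp_apply, List.cons_append,
      zeroFace_cons_cons, ih, List.sum_cons, add_assoc]

/-- The factor `c` is left unspecified: the lemma serves to show that the value vanishes when `x`
contains a zero. -/
theorem lastFace_iterate_append (odd : Bool) (Z : List (ι →₀ ℕ) → k) (a : ι →₀ ℕ)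
    (x y : List (ι →₀ ℕ)) :
    ∃ c : k, (lastFace odd)^[y.length] Z (a :: (x ++ y)) = c * Z ((y.sum + a) :: x) := by
  induction y using List.reverseRecOn generalizing a with
  | nil => exact ⟨1, by simp⟩
  | append_singleton y l ih =>
    obtain ⟨c, hc⟩ := ih (l + a)
    refine ⟨dotSign k odd l (x ++ y).sum * c, ?_⟩
    rw [List.length_append, List.length_singleton, Function.iterate_succ', Function.comp_apply,
      ← List.append_assoc, lastFace_append, hc, mul_assoc, List.sum_append (l₁ := y), List.sum_cons,
      List.sum_nil, add_zero, add_assoc]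

theorem lastFace_iterate_append_zero (odd : Bool) (Z : List (ι →₀ ℕ) → k) (a : ι →₀ ℕ)
    (x : List (ι →₀ ℕ)) (q : ℕ) :
    (lastFace odd)^[q] Z (a :: (x ++ List.replicate q 0)) = Z (a :: x) := by
  induction q generalizing a with
  | zero => simp
  | succ q ih =>
    rw [Function.iterate_succ', Function.comp_apply, List.replicate_succ', ← List.append_assoc,
      lastFace_append, zero_add, ih]
    simp

theorem lastFace_insertGens {odd : Bool} {Z : List (ι →₀ ℕ) → k} (hZ : AdmissibleFun odd Z)
    (L : List ι) : lastFace odd (insertGens odd Z L) = insertGens odd (lastFace odd Z) L := by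
  induction L with
  | nil => rfl
  | cons i L ih =>
    rw [insertGens, insertGens, ← ih]
    exact funext fun w => lastFace_insertGen (hZ.insertGens L) i w

theorem lastFace_iterate_insertGens {odd : Bool} {Z : List (ι →₀ ℕ) → k}
    (hZ : AdmissibleFun odd Z) (L : List ι) (q : ℕ) :
    (lastFace odd)^[q] (insertGens odd Z L) = insertGens odd ((lastFace odd)^[q] Z) L := by
  induction q generalizing Z with
  | zero => rfl
  | succ q ih =>
    rw [Function.iterate_succ_apply, Function.iterate_succ_apply, ← ih hZ.lastFace,
      lastFace_insertGens hZ]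

theorem zeroFace_iterate_single₁ (c : (ι →₀ ℕ) → k) (q : ℕ) (w : List (ι →₀ ℕ)) :
    zeroFace^[q] (single₁ c) w = if w.length = q + 1 then c w.sum else 0 := by
  induction q generalizing w with
  | zero => rcases w with _ | ⟨a, _ | ⟨b, x⟩⟩ <;> simp [single₁]
  | succ q ih =>
    rw [Function.iterate_succ', Function.comp_apply]
    rcases w with _ | ⟨a, _ | ⟨b, x⟩⟩
    · simp [zeroFace]
    · simp [zeroFace, addHead]
    · rw [zeroFace_cons_cons, ih]
      simp [add_assoc]

/-- On elements of `C` all iterated cofaces are the iterated comultiplication, by cocommutativity;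
the sign of the last face is trivial because the total sum is admissible. -/
theorem lastFace_iterate_single₁ {odd : Bool} {c : (ι →₀ ℕ) → k}
    (hc : ∀ b, c b ≠ 0 → Admissible odd b) (q : ℕ) :
    (lastFace odd)^[q] (single₁ c) = zeroFace^[q] (single₁ c) := by
  induction q with
  | zero => rfl
  | succ q ih =>
    rw [Function.iterate_succ', Function.comp_apply, ih]
    funext w
    rw [zeroFace_iterate_single₁]
    rcases w with _ | ⟨a, x⟩
    · simp
    rcases List.eq_nil_or_concat' x with rfl | ⟨x, l, rfl⟩
    · simp
    rw [lastFace_append, zeroFace_iterate_single₁]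
    have e : (a :: (x ++ [l])).sum = ((l + a) :: x).sum := by
      simp only [List.sum_cons, List.sum_append, List.sum_nil]
      abel
    simp only [e, List.length_cons, List.length_append, List.length_nil, zero_add,
      Nat.add_right_cancel_iff]
    by_cases h : c ((l + a) :: x).sum = 0
    · simp only [h, mul_zero, ite_self]
    · have h1 : Admissible odd (l + x.sum) := (hc _ h).of_le (by
        rw [List.sum_cons, add_right_comm]
        exact le_self_add)
      rw [dotSign_of_admissible h1, one_mul]

/-- The external product of coordinate functions. -/
def outer (x y : List (ι →₀ ℕ) → k) (W : List (ι ⊕ₗ ι →₀ ℕ)) : k :=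
  x (W.map leftPart) * y (W.map rightPart)

/-- A left generator is invisible to the right factor, which only sees its first two entries added.
-/
theorem insertGen_inL_outer (odd : Bool) (i : ι) (x y : List (ι →₀ ℕ) → k) :
    insertGen odd (inL i) (outer x y) = outer (insertGen odd i x) (zeroFace y) := by
  funext W
  rcases W with _ | ⟨v, _ | ⟨w, X⟩⟩
  · simp [outer, insertGen]
  · simp [outer, insertGen]
  · simp only [outer, insertGen_cons_cons, List.map_cons, zeroFace_cons_cons, leftPart_sub,
      rightPart_sub, map_add, leftPart_single_inL, rightPart_single_inL, tsub_zero,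
      leftPart_apply]
    ring

theorem insertGen_inR_outer (odd : Bool) (i : ι) (x y : List (ι →₀ ℕ) → k) :
    insertGen odd (inR i) (outer x y) = outer (zeroFace x) (insertGen odd i y) := by
  funext W
  rcases W with _ | ⟨v, _ | ⟨w, X⟩⟩
  · simp [outer, insertGen]
  · simp [outer, insertGen]
  · simp only [outer, insertGen_cons_cons, List.map_cons, zeroFace_cons_cons, leftPart_sub,
      rightPart_sub, map_add, leftPart_single_inR, rightPart_single_inR, tsub_zero,
      rightPart_apply]
    ring

theorem insertGens_inR_outer (odd : Bool) (L : List ι) (x y : List (ι →₀ ℕ) → k) :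
    insertGens odd (outer x y) (L.map inR) =
      outer (zeroFace^[L.length] x) (insertGens odd y L) := by
  induction L with
  | nil => rfl
  | cons i L ih =>
    rw [List.map_cons, insertGens, ih, insertGen_inR_outer, List.length_cons,
      Function.iterate_succ', Function.comp_apply, insertGens]

theorem insertGens_inL_outer (odd : Bool) (L : List ι) (x y : List (ι →₀ ℕ) → k) :
    insertGens odd (outer x y) (L.map inL) =
      outer (insertGens odd x L) (zeroFace^[L.length] y) := by
  induction L with
  | nil => rfl
  | cons i L ih =>
    rw [List.map_cons, insertGens, ih, insertGen_inL_outer, List.length_cons,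
      Function.iterate_succ', Function.comp_apply, insertGens]

theorem insertGens_append (odd : Bool) (Z : List (ι →₀ ℕ) → k) (L L' : List ι) :
    insertGens odd Z (L ++ L') = insertGens odd (insertGens odd Z L') L := by
  induction L with
  | nil => rfl
  | cons i L ih => rw [List.cons_append, insertGens, insertGens, ih]

/-- The Alexander-Whitney product of coordinate functions. -/
def awFun (odd : Bool) (p q : ℕ) (x y : List (ι →₀ ℕ) → k) : List (ι ⊕ₗ ι →₀ ℕ) → k :=
  outer ((lastFace odd)^[q] x) (zeroFace^[p] y)

theorem outer_single₁ (c c' : (ι →₀ ℕ) → k) : outer (single₁ c) (single₁ c') =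
    single₁ fun v : ι ⊕ₗ ι →₀ ℕ => c (leftPart v) * c' (rightPart v) := by
  funext W
  rcases W with _ | ⟨v, _ | ⟨w, X⟩⟩ <;> simp [outer, single₁]

/-- The Alexander-Whitney product of two inserted cocycles is an inserted cocycle for the doubled
generators. In particular it is a cocycle on the diagonal, which is all that is needed of the
Alexander-Whitney map in this respect. -/
theorem awFun_insertGens {odd : Bool} {c : (ι →₀ ℕ) → k}
    (hc : ∀ b, c b ≠ 0 → Admissible odd b) (c' : (ι →₀ ℕ) → k) (L L' : List ι) :
    awFun odd L.length L'.length (insertGens odd (single₁ c) L)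
        (insertGens odd (single₁ c') L') =
      insertGens odd (single₁ fun v : ι ⊕ₗ ι →₀ ℕ => c (leftPart v) * c' (rightPart v))
        (L.map inL ++ L'.map inR) := by
  rw [insertGens_append, ← outer_single₁, insertGens_inR_outer, insertGens_inL_outer,
    ← lastFace_iterate_single₁ hc, ← lastFace_iterate_insertGens (admissibleFun_single₁ hc)]
  rfl

variable [LinearOrder ι]

/-- By normalization the product vanishes unless the first `p` generators are left and the last `q`
are right: a generator on the wrong side becomes a zero entry of the factor that does not absorb it.
Then `evalAlt_prod` applies. -/
theorem evalAlt_awFun (odd : Bool) {p q : ℕ} {x y : List (ι →₀ ℕ) → k} (hx : NormalizedTail x)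
    (hy : NormalizedTail y) (v₀ : ι ⊕ₗ ι →₀ ℕ) {v : ι ⊕ₗ ι →₀ ℕ} (hv : v.degree = p + q) :
    evalAlt (p + q) (fun X => awFun odd p q x y (v₀ :: X)) v = if (leftPart v).degree = p then
      evalAlt p (fun X => x (leftPart v₀ :: X)) (leftPart v) *
        evalAlt q (fun X => y (rightPart v₀ :: X)) (rightPart v) else 0 := by
  refine evalAlt_prod p q (fun X Y hX hY h => ?_) (fun L L' hL hL' => ?_) hv
  · simp only [awFun, outer, List.map_cons, List.map_append, List.map_map]
    rcases h with ⟨i, hi⟩ | ⟨i, hi⟩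
    · have hlen : q = (Y.map (leftPart ∘ gen)).length := by simp [hY]
      rw [hlen]
      obtain ⟨c, hc⟩ := lastFace_iterate_append odd x (leftPart v₀) (X.map (leftPart ∘ gen))
        (Y.map (leftPart ∘ gen))
      rw [hc, hx, mul_zero, zero_mul]
      exact List.mem_map.mpr ⟨inR i, hi, by simp⟩
    · have hlen : p = (X.map (rightPart ∘ gen)).length := by simp [hX]
      rw [hlen, zeroFace_iterate_append, hy, mul_zero]
      exact List.mem_map.mpr ⟨inL i, hi, by simp⟩
  · have e1 : (L'.map fun i => gen (inR i)).map leftPart = List.replicate q (0 : ι →₀ ℕ) := by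
      rw [List.map_map, ← hL', ← List.map_const']
      exact List.map_congr_left fun i _ => by simp
    have e2 : (L.map fun i => gen (inL i)).map rightPart = List.replicate p (0 : ι →₀ ℕ) := by
      rw [List.map_map, ← hL, ← List.map_const']
      exact List.map_congr_left fun i _ => by simp
    have e3 : (L.map fun i => gen (inL i)).map leftPart = L.map gen := by
      rw [List.map_map]
      exact List.map_congr_left fun i _ => by simp
    have e4 : (L'.map fun i => gen (inR i)).map rightPart = L'.map gen := by
      rw [List.map_map]
      exact List.map_congr_left fun i _ => by simp
    simp only [awFun, outer, List.map_cons, List.map_append, e1, e2, e3, e4,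
      lastFace_iterate_append_zero]
    have hlen : p = (List.replicate p (0 : ι →₀ ℕ)).length := by simp
    congr 1
    conv_lhs => enter [2]; rw [hlen]
    rw [zeroFace_iterate_append]
    simp

end AlexanderWhitney

/-! ### The coproduct of the tensor powers and its evaluation -/

section Comultiplication

variable {k ι : Type*} [Field k]

/-- The pairs of positions in which the right part of the first meets the left part of the
second. -/
def crossings : List (ι ⊕ₗ ι →₀ ℕ) → ℕ
  | [] => 0
  | v :: X => dot (rightPart v) (leftPart X.sum) + crossings X

theorem crossings_append (X : List (ι ⊕ₗ ι →₀ ℕ)) (l : ι ⊕ₗ ι →₀ ℕ) :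
    crossings (X ++ [l]) = crossings X + dot (rightPart X.sum) (leftPart l) := by
  induction X with
  | nil => simp [crossings]
  | cons v X ih =>
    rw [List.cons_append, crossings, crossings, ih]
    simp only [List.sum_append, List.sum_cons, List.sum_nil, map_add, add_zero,
      dot_add_right, dot_add_left]
    ring

/-- The sum of the two parts. -/
def mergeParts : (ι ⊕ₗ ι →₀ ℕ) →+ (ι →₀ ℕ) := leftPart + rightPart

theorem mergeParts_apply (v : ι ⊕ₗ ι →₀ ℕ) : mergeParts v = leftPart v + rightPart v := rfl

theorem mid_comp_map {ι' : Type*} (f : (ι' →₀ ℕ) →+ (ι →₀ ℕ)) (φ : List (ι →₀ ℕ) → k)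
    (X : List (ι' →₀ ℕ)) : mid (fun Y => φ (Y.map f)) X = mid φ (X.map f) := by
  induction X generalizing φ with
  | nil => rfl
  | cons v X ih =>
    rw [List.map_cons, mid_cons, mid_cons]
    congr 1
    · cases X <;> simp [addHead]
    · exact ih fun y => φ (f v :: y)

/-- Merging `v` and `w` removes the crossing of the right part of `v` with the left part of `w`; its
sign is trivial, since all parts of `v + w` together are admissible. -/
theorem Merge.sigma_crossings {odd : Bool} {X Y : List (ι ⊕ₗ ι →₀ ℕ)} (h : Merge X Y)
    (hY : ∀ a ∈ Y.map mergeParts, Admissible odd a) :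
    sigma k odd ^ crossings Y = sigma k odd ^ crossings X := by
  induction h with
  | head v w X =>
    simp only [List.map_cons, List.mem_cons, forall_eq_or_imp] at hY
    have h1 : dotSign k odd (rightPart v) (leftPart w) = 1 := by
      refine dotSign_of_admissible (hY.1.of_le ?_)
      intro i
      simp only [mergeParts_apply, map_add, Finsupp.add_apply]
      omega
    rw [dotSign] at h1
    simp only [crossings, List.sum_cons, map_add, dot_add_left, dot_add_right, pow_add, h1]
    ring
  | cons v h ih =>
    simp only [List.map_cons, List.mem_cons, forall_eq_or_imp] at hY
    rw [crossings, crossings, pow_add, pow_add, ih hY.2, h.sum_eq]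

variable [LinearOrder ι]

/-- `chi` in the odd case, `1` in the even case. -/
def chiOdd (k : Type*) [Field k] (odd : Bool) (a b : ι →₀ ℕ) : k := if odd then chi k a b else 1

theorem chiOdd_add_left (odd : Bool) (a a' b : ι →₀ ℕ) :
    chiOdd k odd (a + a') b = chiOdd k odd a b * chiOdd k odd a' b := by
  cases odd <;> simp [chiOdd, chi_add_left]

theorem chiOdd_add_right (odd : Bool) (a b b' : ι →₀ ℕ) :
    chiOdd k odd a (b + b') = chiOdd k odd a b * chiOdd k odd a b' := by
  cases odd <;> simp [chiOdd, chi_add_right]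

@[simp] theorem chiOdd_zero_left (odd : Bool) (b : ι →₀ ℕ) : chiOdd k odd 0 b = 1 := by
  cases odd <;> simp [chiOdd]

@[simp] theorem chiOdd_zero_right (odd : Bool) (b : ι →₀ ℕ) : chiOdd k odd b 0 = 1 := by
  cases odd <;> simp [chiOdd]

theorem chiOdd_mul_self (odd : Bool) (a b : ι →₀ ℕ) :
    chiOdd k odd a b * chiOdd k odd a b = 1 := by
  cases odd <;> simp [chiOdd, chi_mul_self]

/-- The comultiplication on coordinate functions. -/
def comulFun (odd : Bool) (Z : List (ι →₀ ℕ) → k) (X : List (ι ⊕ₗ ι →₀ ℕ)) : k :=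
  chiOdd k odd (leftPart X.sum) (rightPart X.sum) * sigma k odd ^ crossings X *
    Z (X.map mergeParts)

theorem comulFun_cons (odd : Bool) (Z : List (ι →₀ ℕ) → k) (v : ι ⊕ₗ ι →₀ ℕ)
    (X : List (ι ⊕ₗ ι →₀ ℕ)) : comulFun odd Z (v :: X) =
      chiOdd k odd (leftPart v) (rightPart v) * chiOdd k odd (leftPart v) (rightPart X.sum) *
        chiOdd k odd (leftPart X.sum) (rightPart v) *
        dotSign k odd (rightPart v) (leftPart X.sum) *
        comulFun odd (fun x => Z (mergeParts v :: x)) X := by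
  simp only [comulFun, crossings, List.sum_cons, map_add, chiOdd_add_left, chiOdd_add_right,
    pow_add, List.map_cons, dotSign]
  ring

theorem NormalizedTail.comulFun {odd : Bool} {Z : List (ι →₀ ℕ) → k} (hZ : NormalizedTail Z) :
    NormalizedTail (comulFun odd Z) := by
  intro v X hX
  rw [CoHochschild.comulFun, List.map_cons, hZ, mul_zero]
  exact List.mem_map.mpr ⟨0, hX, map_zero _⟩

theorem mid_comulFun {odd : Bool} {Z : List (ι →₀ ℕ) → k} (hZ : AdmissibleFun odd Z)
    (X : List (ι ⊕ₗ ι →₀ ℕ)) : mid (comulFun odd Z) X = comulFun odd (mid Z) X := by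
  rw [comulFun, ← mid_comp_map, ← mid_const_mul]
  refine mid_congr fun Y hY => ?_
  rw [comulFun, hY.sum_eq]
  by_cases h : Z (Y.map mergeParts) = 0
  · simp [h]
  · rw [hY.sigma_crossings (hZ _ h)]

/-- Moving `l` to the front replaces its crossings with the intermediate entries by those on the
other side. The change equals the mixed part of the sign of the last face for the merged list, whose
pure parts give the sign for the doubled one. -/
theorem lastFace_comulFun {odd : Bool} {Z : List (ι →₀ ℕ) → k} (hZ : AdmissibleFun odd Z)
    (X : List (ι ⊕ₗ ι →₀ ℕ)) : lastFace odd (comulFun odd Z) X = comulFun odd (lastFace odd Z) X := by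
  rcases X with _ | ⟨v, X⟩
  · simp [comulFun]
  rcases List.eq_nil_or_concat' X with rfl | ⟨X, l, rfl⟩
  · simp [comulFun]
  rw [lastFace_append, comulFun, comulFun]
  simp only [List.map_cons, List.map_append, List.map_nil]
  rw [lastFace_append]
  have e : (v :: (X ++ [l])).sum = ((l + v) :: X).sum := by
    simp only [List.sum_cons, List.sum_append, List.sum_nil]
    abel
  rw [e, ← map_add]
  by_cases h : Z (mergeParts (l + v) :: X.map mergeParts) = 0
  · simp only [h, mul_zero]
  -- The crossing between `v` and `l` is trivial because the merged list has the admissible entry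
  -- `mergeParts (l + v)` wherever `Z` does not vanish.
  have h1 : dotSign k odd (rightPart v) (leftPart l) = 1 := by
    refine dotSign_of_admissible ((hZ _ h _ List.mem_cons_self).of_le ?_)
    rw [mergeParts_apply, map_add, map_add, add_comm (rightPart v)]
    exact add_le_add le_self_add le_add_self
  have e2 : (X.map mergeParts).sum = leftPart X.sum + rightPart X.sum := by
    rw [← map_list_sum, mergeParts_apply]
  have h2 := dotSign_mul_self (k := k) odd (rightPart X.sum) (leftPart l)
  rw [e2, ← List.cons_append, crossings_append, dotSign_parts, mergeParts_apply l]
  simp only [crossings, List.sum_cons, map_add, dot_add_left, pow_add]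
  have e3 : ∀ a b : ι →₀ ℕ, sigma k odd ^ dot a b = dotSign k odd a b := fun _ _ => rfl
  simp only [e3, h1, dotSign_add_left, dotSign_add_right]
  rw [dotSign_comm odd (leftPart l) (rightPart X.sum)]
  generalize dotSign k odd (rightPart X.sum) (leftPart l) = u at *
  generalize chiOdd (ι := ι) k odd _ _ = u1
  generalize Z _ = u2
  linear_combination (-u1 * u2 * dotSign k odd (leftPart l) (leftPart X.sum) *
    dotSign k odd (rightPart l) (rightPart X.sum) * dotSign k odd (rightPart v) (leftPart X.sum) *
    dotSign k odd (rightPart l) (leftPart X.sum) * sigma k odd ^ crossings X) * h2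

theorem hochD_comulFun {odd : Bool} {Z : List (ι →₀ ℕ) → k} (hZ : AdmissibleFun odd Z)
    (X : List (ι ⊕ₗ ι →₀ ℕ)) : hochD odd (comulFun odd Z) X = comulFun odd (hochD odd Z) X := by
  rw [hochD, mid_comulFun hZ, lastFace_comulFun hZ, comulFun, comulFun, comulFun, hochD,
    List.length_map]
  ring

theorem prod_choose_split (s t : ι →₀ ℕ) (i : ι) :
    (s.prod fun j m => ((m + t j).choose m : k)) =
      ((s i + t i).choose (s i) : k) * (s.erase i).prod fun j m => ((m + t j).choose m : k) :=
  (Finsupp.mul_prod_erase' s i (fun j m => ((m + t j).choose m : k)) (by simp)).symm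

open Classical in
/-- The coefficients of the comultiplication of the exterior (`odd = false`) or polynomial
(`odd = true`) Hopf algebra. -/
def dualCoeff (k : Type*) [Field k] (odd : Bool) (s t : ι →₀ ℕ) : k :=
  if odd then s.prod fun i m => ((m + t i).choose m : k)
  else if Admissible true (s + t) then chi k s t else 0

theorem erase_sub_gen (s : ι →₀ ℕ) (i : ι) : (s - gen i).erase i = s.erase i := by
  ext j
  by_cases h : j = i
  · simp [h]
  · simp [h]

theorem prod_erase_sub_gen (s t : ι →₀ ℕ) (i : ι) :
    ((s.erase i).prod fun j m => ((m + (t - gen i) j).choose m : k)) =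
      (s.erase i).prod fun j m => ((m + t j).choose m : k) := by
  refine Finsupp.prod_congr fun j hj => ?_
  have h : j ≠ i := fun h => by simp [h] at hj
  simp [Ne.symm h]

/-- Pascal's rule in the variable `i`; the binomials of the other variables are unchanged. -/
theorem dualCoeff_true_add {s t : ι →₀ ℕ} {i : ι} (hi : i ∈ (s + t).support) :
    (if i ∈ s.support then dualCoeff k true (s - gen i) t else 0) +
      (if i ∈ t.support then dualCoeff k true s (t - gen i) else 0) = dualCoeff k true s t := by
  simp only [dualCoeff, if_true]
  rw [prod_choose_split s t i, prod_choose_split (s - gen i) t i,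
    prod_choose_split s (t - gen i) i, erase_sub_gen, prod_erase_sub_gen]
  generalize (s.erase i).prod (fun j m => ((m + t j).choose m : k)) = P
  simp only [Finsupp.mem_support_iff, Finsupp.coe_tsub, Pi.sub_apply, Finsupp.single_eq_same,
    Finsupp.add_apply] at hi ⊢
  rcases hs : s i with _ | m <;> rcases ht : t i with _ | n
  · simp [hs, ht] at hi
  · simp
  · simp
  · have := Nat.choose_succ_succ (m + n + 1) m
    rw [show m + 1 + (n + 1) = m + n + 1 + 1 by ring, this]
    simp only [Nat.add_sub_cancel, ne_eq, Nat.add_eq_zero_iff, one_ne_zero, and_false,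
      not_false_eq_true, if_true, Nat.cast_add, Nat.succ_eq_add_one]
    rw [show m + (n + 1) = m + n + 1 by ring, show m + 1 + n = m + n + 1 by ring]
    ring

theorem chi_gen_comm (s : ι →₀ ℕ) (i : ι) :
    chi k s (gen i) = (-1) ^ s.degree * (-1) ^ s i * chi k (gen i) s := by
  have h1 := chi_mul_chi (k := k) s (gen i)
  have h2 := chi_mul_self (k := k) (gen i) s
  rw [dot_gen_right, Finsupp.degree_single, mul_one] at h1
  linear_combination chi k (gen i) s * h1 - chi k s (gen i) * h2

/-- The recursion obtained when a generator `i` is removed from the left or from the right part. In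
the polynomial case the signs cancel and Pascal's rule remains. In the exterior case the two terms
cannot both contribute without cancelling. -/
theorem dualCoeff_step {odd : Bool} {s t : ι →₀ ℕ} (hs : Admissible (!odd) s)
    (ht : Admissible (!odd) t) {i : ι} (hi : i ∈ (s + t).support) :
    (if i ∈ s.support then chi k (gen i) (s - gen i) * (chiOdd k odd (gen i) t *
        dualCoeff k odd (s - gen i) t) else 0) +
      (if i ∈ t.support then (-1) ^ s.degree * (chi k (gen i) (t - gen i) *
        (chiOdd k odd s (gen i) * sigma k odd ^ s i * dualCoeff k odd s (t - gen i))) else 0) =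
      chi k (gen i) (s + t - gen i) * dualCoeff k odd s t := by
  have q1 : ((-1 : k) ^ s.degree) * (-1) ^ s.degree = 1 := by rw [← mul_pow]; simp
  have q2 : ((-1 : k) ^ s i) * (-1) ^ s i = 1 := by rw [← mul_pow]; simp
  have r1 : i ∈ s.support → chi k (gen i) (s + t - gen i) =
      chi k (gen i) (s - gen i) * chi k (gen i) t := fun h => by
    rw [← chi_add_right, ← tsub_add_eq_add_tsub]
    rw [Finsupp.single_le_iff]
    exact Nat.one_le_iff_ne_zero.mpr (Finsupp.mem_support_iff.mp h)
  have r2 : i ∈ t.support → chi k (gen i) (s + t - gen i) =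
      chi k (gen i) s * chi k (gen i) (t - gen i) := fun h => by
    rw [← chi_add_right, add_tsub_assoc_of_le]
    rw [Finsupp.single_le_iff]
    exact Nat.one_le_iff_ne_zero.mpr (Finsupp.mem_support_iff.mp h)
  cases odd
  · simp only [chiOdd, sigma, Bool.false_eq_true, if_false, one_mul, one_pow, dualCoeff]
    simp only [Bool.not_false] at hs ht
    by_cases hsi : i ∈ s.support <;> by_cases hti : i ∈ t.support
    -- The generator occurs on both sides, so the exterior structure constant is zero and the two
    -- terms have to cancel.
    · have e1 := eq_add_gen hsi
      have e2 := eq_add_gen hti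
      generalize s - gen i = s₁ at *
      generalize t - gen i = t₁ at *
      subst e1 e2
      have hn : ¬ Admissible true (s₁ + gen i + (t₁ + gen i)) := fun h => by
        have := h rfl i
        simp at this
        omega
      rw [if_pos hsi, if_pos hti, if_neg hn, add_right_comm s₁, add_assoc s₁]
      split_ifs with h
      · have h0 : s₁ i = 0 := by
          have := hs rfl i
          simpa using this
        have c1 := chi_gen_comm (k := k) s₁ i
        have q3 := chi_mul_self (k := k) (gen i) s₁
        have q4 := chi_mul_self (k := k) (gen i) t₁
        simp only [chi_add_left, chi_add_right, map_add, Finsupp.degree_single, pow_add, pow_one,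
          c1, h0, pow_zero, mul_one]
        linear_combination ((-1) ^ s₁.degree * chi k s₁ t₁) * (q3 - q4)
      · simp
    · rw [if_pos hsi, if_neg hti, add_zero, r1 hsi]
      have e1 := eq_add_gen hsi
      have h0 : t i = 0 := Finsupp.notMem_support_iff.mp hti
      have hiff : Admissible true (s - gen i + t) ↔ Admissible true (s + t) := by
        refine ⟨fun h _ j => ?_, fun h => h.of_le (add_le_add_left tsub_le_self _)⟩
        have := h rfl j
        have h2 := hs rfl j
        by_cases hj : j = i
        · subst hj; simp [h0, h2]
        · simpa [Finsupp.single_apply, Ne.symm hj] using this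
      by_cases hst : Admissible true (s + t)
      · rw [if_pos hst, if_pos (hiff.mpr hst)]
        have q4 := chi_mul_self (k := k) (gen i) t
        have : chi k s t = chi k (s - gen i) t * chi k (gen i) t := by
          rw [← chi_add_left, ← e1]
        rw [this]
        linear_combination (-chi k (gen i) (s - gen i) * chi k (s - gen i) t) * q4
      · rw [if_neg hst, if_neg (mt hiff.mp hst)]; simp
    · rw [if_neg hsi, if_pos hti, zero_add, r2 hti]
      have e1 := eq_add_gen hti
      have h0 : s i = 0 := Finsupp.notMem_support_iff.mp hsi
      have hiff : Admissible true (s + (t - gen i)) ↔ Admissible true (s + t) := by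
        refine ⟨fun h _ j => ?_, fun h => h.of_le (add_le_add_right tsub_le_self _)⟩
        have := h rfl j
        have h2 := ht rfl j
        by_cases hj : j = i
        · subst hj; simp [h0, h2]
        · simpa [Finsupp.single_apply, Ne.symm hj] using this
      by_cases hst : Admissible true (s + t)
      · rw [if_pos hst, if_pos (hiff.mpr hst)]
        have c1 := chi_gen_comm (k := k) s i
        have q4 := chi_mul_self (k := k) (gen i) s
        have : chi k s t = chi k s (t - gen i) * chi k s (gen i) := by
          rw [← chi_add_right, ← e1]
        rw [this, c1, h0, pow_zero]
        linear_combination (-(-1) ^ s.degree * chi k (gen i) (t - gen i) * chi k s (t - gen i)) * q4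
      · rw [if_neg hst, if_neg (mt hiff.mp hst)]; simp
    · simp only [Finsupp.mem_support_iff, not_not, Finsupp.add_apply] at hsi hti hi
      omega
  · simp only [chiOdd, sigma, if_true]
    rw [← dualCoeff_true_add hi, chi_gen_comm, mul_add]
    congr 1
    · split_ifs with h
      · rw [r1 h]; ring
      · simp
    · split_ifs with h
      · rw [r2 h]
        linear_combination (chi k (gen i) (t - gen i) * chi k (gen i) s *
          dualCoeff k true s (t - gen i)) * ((-1) ^ s i * (-1) ^ s i * q1 + q2)
      · simp

theorem comulFun_eq_of_sum {odd : Bool} (n : ℕ) {v v₁ : ι ⊕ₗ ι →₀ ℕ} (h : v.degree = n)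
    (φ : List (ι →₀ ℕ) → k) : evalAlt n (fun X => comulFun odd φ (v₁ :: X)) v =
      chiOdd k odd (leftPart v₁) (rightPart v₁) * chiOdd k odd (leftPart v₁) (rightPart v) *
        chiOdd k odd (leftPart v) (rightPart v₁) * dotSign k odd (rightPart v₁) (leftPart v) *
        evalAlt n (comulFun odd fun x => φ (mergeParts v₁ :: x)) v := by
  rw [← evalAlt_const_mul]
  exact evalAlt_congr h fun L _ hL => by rw [comulFun_cons, hL]

/-- Every first generator of a list with sum `v` is either a left or a right one. Both merge to the
same generator of `leftPart v + rightPart v`, and `dualCoeff_step` sums the two signs. -/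
theorem evalAlt_comulFun {odd : Bool} {n : ℕ} (φ : List (ι →₀ ℕ) → k) {v : ι ⊕ₗ ι →₀ ℕ}
    (hv : Admissible (!odd) v) (hn : v.degree = n) :
    evalAlt n (comulFun odd φ) v =
      dualCoeff k odd (leftPart v) (rightPart v) * evalAlt n φ (leftPart v + rightPart v) := by
  induction n generalizing φ v with
  | zero =>
    obtain rfl := (Finsupp.degree_eq_zero_iff v).mp hn
    simp [evalAlt, comulFun, crossings, dualCoeff, admissible_zero]
  | succ n ih =>
    have hp := admissible_iff_parts.mp hv
    set s := leftPart v with hs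
    set t := rightPart v with ht
    -- Extends the sums over the left and right generators to a common index set so that they can be
    -- compared termwise.
    have hsub : ∀ {r : ι →₀ ℕ}, r.support ⊆ (s + t).support → ∀ F : ι → k,
        ∑ i ∈ r.support, F i = ∑ i ∈ (s + t).support, if i ∈ r.support then F i else 0 :=
      fun h F => by
        rw [Finset.sum_ite_mem, Finset.inter_eq_right.mpr h]
    rw [evalAlt_succ_parts, evalAlt_succ, Finset.mul_sum, ← hs, ← ht,
      hsub (r := s) (fun i hi => by simp at hi ⊢; omega),
      hsub (r := t) (fun i hi => by simp at hi ⊢; omega),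
      ← Finset.sum_add_distrib]
    refine Finset.sum_congr rfl fun i hi => ?_
    rw [← mul_assoc (dualCoeff k odd s t), mul_comm (dualCoeff k odd s t),
      ← dualCoeff_step hp.1 hp.2 hi, add_mul]
    congr 1
    · split_ifs with h
      · have h1 := mem_support_inL (v := v) h
        have h2 := degree_sub_gen h1
        have e1 : leftPart (v - gen (inL i)) = s - gen i := by simp [leftPart_sub, hs]
        have e2 : rightPart (v - gen (inL i)) = t := by simp [rightPart_sub, ht]
        have e3 : s - gen i + t = s + t - gen i := tsub_add_eq_add_tsub (by
          rw [Finsupp.single_le_iff]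
          exact Nat.one_le_iff_ne_zero.mpr (Finsupp.mem_support_iff.mp h))
        rw [comulFun_eq_of_sum n (by omega), ih _ (hv.of_le tsub_le_self) (by omega), e1, e2, e3]
        simp [mergeParts_apply]
        ring
      · simp
    · split_ifs with h
      · have h1 := mem_support_inR (v := v) h
        have h2 := degree_sub_gen h1
        have e1 : leftPart (v - gen (inR i)) = s := by simp [leftPart_sub, hs]
        have e2 : rightPart (v - gen (inR i)) = t - gen i := by simp [rightPart_sub, ht]
        have e3 : s + (t - gen i) = s + t - gen i := (add_tsub_assoc_of_le (by
          rw [Finsupp.single_le_iff]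
          exact Nat.one_le_iff_ne_zero.mpr (Finsupp.mem_support_iff.mp h)) _).symm
        rw [comulFun_eq_of_sum n (by omega), ih _ (hv.of_le tsub_le_self) (by omega), e1, e2, e3]
        simp [mergeParts_apply, dotSign, dot_gen_left]
        ring
      · simp

end Comultiplication

/-! ### Coordinate functionals and tensor products -/

section Coordinates

variable {k : Type*} [Field k] {U V W : Type*} [AddCommGroup U] [Module k U]
  [AddCommGroup V] [Module k V] [AddCommGroup W] [Module k W]

/-- The functional `v ⊗ w ↦ f v * g w`. -/
def box (f : V →ₗ[k] k) (g : W →ₗ[k] k) : V ⊗[k] W →ₗ[k] k := tensorCounit f g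

@[simp] theorem box_tmul (f : V →ₗ[k] k) (g : W →ₗ[k] k) (v : V) (w : W) :
    box f g (v ⊗ₜ w) = f v * g w := by
  simp [box, tensorCounit]

@[simp] theorem box_zero_left (g : W →ₗ[k] k) : box (0 : V →ₗ[k] k) g = 0 := by
  ext; simp

@[simp] theorem box_zero_right (f : V →ₗ[k] k) : box f (0 : W →ₗ[k] k) = 0 := by
  ext; simp

@[simp] theorem box_smul_left (c : k) (f : V →ₗ[k] k) (g : W →ₗ[k] k) :
    box (c • f) g = c • box f g := by
  ext; simp [mul_assoc]

@[simp] theorem box_smul_right (c : k) (f : V →ₗ[k] k) (g : W →ₗ[k] k) :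
    box f (c • g) = c • box f g := by
  ext; simp [mul_left_comm]

theorem box_map {V' W' : Type*} [AddCommGroup V'] [Module k V'] [AddCommGroup W'] [Module k W']
    (f : V →ₗ[k] k) (g : W →ₗ[k] k) (F : V' →ₗ[k] V) (G : W' →ₗ[k] W) (t : V' ⊗[k] W') :
    box f g (TensorProduct.map F G t) = box (f ∘ₗ F) (g ∘ₗ G) t := by
  rw [← LinearMap.comp_apply]
  congr 1
  ext; simp

theorem box_lTensor {W' : Type*} [AddCommGroup W'] [Module k W'] (f : V →ₗ[k] k) (g : W →ₗ[k] k)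
    (G : W' →ₗ[k] W) (t : V ⊗[k] W') :
    box f g (LinearMap.lTensor V G t) = box f (g ∘ₗ G) t :=
  box_map f g LinearMap.id G t

theorem box_rTensor {V' : Type*} [AddCommGroup V'] [Module k V'] (f : V →ₗ[k] k) (g : W →ₗ[k] k)
    (F : V' →ₗ[k] V) (t : V' ⊗[k] W) :
    box f g (LinearMap.rTensor W F t) = box (f ∘ₗ F) g t :=
  box_map f g F LinearMap.id t

theorem box_assoc (f : U →ₗ[k] k) (g : V →ₗ[k] k) (h : W →ₗ[k] k) (t : (U ⊗[k] V) ⊗[k] W) :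
    box f (box g h) (TensorProduct.assoc k U V W t) = box (box f g) h t := by
  rw [← LinearEquiv.coe_coe, ← LinearMap.comp_apply]
  congr 1
  ext; simp [mul_assoc]

theorem box_assoc_symm (f : U →ₗ[k] k) (g : V →ₗ[k] k) (h : W →ₗ[k] k) (t : U ⊗[k] (V ⊗[k] W)) :
    box (box f g) h ((TensorProduct.assoc k U V W).symm t) = box f (box g h) t := by
  rw [← box_assoc, LinearEquiv.apply_symm_apply]

theorem box_interchange {τ : V ⊗[k] W →ₗ[k] W ⊗[k] V} {f f' : V →ₗ[k] k} {g g' : W →ₗ[k] k} {c : k}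
    (h : box g f' ∘ₗ τ = c • box f' g) (t : (V ⊗[k] V) ⊗[k] (W ⊗[k] W)) :
    box (box f g) (box f' g') (interchange τ t) = c * box (box f f') (box g g') t := by
  simp only [interchange, LinearMap.comp_apply, LinearEquiv.coe_coe]
  rw [box_assoc_symm, box_lTensor, ← box_assoc]
  have : box g (box f' g') ∘ₗ ((TensorProduct.assoc k W V W).toLinearMap ∘ₗ
      LinearMap.rTensor W τ ∘ₗ (TensorProduct.assoc k V W W).symm.toLinearMap) =
      c • box f' (box g g') := by
    refine LinearMap.ext fun t => ?_
    simp only [LinearMap.comp_apply, LinearEquiv.coe_coe]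
    rw [box_assoc, box_rTensor, h, box_smul_left, LinearMap.smul_apply, box_assoc_symm,
      LinearMap.smul_apply]
  rw [this, box_smul_right, LinearMap.smul_apply, smul_eq_mul]

variable {α β : Type*}

/-- The functionals `c a` are the coordinates with respect to a basis indexed by `S`, and vanish
for `a ∉ S`. -/
structure IsCoord (c : α → V →ₗ[k] k) (S : Set α) : Prop where
  ext_zero : ∀ v, (∀ a, c a v = 0) → v = 0
  finite : ∀ v, (Function.support fun a => c a v).Finite
  mem : ∀ a v, c a v ≠ 0 → a ∈ S
  exists_dual : ∀ a ∈ S, ∃ v, c a v = 1 ∧ ∀ b ≠ a, c b v = 0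

namespace IsCoord

variable {c : α → V →ₗ[k] k} {S : Set α}

theorem ext_iff (h : IsCoord c S) {v w : V} : v = w ↔ ∀ a, c a v = c a w := by
  refine ⟨fun e a => by rw [e], fun e => sub_eq_zero.mp (h.ext_zero _ fun a => ?_)⟩
  rw [map_sub, e, sub_self]

theorem eq_zero (h : IsCoord c S) {a : α} (ha : a ∉ S) : c a = 0 := by
  ext v
  by_contra h0
  exact ha (h.mem a v h0)

/-- Induction on a finite set containing the support of the coordinates: multiples of the given
elements `u` of `N` remove the coordinates one at a time. The `u` need not be normalized. -/
theorem mem_submodule (h : IsCoord c S) (N : Submodule k V) (v : V)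
    (hN : ∀ a, c a v ≠ 0 → ∃ u ∈ N, c a u ≠ 0 ∧ ∀ b ≠ a, c b u = 0) : v ∈ N := by
  classical
  have key : ∀ (s : Finset α) (v : V), (∀ a, c a v ≠ 0 → a ∈ s) →
      (∀ a, c a v ≠ 0 → ∃ u ∈ N, c a u ≠ 0 ∧ ∀ b ≠ a, c b u = 0) → v ∈ N := by
    intro s
    induction s using Finset.induction_on with
    | empty =>
      intro v hv _
      rw [h.ext_zero v fun a => by_contra fun h0 => by simpa using hv a h0]
      exact zero_mem _
    | insert a s ha ih =>
      intro v hv hN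
      by_cases h0 : c a v = 0
      · refine ih v (fun b hb => (Finset.mem_insert.mp (hv b hb)).resolve_left ?_) hN
        rintro rfl
        exact hb h0
      · obtain ⟨u, hu, hu1, hu2⟩ := hN a h0
        have e : ∀ b, c b (v - (c a v / c a u) • u) = if b = a then 0 else c b v := by
          intro b
          rw [map_sub, map_smul, smul_eq_mul]
          split_ifs with hb
          · subst hb; rw [div_mul_cancel₀ _ hu1, sub_self]
          · rw [hu2 b hb, mul_zero, sub_zero]
        have h1 : v - (c a v / c a u) • u ∈ N := by
          refine ih _ (fun b hb => ?_) fun b hb => hN b ?_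
          · rw [e] at hb
            split_ifs at hb with hba
            · exact absurd rfl hb
            · exact (Finset.mem_insert.mp (hv b hb)).resolve_left hba
          · rw [e] at hb
            split_ifs at hb
            · exact absurd rfl hb
            · exact hb
        rw [← sub_add_cancel v ((c a v / c a u) • u)]
        exact add_mem h1 (N.smul_mem _ hu)
  exact key (h.finite v).toFinset v (fun a ha => by simpa using ha) hN

theorem exists_of_finite (h : IsCoord c S) (f : α → k) (hf : (Function.support f).Finite)
    (hS : ∀ a, f a ≠ 0 → a ∈ S) : ∃ v, ∀ a, c a v = f a := by
  classical
  choose! u hu1 hu2 using h.exists_dual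
  refine ⟨∑ a ∈ hf.toFinset, f a • u a, fun a => ?_⟩
  rw [map_sum]
  by_cases ha : f a = 0
  · rw [ha]
    refine Finset.sum_eq_zero fun b hb => ?_
    have hb : f b ≠ 0 := by simpa using hb
    rw [map_smul, hu2 b (hS b hb) a fun e => hb (e ▸ ha), smul_zero]
  · rw [Finset.sum_eq_single a]
    · rw [map_smul, hu1 a (hS a ha), smul_eq_mul, mul_one]
    · intro b hb hba
      have hb : f b ≠ 0 := by simpa using hb
      rw [map_smul, hu2 b (hS b hb) a hba.symm, smul_zero]
    · intro h0
      simp [ha] at h0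

/-- The pointwise choice of preimages is automatically linear, since coordinates determine a vector.
-/
theorem exists_linearMap (h : IsCoord c S) (F : α → W →ₗ[k] k)
    (hf : ∀ w, (Function.support fun a => F a w).Finite) (hS : ∀ a w, F a w ≠ 0 → a ∈ S) :
    ∃ g : W →ₗ[k] V, ∀ a w, c a (g w) = F a w := by
  choose g hg using fun w => h.exists_of_finite (fun a => F a w) (hf w) fun a => hS a w
  refine ⟨{ toFun := g, map_add' := fun x y => ?_, map_smul' := fun r x => ?_ }, fun a w => hg w a⟩
  · rw [h.ext_iff]
    intro a
    rw [map_add, hg, hg, hg, map_add]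
  · rw [h.ext_iff]
    intro a
    rw [RingHom.id_apply, map_smul, hg, hg, map_smul]

theorem of_basis {κ : Type*} (b : Module.Basis κ k V) {f : κ → α}
    (h1 : ∀ i v, c (f i) v = b.repr v i) (h2 : ∀ a, a ∉ Set.range f → c a = 0) :
    IsCoord c (Set.range f) where
  ext_zero v hv := by
    refine b.repr.map_eq_zero_iff.mp (Finsupp.ext fun i => ?_)
    rw [← h1, hv, Finsupp.zero_apply]
  finite v := by
    refine ((b.repr v).hasFiniteSupport.image f).subset fun a ha => ?_
    by_cases h : a ∈ Set.range f
    · obtain ⟨i, rfl⟩ := h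
      exact ⟨i, by simpa [h1] using ha, rfl⟩
    · simp [h2 a h] at ha
  mem a v hv := by
    by_contra h
    simp [h2 a h] at hv
  exists_dual := by
    rintro _ ⟨i, rfl⟩
    refine ⟨b i, by simp [h1], fun a ha => ?_⟩
    by_cases h : a ∈ Set.range f
    · obtain ⟨j, rfl⟩ := h
      have : i ≠ j := fun e => ha (e ▸ rfl)
      rw [h1, Module.Basis.repr_self, Finsupp.single_eq_of_ne this.symm]
    · simp [h2 a h]

theorem exists_basis (h : IsCoord c S) : ∃ b : Module.Basis S k V, ∀ a v, b.repr v a = c a v := by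
  let e : V →ₗ[k] (S →₀ k) :=
    { toFun := fun v => Finsupp.ofSupportFinite (fun a : S => c a v)
        (Set.Finite.preimage Subtype.val_injective.injOn (h.finite v))
      map_add' := fun x y => Finsupp.ext fun a => map_add (c a) x y
      map_smul' := fun r x => Finsupp.ext fun a => map_smul (c a) r x }
  have he : ∀ v a, e v a = c a v := fun _ _ => rfl
  have hinj : Function.Injective e := by
    rw [injective_iff_map_eq_zero]
    intro v hv
    refine h.ext_zero v fun a => ?_
    by_cases ha : a ∈ S
    · rw [← he v ⟨a, ha⟩, hv, Finsupp.zero_apply]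
    · rw [h.eq_zero ha, LinearMap.zero_apply]
  have hsurj : Function.Surjective e := by
    classical
    intro f
    obtain ⟨v, hv⟩ := h.exists_of_finite (fun a => if ha : a ∈ S then f ⟨a, ha⟩ else 0) (by
      refine (f.hasFiniteSupport.image Subtype.val).subset fun a ha => ?_
      simp only [Function.mem_support, ne_eq, dite_eq_right_iff, not_forall] at ha
      obtain ⟨h1, h2⟩ := ha
      exact ⟨⟨a, h1⟩, h2, rfl⟩) fun a ha => by
        by_contra h0
        exact ha (dif_neg h0)
    refine ⟨v, Finsupp.ext fun a => ?_⟩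
    rw [he, hv, dif_pos a.2]
  exact ⟨.ofRepr (LinearEquiv.ofBijective e ⟨hinj, hsurj⟩), fun a v => rfl⟩

theorem tensor (h : IsCoord c S) {d : β → W →ₗ[k] k} {T : Set β} (h' : IsCoord d T) :
    IsCoord (fun p : α × β => box (c p.1) (d p.2)) (S ×ˢ T) := by
  obtain ⟨b, hb⟩ := h.exists_basis
  obtain ⟨b', hb'⟩ := h'.exists_basis
  have e : S ×ˢ T = Set.range (fun p : S × T => ((p.1, p.2) : α × β)) := by
    ext ⟨x, y⟩
    simp
  rw [e]
  refine of_basis (b.tensorProduct b') (fun p t => ?_) fun p hp => ?_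
  · induction t using TensorProduct.induction_on with
    | zero => simp
    | add x y hx hy => simp [hx, hy]
    | tmul x y =>
      obtain ⟨p, q⟩ := p
      rw [Module.Basis.tensorProduct_repr_tmul_apply, hb, hb', box_tmul, smul_eq_mul, mul_comm]
  · rw [← e, Set.mem_prod, not_and_or] at hp
    rcases hp with hp | hp
    · simp [h.eq_zero hp]
    · simp [h'.eq_zero hp]

/-- The factors `u` allow for the sign rescalings. Injectivity of `f` on `S` need not be assumed:
two indices with the same image would have proportional coordinates, against the existence of dual
vectors. -/
theorem reindex (h : IsCoord c S) {d : β → V →ₗ[k] k} {f : α → β} {u : α → k} (hu : ∀ a ∈ S, u a ≠ 0) (h1 : ∀ a ∈ S, d (f a) = u a • c a)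
    (h2 : ∀ b, b ∉ f '' S → d b = 0) : IsCoord d (f '' S) where
  ext_zero v hv := by
    refine h.ext_zero v fun a => ?_
    by_cases ha : a ∈ S
    · have := hv (f a)
      rw [h1 a ha, LinearMap.smul_apply, smul_eq_mul] at this
      exact (mul_eq_zero.mp this).resolve_left (hu a ha)
    · rw [h.eq_zero ha, LinearMap.zero_apply]
  finite v := by
    refine ((h.finite v).image f).subset fun b hb => ?_
    by_cases hb1 : b ∈ f '' S
    · obtain ⟨a, ha, rfl⟩ := hb1
      refine ⟨a, fun h0 => hb ?_, rfl⟩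
      simp [h1 a ha, h0]
    · simp [h2 b hb1] at hb
  mem b v hv := by
    by_contra hb
    simp [h2 b hb] at hv
  exists_dual := by
    rintro _ ⟨a, ha, rfl⟩
    obtain ⟨v, hv1, hv2⟩ := h.exists_dual a ha
    refine ⟨(u a)⁻¹ • v, by simp [h1 a ha, hv1, hu a ha], fun b hb => ?_⟩
    by_cases hb1 : b ∈ f '' S
    · obtain ⟨a', ha', rfl⟩ := hb1
      have : a' ≠ a := fun e => hb (e ▸ rfl)
      simp [h1 a' ha', hv2 a' this]
    · simp [h2 b hb1]

end IsCoord

/-- Linear surjections with the same kernel have isomorphic images. -/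
theorem exists_equiv_of_ker_eq {π : U →ₗ[k] V} {g : U →ₗ[k] W} (hπ : Function.Surjective π)
    (hg : Function.Surjective g) (h : LinearMap.ker π = LinearMap.ker g) :
    ∃ Φ : V ≃ₗ[k] W, ∀ u, Φ (π u) = g u := by
  refine ⟨(π.quotKerEquivOfSurjective hπ).symm ≪≫ₗ Submodule.quotEquivOfEq _ _ h ≪≫ₗ
    g.quotKerEquivOfSurjective hg, fun u => ?_⟩
  have : (π.quotKerEquivOfSurjective hπ).symm (π u) = (LinearMap.ker π).mkQ u := by
    rw [LinearEquiv.symm_apply_eq]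
    rfl
  simp only [LinearEquiv.trans_apply, this]
  rfl

theorem box_symmetry {I J D E : Type*} [DecidableEq D] [DecidableEq E] (sgn : D → E → ℤˣ)
    (b : Module.Basis I k V) (deg : I → D) (b' : Module.Basis J k W) (deg' : J → E) (i : I) (j : J)
    (t : V ⊗[k] W) : box (b'.coord j) (b.coord i)
        (symmetry sgn (homogeneous b deg) (homogeneous b' deg') t) =
      ((sgn (deg i) (deg' j) : ℤ) : k) * box (b.coord i) (b'.coord j) t := by
  rw [← LinearMap.comp_apply, ← smul_eq_mul, ← LinearMap.smul_apply]
  congr 1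
  refine (b.tensorProduct b').ext fun p => ?_
  rw [Module.Basis.tensorProduct_apply, LinearMap.comp_apply,
    symmetry_tmul sgn _ _ (basis_mem_homogeneous b deg p.1) (basis_mem_homogeneous b' deg' p.2),
    map_zsmul, box_tmul, LinearMap.smul_apply, box_tmul]
  simp only [Module.Basis.coord_apply, Module.Basis.repr_self]
  by_cases h1 : p.1 = i <;> by_cases h2 : p.2 = j <;> simp [h1, h2]

theorem mem_homogeneous_iff {I D : Type*} [DecidableEq D] (b : Module.Basis I k V) (deg : I → D)
    (d : D) (v : V) : v ∈ homogeneous b deg d ↔ ∀ i, b.repr v i ≠ 0 → deg i = d := by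
  rw [homogeneous, b.mem_span_image]
  simp [Set.subset_def]

end Coordinates

/-! ### Cosimplicial vector spaces with combinatorial coordinates -/

section Model

variable {k : Type*} [Field k] {ι : Type*}

theorem mid_eq_sum {φ : List (ι →₀ ℕ) → k} {F : ℕ → k} {m : ℕ} {w : List (ι →₀ ℕ)}
    (hw : w.length = m + 1)
    (hF : ∀ x a b y, w = x ++ a :: b :: y → F x.length = φ (x ++ (a + b) :: y)) :
    mid φ w = ∑ i ∈ Finset.range m, (-1) ^ i * F i := by
  induction w generalizing φ F m with
  | nil => simp at hw
  | cons a w ih =>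
    rcases w with _ | ⟨b, y⟩
    · obtain rfl : m = 0 := by simpa using hw.symm
      simp
    · obtain ⟨m, rfl⟩ : ∃ m', m = m' + 1 := ⟨y.length, by simpa using hw.symm⟩
      rw [mid_cons_cons, ih (φ := fun y => φ (a :: y)) (F := fun i => F (i + 1)) (m := m)
        (by simpa using hw) fun x c d z h => hF (a :: x) c d z (by rw [h, List.cons_append]),
        Finset.sum_range_succ', show F 0 = φ ((a + b) :: y) from hF [] a b y rfl]
      simp only [pow_succ, mul_neg, mul_one, neg_mul, Finset.sum_neg_distrib, pow_zero, one_mul]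
      ring

/-- The lists of `n + 1` admissible vectors. -/
def wordSet (ι : Type*) (odd : Bool) (n : ℕ) : Set (List (ι →₀ ℕ)) :=
  {w | w.length = n + 1 ∧ ∀ a ∈ w, Admissible odd a}

universe v

variable {X : ℕ → Type v} [∀ n, AddCommGroup (X n)] [∀ n, Module k (X n)]

/-- The functionals `e n` on `X n` are coordinates in which the cosimplicial operators take the
form they have for the tensor powers of a divided power or exterior coalgebra. -/
structure CosimplicialModel (odd : Bool) (δ : ∀ n, Fin (n + 2) → X n →ₗ[k] X (n + 1))
    (σ : ∀ n, Fin (n + 1) → X (n + 1) →ₗ[k] X n)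
    (e : ∀ n, List (ι →₀ ℕ) → X n →ₗ[k] k) : Prop where
  isCoord : ∀ n, IsCoord (e n) (wordSet ι odd n)
  coface : ∀ n (i : Fin (n + 1)) z x a b y, x.length = (i : ℕ) → (x ++ a :: b :: y).length = n + 2 →
    e (n + 1) (x ++ a :: b :: y) (δ n i.castSucc z) = e n (x ++ (a + b) :: y) z
  lastCoface : ∀ n z a x l, x.length = n →
    e (n + 1) (a :: (x ++ [l])) (δ n (Fin.last _) z) = dotSign k odd l x.sum * e n ((l + a) :: x) z
  codegeneracy : ∀ n (i : Fin (n + 1)) z a x y, x.length = (i : ℕ) → (x ++ y).length = n →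
    e n (a :: (x ++ y)) (σ n i z) = e (n + 1) (a :: (x ++ 0 :: y)) z

namespace CosimplicialModel

variable {odd : Bool} {δ : ∀ n, Fin (n + 2) → X n →ₗ[k] X (n + 1)}
  {σ : ∀ n, Fin (n + 1) → X (n + 1) →ₗ[k] X n} {e : ∀ n, List (ι →₀ ℕ) → X n →ₗ[k] k}

theorem apply_eq_zero (h : CosimplicialModel odd δ σ e) {n : ℕ} {w : List (ι →₀ ℕ)} (hw : w.length ≠ n + 1) (z : X n) :
    e n w z = 0 := by
  rw [(h.isCoord n).eq_zero fun hc => hw hc.1, LinearMap.zero_apply]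

theorem admissibleFun (h : CosimplicialModel odd δ σ e) {n : ℕ} (z : X n) : AdmissibleFun odd fun w => e n w z :=
  fun w hw => ((h.isCoord n).mem w z hw).2

theorem hochD_eq_zero (h : CosimplicialModel odd δ σ e) {n : ℕ} {w : List (ι →₀ ℕ)} (hw : w.length ≠ n + 2) (z : X n) :
    hochD odd (fun v => e n v z) w = 0 :=
  (hochD_congr fun y _ hy => h.apply_eq_zero (by omega) z).trans (hochD_zero odd w)

theorem apply_differential (h : CosimplicialModel odd δ σ e) (n : ℕ) (z : X n) (w : List (ι →₀ ℕ)) :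
    e (n + 1) w (differential δ n z) = hochD odd (fun v => e n v z) w := by
  by_cases hw : w.length = n + 2
  -- The value `0` for `i ≥ n + 1` is never used; it only makes `F` a function on all natural
  -- numbers.
  · rw [hochD, mid_eq_sum (m := n + 1) (F := fun i => if hi : i < n + 1 then
        e (n + 1) w (δ n (Fin.castSucc ⟨i, hi⟩) z) else 0) hw, Finset.sum_range]
    · rw [differential, Fin.sum_univ_castSucc]
      simp only [LinearMap.add_apply, LinearMap.sum_apply, LinearMap.smul_apply, map_add, map_sum,
        map_zsmul, Fin.is_lt, dite_true, Fin.eta]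
      congr 1
      · refine Finset.sum_congr rfl fun i _ => ?_
        rw [zsmul_eq_mul]
        simp
      · rcases w with _ | ⟨a, x⟩
        · simp at hw
        rcases List.eq_nil_or_concat' x with rfl | ⟨x, l, rfl⟩
        · simp at hw
        have hx : x.length = n := by simpa using hw
        rw [h.lastCoface n z a x l hx, lastFace_append, hw, zsmul_eq_mul]
        simp [pow_succ]
    · rintro x a b y rfl
      have hx : x.length < n + 1 := by
        simp only [List.length_append, List.length_cons] at hw
        omega
      rw [dif_pos hx, h.coface n ⟨x.length, hx⟩ z x a b y rfl hw]
  · rw [h.hochD_eq_zero hw, h.apply_eq_zero hw]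

/-- The codegeneracies insert a zero at every position except the first. So normalization is the
vanishing at lists with a zero in the tail, and the first entry remains free. -/
theorem mem_normalized_iff (h : CosimplicialModel odd δ σ e) (n : ℕ) (z : X n) :
    z ∈ normalized σ n ↔ NormalizedTail fun w => e n w z := by
  rcases n with _ | n
  · simp only [normalized, Submodule.mem_top, true_iff]
    intro a x hx
    refine h.apply_eq_zero ?_ z
    rcases x with _ | ⟨b, x⟩ <;> simp at hx ⊢
  · simp only [normalized, Submodule.mem_iInf, LinearMap.mem_ker]
    constructor
    · intro hz a x hx
      obtain ⟨x, y, rfl⟩ := List.append_of_mem hx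
      by_cases hl : (a :: (x ++ 0 :: y)).length = n + 1 + 1
      · have hi : x.length < n + 1 := by
          simp only [List.length_append, List.length_cons] at hl
          omega
        change e (n + 1) (a :: (x ++ 0 :: y)) z = 0
        rw [← h.codegeneracy n ⟨x.length, hi⟩ z a x y rfl (by
          simp only [List.length_append, List.length_cons] at hl ⊢
          omega), hz, map_zero]
      · exact h.apply_eq_zero hl z
    · intro hz i
      refine (h.isCoord n).ext_zero _ fun w => ?_
      by_cases hw : w.length = n + 1
      · rcases w with _ | ⟨a, w⟩
        · simp at hw
        have hwn : w.length = n := by simpa using hw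
        rw [← List.take_append_drop i w, h.codegeneracy n i z a _ _ (by
          rw [List.length_take, hwn]
          omega) (by rw [List.take_append_drop, hwn])]
        exact hz a _ (by simp)
      · exact h.apply_eq_zero hw _

theorem mem_cocycles_iff (h : CosimplicialModel odd δ σ e) (n : ℕ) (z : X n) : z ∈ cocycles δ σ n ↔
    NormalizedTail (fun w => e n w z) ∧ ∀ w, hochD odd (fun v => e n v z) w = 0 := by
  rw [cocycles, Submodule.mem_inf, h.mem_normalized_iff, LinearMap.mem_ker]
  refine and_congr_right fun _ => ⟨fun h0 w => ?_, fun h0 => ?_⟩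
  · rw [← h.apply_differential, h0, map_zero]
  · exact (h.isCoord (n + 1)).ext_zero _ fun w => by rw [h.apply_differential, h0]

theorem exists_of_fun (h : CosimplicialModel odd δ σ e) {n : ℕ} {Z : List (ι →₀ ℕ) → k} (hZ : AdmissibleFun odd Z)
    (hlen : ∀ w, Z w ≠ 0 → w.length = n + 1) (hfin : (Function.support Z).Finite) :
    ∃ z : X n, ∀ w, e n w z = Z w :=
  (h.isCoord n).exists_of_finite Z hfin fun w hw => ⟨hlen w hw, hZ w hw⟩

end CosimplicialModel

end Model

/-! ### Evaluations detect cohomology in a cosimplicial model -/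

section Evaluation

universe v

variable {k : Type*} [Field k] {ι : Type*} [LinearOrder ι]
  {X : ℕ → Type v} [∀ n, AddCommGroup (X n)] [∀ n, Module k (X n)]
  {odd : Bool} {δ : ∀ n, Fin (n + 2) → X n →ₗ[k] X (n + 1)}
  {σ : ∀ n, Fin (n + 1) → X (n + 1) →ₗ[k] X n} {e : ∀ n, List (ι →₀ ℕ) → X n →ₗ[k] k}

/-- The signed sum of the coordinates of an element at the lists starting with `a` and continuing
with `n` generators with sum `s`. -/
def evalMap {V : Type*} [AddCommGroup V] [Module k V] (e : List (ι →₀ ℕ) → V →ₗ[k] k) (n : ℕ)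
    (a s : ι →₀ ℕ) : V →ₗ[k] k where
  toFun z := evalAlt n (fun x => e (a :: x) z) s
  map_add' y z := by simp only [map_add, evalAlt_add]
  map_smul' r z := by simp only [map_smul, smul_eq_mul, evalAlt_const_mul, RingHom.id_apply]

theorem evalMap_apply {V : Type*} [AddCommGroup V] [Module k V] (e : List (ι →₀ ℕ) → V →ₗ[k] k)
    (n : ℕ) (a s : ι →₀ ℕ) (z : V) : evalMap e n a s z = evalAlt n (fun x => e (a :: x) z) s := rfl

namespace CosimplicialModel

theorem eval_eq_zero_of_mem (h : CosimplicialModel odd δ σ e) {n : ℕ} {z : X n}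
    (hz : z ∈ coboundaries δ σ n) (a : ι →₀ ℕ) {s : ι →₀ ℕ} (hs : Admissible (!odd) s)
    (hn : s.degree = n) : evalMap (e n) n a s z = 0 := by
  rw [evalMap_apply]
  rcases n with _ | n
  · rw [coboundaries, Submodule.mem_bot] at hz
    simp [hz, evalAlt]
  · obtain ⟨y, -, rfl⟩ := hz
    simp only [h.apply_differential]
    exact evalAlt_hochD (h.admissibleFun y) hs hn a

/-- The primitive found for coordinate functions is admissible and finitely supported, and therefore
the coordinate function of an element. In degree zero there are no coboundaries, and the statement
becomes that `z` vanishes. -/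
theorem mem_coboundaries (h : CosimplicialModel odd δ σ e) {n : ℕ} {z : X n}
    (h1 : NormalizedTail fun w => e n w z) (h2 : ∀ w, hochD odd (fun v => e n v z) w = 0)
    (h3 : ∀ a s, Admissible (!odd) s → s.degree = n → evalMap (e n) n a s z = 0) : z ∈ coboundaries δ σ n := by
  have hlen : ∀ w, e n w z ≠ 0 → w.length = n + 1 := fun w hw => ((h.isCoord n).mem w z hw).1
  obtain ⟨Y, hY1, hY2, hY3, hY4, hY5⟩ := IsNullHochCocycle.exists_hochD_eq
    ⟨h.admissibleFun z, h1, fun w _ => h2 w, h3⟩ hlen ((h.isCoord n).finite z)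
  rcases n with _ | n
  · rw [coboundaries, Submodule.mem_bot]
    refine (h.isCoord 0).ext_zero _ fun w => ?_
    by_cases hw : w.length = 1
    · obtain ⟨a, rfl⟩ := List.length_eq_one_iff.mp hw
      rw [← hY5]
      simp [hochD]
    · exact h.apply_eq_zero hw z
  · obtain ⟨y, hy⟩ := h.exists_of_fun hY1 hY4 hY3
    refine ⟨y, (h.mem_normalized_iff n y).mpr ?_, ?_⟩
    · simpa only [hy] using hY2
    · rw [(h.isCoord (n + 1)).ext_iff]
      intro w
      rw [h.apply_differential]
      simp only [hy]
      exact hY5 w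

theorem exists_cocycle (h : CosimplicialModel odd δ σ e) {a : ι →₀ ℕ} (ha : Admissible odd a)
    (s : ι →₀ ℕ) : ∃ (L : List ι) (z : X L.length) (c : (ι →₀ ℕ) → k), L.length = s.degree ∧
      (L.map gen).sum = s ∧ (∀ b, c b ≠ 0 ↔ b = a) ∧
      ∀ w, e L.length w z = insertGens odd (single₁ c) L w := by
  classical
  obtain ⟨L, hL1, hL2⟩ := exists_list_sum_gen s
  have hc : ∀ b, (if b = a then 1 else 0 : k) ≠ 0 ↔ b = a := fun b => by simp
  have hadm := (admissibleFun_single₁ (odd := odd) (c := fun b => (if b = a then 1 else 0 : k))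
    fun b hb => by rw [(hc b).mp hb]; exact ha).insertGens L
  obtain ⟨z, hz⟩ := h.exists_of_fun hadm
    (fun w hw => (insertGens_support (fun b hb => (hc b).mp hb) L hw).1)
    ((finite_lists_of_sum_mem (Set.finite_singleton (a + (L.map gen).sum)) (L.length + 1)).subset
      fun w hw => insertGens_support (fun b hb => (hc b).mp hb) L hw)
  exact ⟨L, z, _, hL2, hL1, hc, hz⟩

/-- A given `z` has only finitely many nonzero evaluations, since each forces a nonzero coordinate
at some list with head `a` and tail sum `s`. They are therefore the coordinates of an element of
`T`. -/
theorem exists_eval (h : CosimplicialModel odd δ σ e) {T : Type*} [AddCommGroup T] [Module k T]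
    {cT : (ι →₀ ℕ) × (ι →₀ ℕ) → T →ₗ[k] k}
    (hT : IsCoord cT {p | Admissible odd p.1 ∧ Admissible (!odd) p.2}) (n : ℕ) :
    ∃ g : X n →ₗ[k] T, (∀ a s z, Admissible (!odd) s → s.degree = n →
      cT (a, s) (g z) = evalMap (e n) n a s z) ∧
      ∀ a s z, s.degree ≠ n → cT (a, s) (g z) = 0 := by
  classical
  let F : (ι →₀ ℕ) × (ι →₀ ℕ) → X n →ₗ[k] k := fun p =>
    if Admissible (!odd) p.2 ∧ p.2.degree = n then evalMap (e n) n p.1 p.2 else 0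
  have hF : ∀ a s z, Admissible (!odd) s → s.degree = n →
      F (a, s) z = evalMap (e n) n a s z := fun a s z h1 h2 => by
    simp only [F, if_pos (And.intro h1 h2)]
  have hF0 : ∀ a s z, ¬ (Admissible (!odd) s ∧ s.degree = n) → F (a, s) z = 0 :=
    fun a s z h1 => by simp only [F, if_neg h1, LinearMap.zero_apply]
  have key : ∀ a s z, F (a, s) z ≠ 0 → Admissible (!odd) s ∧ ∃ x, x.sum = s ∧ e n (a :: x) z ≠ 0 := by
    intro a s z hz
    by_cases h1 : Admissible (!odd) s ∧ s.degree = n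
    · refine ⟨h1.1, ?_⟩
      by_contra hc
      push Not at hc
      rw [hF a s z h1.1 h1.2] at hz
      exact hz (evalAlt_eq_zero h1.2 fun L _ hL => hc _ hL)
    · exact absurd (hF0 a s z h1) hz
  obtain ⟨g, hg⟩ := hT.exists_linearMap F (fun z => by
    refine (((h.isCoord n).finite z).image fun w => (w.headD 0, w.tail.sum)).subset ?_
    rintro ⟨a, s⟩ hz
    obtain ⟨-, x, rfl, hx⟩ := key a s z hz
    exact ⟨a :: x, hx, rfl⟩) (by
    rintro ⟨a, s⟩ z hz
    obtain ⟨h1, x, rfl, hx⟩ := key a s z hz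
    exact ⟨h.admissibleFun z _ hx a List.mem_cons_self, h1⟩)
  exact ⟨g, fun a s z h1 h2 => by rw [hg, hF a s z h1 h2],
    fun a s z h1 => by rw [hg, hF0 a s z fun hc => h1 hc.2]⟩

end CosimplicialModel

end Evaluation

/-! ### Tensor powers of a coalgebra in rescaled word coordinates -/

section Words

universe u v

variable {k : Type u} [Field k] {C : Type v} [AddCommGroup C] [Module k C]
  {ι : Type*} [LinearOrder ι]

/-- The sign with which the monomials `a` and `b` commute. -/
def swapSign (k : Type*) [Field k] (odd : Bool) (a b : ι →₀ ℕ) : k :=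
  chiOdd k odd a b * chiOdd k odd b a * dotSign k odd a b

theorem swapSign_add_left (odd : Bool) (a a' b : ι →₀ ℕ) :
    swapSign k odd (a + a') b = swapSign k odd a b * swapSign k odd a' b := by
  simp only [swapSign, chiOdd_add_left, chiOdd_add_right, dotSign_add_left]
  ring

@[simp] theorem swapSign_zero_left (odd : Bool) (b : ι →₀ ℕ) : swapSign k odd 0 b = 1 := by
  simp [swapSign]

/-- The coordinates on `C^{⊗ (n+1)}` built from the coordinates `c` on `C`, rescaled by signs. -/
def wordCoord (odd : Bool) (c : (ι →₀ ℕ) → C →ₗ[k] k) :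
    ∀ n, List (ι →₀ ℕ) → TensorPow k C n →ₗ[k] k
  | 0, [a] => c a
  | 0, _ => 0
  | _ + 1, [] => 0
  | n + 1, a :: w => chiOdd k odd a w.sum • box (c a) (wordCoord odd c n w)

variable {odd : Bool} {c : (ι →₀ ℕ) → C →ₗ[k] k}

theorem wordCoord_zero_singleton (a : ι →₀ ℕ) : wordCoord odd c 0 [a] = c a := rfl

theorem wordCoord_succ_cons (n : ℕ) (a : ι →₀ ℕ) (w : List (ι →₀ ℕ)) :
    wordCoord odd c (n + 1) (a :: w) =
      chiOdd k odd a w.sum • box (c a) (wordCoord odd c n w) := rfl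

theorem wordCoord_eq_zero {n : ℕ} {w : List (ι →₀ ℕ)} (hw : w.length ≠ n + 1) :
    wordCoord odd c n w = 0 := by
  induction n generalizing w with
  | zero => rcases w with _ | ⟨a, _ | ⟨b, w⟩⟩ <;> first | rfl | simp at hw
  | succ n ih =>
    rcases w with _ | ⟨a, w⟩
    · rfl
    · rw [wordCoord_succ_cons, ih (by simpa using hw), box_zero_right, smul_zero]
      rfl

theorem isCoord_wordCoord (hc : IsCoord c {a | Admissible odd a}) (n : ℕ) :
    IsCoord (wordCoord odd c n) (wordSet ι odd n) := by
  induction n with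
  | zero =>
    have e : wordSet ι odd 0 = (fun a => [a]) '' {a : ι →₀ ℕ | Admissible odd a} := by
      ext w
      constructor
      · rintro ⟨h1, h2⟩
        obtain ⟨a, rfl⟩ := List.length_eq_one_iff.mp h1
        exact ⟨a, h2 a (by simp), rfl⟩
      · rintro ⟨a, ha, rfl⟩
        exact ⟨rfl, by simpa using ha⟩
    rw [e]
    refine hc.reindex (u := fun _ => 1) (fun _ _ => one_ne_zero)
      (fun a _ => by rw [one_smul, wordCoord_zero_singleton]) fun w hw => ?_
    by_cases h1 : w.length = 1
    · obtain ⟨a, rfl⟩ := List.length_eq_one_iff.mp h1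
      rw [wordCoord_zero_singleton]
      exact hc.eq_zero fun ha => hw ⟨a, ha, rfl⟩
    · exact wordCoord_eq_zero h1
  | succ n ih =>
    have e : wordSet ι odd (n + 1) = (fun p : (ι →₀ ℕ) × List (ι →₀ ℕ) => p.1 :: p.2) ''
        ({a | Admissible odd a} ×ˢ wordSet ι odd n) := by
      ext w
      constructor
      · rintro ⟨h1, h2⟩
        rcases w with _ | ⟨a, w⟩
        · simp at h1
        · simp only [List.mem_cons, forall_eq_or_imp] at h2
          exact ⟨(a, w), ⟨h2.1, by simpa using h1, h2.2⟩, rfl⟩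
      · rintro ⟨⟨a, w⟩, ⟨ha, h1, h2⟩, rfl⟩
        exact ⟨by simp [h1], by simpa using ⟨ha, h2⟩⟩
    rw [e]
    refine (hc.tensor ih).reindex (u := fun p => chiOdd k odd p.1 p.2.sum) (fun p _ h0 => ?_)
      (fun p _ => rfl) fun w hw => ?_
    · have := chiOdd_mul_self (k := k) odd p.1 p.2.sum
      rw [h0, zero_mul] at this
      exact zero_ne_one this
    · rw [← e] at hw
      by_cases h1 : w.length = n + 2
      · rcases w with _ | ⟨a, w⟩
        · rfl
        rw [wordCoord_succ_cons]
        by_cases ha : Admissible odd a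
        · rw [ih.eq_zero, box_zero_right, smul_zero]
          rintro ⟨h3, h4⟩
          refine hw ⟨h1, ?_⟩
          simpa using ⟨ha, h4⟩
        · rw [hc.eq_zero ha, box_zero_left, smul_zero]
      · exact wordCoord_eq_zero h1

theorem wordCoord_castPow {m n : ℕ} (h : m = n) (w : List (ι →₀ ℕ)) (z : TensorPow k C m) :
    wordCoord odd c n w (castPow k C h z) = wordCoord odd c m w z := by
  subst h
  rfl

/-- The rescaling factor of a word is the product of `chiOdd` over all ordered pairs of positions.
As `chiOdd` is a bicharacter, it can be built up from the right as well as from the left. -/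
theorem wordCoord_snoc (n : ℕ) (w : List (ι →₀ ℕ)) (l : ι →₀ ℕ) (t : TensorPow k C n ⊗[k] C) :
    wordCoord odd c (n + 1) (w ++ [l]) (snoc k C n t) =
      chiOdd k odd w.sum l * box (wordCoord odd c n w) (c l) t := by
  induction n generalizing w with
  | zero =>
    rcases w with _ | ⟨a, _ | ⟨b, w⟩⟩
    · rw [wordCoord_eq_zero (by simp), wordCoord_eq_zero (w := []) (by simp)]
      simp
    · change chiOdd k odd a [l].sum * box (c a) (c l) t =
        chiOdd k odd [a].sum l * box (c a) (c l) t
      simp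
    · rw [wordCoord_eq_zero (by simp), wordCoord_eq_zero (w := a :: b :: w) (by simp)]
      simp
  | succ n ih =>
    rcases w with _ | ⟨a, w⟩
    · rw [wordCoord_eq_zero (by simp), wordCoord_eq_zero (w := []) (by simp)]
      simp
    · change (C ⊗[k] TensorPow k C n) ⊗[k] C at t
      change chiOdd k odd a (w ++ [l]).sum * box (c a) (wordCoord odd c (n + 1) (w ++ [l]))
        (LinearMap.lTensor C (snoc k C n) (TensorProduct.assoc k C (TensorPow k C n) C t)) =
          chiOdd k odd (a :: w).sum l *
            box (chiOdd k odd a w.sum • box (c a) (wordCoord odd c n w)) (c l) t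
      have e : wordCoord odd c (n + 1) (w ++ [l]) ∘ₗ snoc k C n =
          chiOdd k odd w.sum l • box (wordCoord odd c n w) (c l) :=
        LinearMap.ext fun t => ih w t
      rw [box_lTensor, e, box_smul_right, LinearMap.smul_apply, box_assoc, box_smul_left,
        LinearMap.smul_apply]
      simp only [List.sum_append, List.sum_cons, List.sum_nil, add_zero, chiOdd_add_right,
        chiOdd_add_left, smul_eq_mul]
      ring

theorem wordCoord_eq_zero_of_internalDegree {deg : ι → ℕ} {𝒞 : ℕ → Submodule k C}
    (h𝒞 : ∀ x t, x ∈ 𝒞 t ↔ ∀ a, c a x ≠ 0 → Finsupp.weight deg a = t) {n t : ℕ}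
    {x : TensorPow k C n} (hx : x ∈ internalDegree 𝒞 n t) {w : List (ι →₀ ℕ)}
    (hw : Finsupp.weight deg w.sum ≠ t) : wordCoord odd c n w x = 0 := by
  induction n generalizing t w with
  | zero =>
    by_cases h1 : w.length = 1
    · obtain ⟨a, rfl⟩ := List.length_eq_one_iff.mp h1
      by_contra h0
      exact hw (by simpa using (h𝒞 x t).mp hx a h0)
    · rw [wordCoord_eq_zero h1, LinearMap.zero_apply]
  | succ n ih =>
    rcases w with _ | ⟨a, w⟩
    · rfl
    have key : (⨆ p ∈ Finset.HasAntidiagonal.antidiagonal t, LinearMap.range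
        (TensorProduct.map (𝒞 p.1).subtype (internalDegree 𝒞 n p.2).subtype)) ≤
        LinearMap.ker (box (c a) (wordCoord odd c n w)) := by
      refine iSup₂_le fun p hp => ?_
      rintro _ ⟨u, rfl⟩
      rw [LinearMap.mem_ker]
      induction u using TensorProduct.induction_on with
      | zero => simp
      | add u v hu hv => rw [map_add, map_add, hu, hv, add_zero]
      | tmul u v =>
        rw [TensorProduct.map_tmul, box_tmul, Submodule.subtype_apply, Submodule.subtype_apply]
        by_cases h1 : c a u = 0
        · rw [h1, zero_mul]
        · have h2 := (h𝒞 u p.1).mp u.2 a h1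
          rw [ih v.2, mul_zero]
          intro h3
          refine hw ?_
          rw [List.sum_cons, map_add, h2, h3]
          exact Finset.HasAntidiagonal.mem_antidiagonal.mp hp
    change chiOdd k odd a w.sum * box (c a) (wordCoord odd c n w) x = 0
    rw [LinearMap.mem_ker.mp (key hx), mul_zero]

theorem exists_dual_mem_internalDegree (hc : IsCoord c {a | Admissible odd a}) {deg : ι → ℕ}
    {𝒞 : ℕ → Submodule k C}
    (h𝒞 : ∀ x t, x ∈ 𝒞 t ↔ ∀ a, c a x ≠ 0 → Finsupp.weight deg a = t) {n : ℕ}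
    {w : List (ι →₀ ℕ)} (hw : w ∈ wordSet ι odd n) :
    ∃ x ∈ internalDegree 𝒞 n (Finsupp.weight deg w.sum), wordCoord odd c n w x ≠ 0 ∧
      ∀ w' ≠ w, wordCoord odd c n w' x = 0 := by
  have hdual : ∀ a, Admissible odd a → ∃ x ∈ 𝒞 (Finsupp.weight deg a), c a x = 1 ∧
      ∀ b ≠ a, c b x = 0 := by
    intro a ha
    obtain ⟨x, hx1, hx2⟩ := hc.exists_dual a ha
    refine ⟨x, (h𝒞 x _).mpr fun b hb => ?_, hx1, hx2⟩
    by_cases hba : b = a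
    · rw [hba]
    · exact absurd (hx2 b hba) hb
  obtain ⟨hl, hadm⟩ := hw
  induction n generalizing w with
  | zero =>
    obtain ⟨a, rfl⟩ := List.length_eq_one_iff.mp hl
    obtain ⟨x, hx, hx1, hx2⟩ := hdual a (hadm a (by simp))
    refine ⟨x, ?_, ?_, fun w' hw' => ?_⟩
    · rw [List.sum_singleton]
      exact hx
    · exact fun h0 => one_ne_zero (hx1.symm.trans h0)
    · by_cases h1 : w'.length = 1
      · obtain ⟨b, rfl⟩ := List.length_eq_one_iff.mp h1
        exact hx2 b fun h => hw' (by rw [h])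
      · rw [wordCoord_eq_zero h1]
        rfl
  | succ n ih =>
    rcases w with _ | ⟨a, w⟩
    · simp at hl
    simp only [List.mem_cons, forall_eq_or_imp] at hadm
    obtain ⟨x, hx, hx1, hx2⟩ := hdual a hadm.1
    obtain ⟨y, hy, hy1, hy2⟩ := ih (by simpa using hl) hadm.2
    refine ⟨x ⊗ₜ[k] y, ?_, ?_, fun w' hw' => ?_⟩
    · refine Submodule.mem_iSup_of_mem (Finsupp.weight deg a, Finsupp.weight deg w.sum)
        (Submodule.mem_iSup_of_mem ?_ ?_)
      · rw [Finset.HasAntidiagonal.mem_antidiagonal, List.sum_cons, map_add]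
      · exact ⟨⟨x, hx⟩ ⊗ₜ ⟨y, hy⟩, rfl⟩
    · change chiOdd k odd a w.sum * box (c a) (wordCoord odd c n w) (x ⊗ₜ y) ≠ 0
      rw [box_tmul, hx1, one_mul]
      refine mul_ne_zero (fun h0 => ?_) hy1
      have := chiOdd_mul_self (k := k) odd a w.sum
      rw [h0, zero_mul] at this
      exact zero_ne_one this
    · rcases w' with _ | ⟨b, w'⟩
      · rfl
      change chiOdd k odd b w'.sum * box (c b) (wordCoord odd c n w') (x ⊗ₜ y) = 0
      rw [box_tmul]
      by_cases hb : b = a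
      · rw [hy2 w' fun h => hw' (by rw [hb, h]), mul_zero, mul_zero]
      · rw [hx2 b hb, zero_mul, mul_zero]

/-- The dual vectors of words are pure tensors of homogeneous elements, so an element whose nonzero
coordinates all have weight `t` is a combination of such tensors. -/
theorem mem_internalDegree_iff (hc : IsCoord c {a | Admissible odd a}) {deg : ι → ℕ}
    {𝒞 : ℕ → Submodule k C}
    (h𝒞 : ∀ x t, x ∈ 𝒞 t ↔ ∀ a, c a x ≠ 0 → Finsupp.weight deg a = t) (n t : ℕ)
    (x : TensorPow k C n) : x ∈ internalDegree 𝒞 n t ↔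
      ∀ w, wordCoord odd c n w x ≠ 0 → Finsupp.weight deg w.sum = t := by
  refine ⟨fun hx w hw => ?_, fun h => ?_⟩
  · by_contra h0
    exact hw (wordCoord_eq_zero_of_internalDegree h𝒞 hx h0)
  · refine (isCoord_wordCoord hc n).mem_submodule _ x fun w hw => ?_
    obtain ⟨y, hy, hy1, hy2⟩ := exists_dual_mem_internalDegree hc h𝒞
      ((isCoord_wordCoord hc n).mem w x hw)
    exact ⟨y, h w hw ▸ hy, hy1, hy2⟩

variable [Coalgebra k C]

/-- The structure maps of `C` and the symmetry `τ` in the coordinates `c`: those of a divided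
power (`odd = false`) or exterior (`odd = true`) coalgebra in its monomial basis. -/
structure CoalgebraModel (odd : Bool) (τ : C ⊗[k] C →ₗ[k] C ⊗[k] C)
    (c : (ι →₀ ℕ) → C →ₗ[k] k) : Prop where
  isCoord : IsCoord c {a | Admissible odd a}
  comul : ∀ a b z, box (c a) (c b) (CoalgebraStruct.comul (R := k) z) =
    chiOdd k odd a b * c (a + b) z
  counit : ∀ z, CoalgebraStruct.counit (R := k) z = c 0 z
  symm : ∀ a b t, box (c a) (c b) (τ t) = swapSign k odd a b * box (c b) (c a) t

namespace CoalgebraModel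

variable {τ : C ⊗[k] C →ₗ[k] C ⊗[k] C}

theorem box_braidPast (h : CoalgebraModel odd τ c) (n : ℕ) (w : List (ι →₀ ℕ)) (a : ι →₀ ℕ)
    (t : C ⊗[k] TensorPow k C n) : box (wordCoord odd c n w) (c a) (braidPast τ n t) =
      swapSign k odd w.sum a * box (c a) (wordCoord odd c n w) t := by
  induction n generalizing w with
  | zero =>
    by_cases h1 : w.length = 1
    · obtain ⟨b, rfl⟩ := List.length_eq_one_iff.mp h1
      rw [List.sum_singleton]
      exact h.symm b a t
    · rw [wordCoord_eq_zero h1]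
      simp
  | succ n ih =>
    rcases w with _ | ⟨b, w⟩
    · rw [wordCoord_eq_zero (w := []) (by simp)]
      simp
    · change C ⊗[k] (C ⊗[k] TensorPow k C n) at t
      change box (chiOdd k odd b w.sum • box (c b) (wordCoord odd c n w)) (c a)
        ((TensorProduct.assoc k C (TensorPow k C n) C).symm
          (LinearMap.lTensor C (braidPast τ n)
            (TensorProduct.assoc k C C (TensorPow k C n)
              (LinearMap.rTensor (TensorPow k C n) τ
                ((TensorProduct.assoc k C C (TensorPow k C n)).symm t))))) =
        swapSign k odd (b :: w).sum a *
          box (c a) (chiOdd k odd b w.sum • box (c b) (wordCoord odd c n w)) t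
      have e1 : box (wordCoord odd c n w) (c a) ∘ₗ braidPast τ n =
          swapSign k odd w.sum a • box (c a) (wordCoord odd c n w) :=
        LinearMap.ext fun t => ih w t
      have e2 : box (c b) (c a) ∘ₗ τ = swapSign k odd b a • box (c a) (c b) :=
        LinearMap.ext fun t => h.symm b a t
      rw [box_smul_left, LinearMap.smul_apply, box_assoc_symm, box_lTensor, e1, box_smul_right,
        LinearMap.smul_apply, box_assoc, box_rTensor, e2, box_smul_left, LinearMap.smul_apply,
        box_assoc_symm, box_smul_right, LinearMap.smul_apply, List.sum_cons, swapSign_add_left]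
      simp only [smul_eq_mul]
      ring

/-- The sign `chiOdd a b` of the comultiplication is exactly the rescaling factor of the pair `a`,
`b`, and the two cancel. This is the reason for the rescaling. -/
theorem wordCoord_comulAt_zero (h : CoalgebraModel odd τ c) (n : ℕ) (a b : ι →₀ ℕ)
    (x : List (ι →₀ ℕ)) (z : TensorPow k C n) :
    wordCoord odd c (n + 1) (a :: b :: x) (comulAt k C n 0 z) =
      wordCoord odd c n ((a + b) :: x) z := by
  rcases n with _ | n
  · rcases x with _ | ⟨d, x⟩
    · change C at z
      change chiOdd k odd a [b].sum * box (c a) (c b) (CoalgebraStruct.comul (R := k) z) =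
        c (a + b) z
      rw [h.comul, List.sum_singleton, ← mul_assoc, chiOdd_mul_self, one_mul]
    · rw [wordCoord_eq_zero (by simp), wordCoord_eq_zero (by simp)]
      rfl
  · change C ⊗[k] TensorPow k C n at z
    change chiOdd k odd a (b :: x).sum * box (c a) (chiOdd k odd b x.sum •
      box (c b) (wordCoord odd c n x)) (TensorProduct.assoc k C C (TensorPow k C n)
        (LinearMap.rTensor (TensorPow k C n) (CoalgebraStruct.comul : C →ₗ[k] C ⊗[k] C) z)) =
      chiOdd k odd (a + b) x.sum * box (c (a + b)) (wordCoord odd c n x) z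
    have e : box (c a) (c b) ∘ₗ (CoalgebraStruct.comul : C →ₗ[k] C ⊗[k] C) =
        chiOdd k odd a b • c (a + b) := LinearMap.ext fun z => h.comul a b z
    rw [box_smul_right, LinearMap.smul_apply, box_assoc, box_rTensor, e, box_smul_left,
      LinearMap.smul_apply]
    simp only [smul_eq_mul, List.sum_cons, chiOdd_add_right, chiOdd_add_left]
    linear_combination (chiOdd k odd a x.sum * chiOdd k odd b x.sum *
      box (c (a + b)) (wordCoord odd c n x) z) * chiOdd_mul_self (k := k) odd a b

theorem wordCoord_comulAt (h : CoalgebraModel odd τ c) (n : ℕ) (i : Fin (n + 1))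
    (x : List (ι →₀ ℕ)) (a b : ι →₀ ℕ) (y : List (ι →₀ ℕ)) (z : TensorPow k C n)
    (hx : x.length = i) : wordCoord odd c (n + 1) (x ++ a :: b :: y) (comulAt k C n i z) =
      wordCoord odd c n (x ++ (a + b) :: y) z := by
  induction n generalizing x with
  | zero =>
    obtain rfl : i = 0 := Fin.fin_one_eq_zero i
    obtain rfl := List.length_eq_zero_iff.mp hx
    exact h.wordCoord_comulAt_zero 0 a b y z
  | succ n ih =>
    rcases Fin.eq_zero_or_eq_succ i with rfl | ⟨i, rfl⟩
    · obtain rfl := List.length_eq_zero_iff.mp hx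
      exact h.wordCoord_comulAt_zero (n + 1) a b y z
    · rcases x with _ | ⟨d, x⟩
      · simp at hx
      have e : wordCoord odd c (n + 1) (x ++ a :: b :: y) ∘ₗ comulAt k C n i =
          wordCoord odd c n (x ++ (a + b) :: y) :=
        LinearMap.ext fun z => ih i x z (by simpa using hx)
      change C ⊗[k] TensorPow k C n at z
      change chiOdd k odd d (x ++ a :: b :: y).sum *
        box (c d) (wordCoord odd c (n + 1) (x ++ a :: b :: y))
          (LinearMap.lTensor C (comulAt k C n i) z) =
        chiOdd k odd d (x ++ (a + b) :: y).sum *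
          box (c d) (wordCoord odd c n (x ++ (a + b) :: y)) z
      rw [box_lTensor, e]
      simp only [List.sum_append, List.sum_cons, add_assoc]

theorem wordCoord_lastCoface (h : CoalgebraModel odd τ c) (n : ℕ) (z : TensorPow k C n)
    (a : ι →₀ ℕ) (x : List (ι →₀ ℕ)) (l : ι →₀ ℕ) :
    wordCoord odd c (n + 1) (a :: (x ++ [l])) (coface τ n (Fin.last _) z) =
      dotSign k odd l x.sum * wordCoord odd c n ((l + a) :: x) z := by
  have e0 : coface τ n (Fin.last _) z = snoc k C n (braidPast τ n (comulAt k C n 0 z)) := by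
    rw [coface, Fin.lastCases_last]
    rfl
  have e : chiOdd k odd l (a :: x).sum *
      box (c l) (wordCoord odd c n (a :: x)) (comulAt k C n 0 z) =
        wordCoord odd c n ((l + a) :: x) z := h.wordCoord_comulAt_zero n l a x z
  rw [e0, ← List.cons_append, wordCoord_snoc]
  refine (congrArg _ (h.box_braidPast n (a :: x) l (comulAt k C n 0 z))).trans ?_
  -- `swapSign` consists of two factors `chiOdd` and a factor `dotSign`. The former turn the
  -- rescaling for `l` at the end into the one for `l` in front; the latter remains, and its part
  -- involving `a` is trivial because `l + a` is admissible.
  have h1 := chiOdd_mul_self (k := k) odd (a :: x).sum l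
  rw [← mul_assoc, swapSign, ← mul_assoc, ← mul_assoc, h1, one_mul, mul_comm (chiOdd _ _ _ _),
    mul_assoc, e, dotSign_comm, List.sum_cons, dotSign_add_right]
  by_cases h0 : wordCoord odd c n ((l + a) :: x) z = 0
  · rw [h0, mul_zero, mul_zero]
  · have := ((isCoord_wordCoord h.isCoord n).mem _ z h0).2 _ List.mem_cons_self
    rw [dotSign_of_admissible this, one_mul]

theorem wordCoord_codegeneracy (h : CoalgebraModel odd τ c) (n : ℕ) (i : Fin (n + 1))
    (z : TensorPow k C (n + 1)) (a : ι →₀ ℕ) (x y : List (ι →₀ ℕ)) (hx : x.length = i)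
    (hxy : (x ++ y).length = n) : wordCoord odd c n (a :: (x ++ y)) (codegeneracy k C n i z) =
      wordCoord odd c (n + 1) (a :: (x ++ 0 :: y)) z := by
  have hε : (CoalgebraStruct.counit : C →ₗ[k] k) = c 0 := LinearMap.ext h.counit
  induction n generalizing a x with
  | zero =>
    obtain ⟨rfl, rfl⟩ := List.append_eq_nil_iff.mp (List.length_eq_zero_iff.mp hxy)
    change C ⊗[k] C at z
    change c a (TensorProduct.rid k C (LinearMap.lTensor C (CoalgebraStruct.counit : C →ₗ[k] k) z)) =
      chiOdd k odd a [0].sum * box (c a) (c 0) z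
    rw [hε, List.sum_singleton, chiOdd_zero_right, one_mul]
    induction z using TensorProduct.induction_on with
    | zero => simp
    | add s t hs ht => simp only [map_add, hs, ht]
    | tmul s t => simp [mul_comm]
  | succ n ih =>
    rcases Fin.eq_zero_or_eq_succ i with rfl | ⟨i, rfl⟩
    · obtain rfl := List.length_eq_zero_iff.mp hx
      change C ⊗[k] (C ⊗[k] TensorPow k C n) at z
      change chiOdd k odd a y.sum * box (c a) (wordCoord odd c n y)
        (LinearMap.lTensor C ((TensorProduct.lid k (TensorPow k C n)).toLinearMap ∘ₗ
          LinearMap.rTensor (TensorPow k C n) (CoalgebraStruct.counit : C →ₗ[k] k)) z) =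
        chiOdd k odd a (0 :: y).sum * box (c a) (chiOdd k odd 0 y.sum •
          box (c 0) (wordCoord odd c n y)) z
      rw [box_lTensor, hε, List.sum_cons, zero_add, chiOdd_zero_left, one_smul]
      congr 3
      refine TensorProduct.ext' fun s t => ?_
      simp
    · rcases x with _ | ⟨d, x⟩
      · simp at hx
      have e : wordCoord odd c n (d :: (x ++ y)) ∘ₗ codegeneracy k C n i =
          wordCoord odd c (n + 1) (d :: (x ++ 0 :: y)) :=
        LinearMap.ext fun z => ih i z d x (by simpa using hx) (by simpa using hxy)
      change C ⊗[k] TensorPow k C (n + 1) at z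
      change chiOdd k odd a (d :: (x ++ y)).sum * box (c a) (wordCoord odd c n (d :: (x ++ y)))
          (LinearMap.lTensor C (codegeneracy k C n i) z) =
        chiOdd k odd a (d :: (x ++ 0 :: y)).sum * box (c a)
          (wordCoord odd c (n + 1) (d :: (x ++ 0 :: y))) z
      rw [box_lTensor, e]
      simp only [List.sum_append, List.sum_cons, zero_add]

theorem cosimplicialModel (h : CoalgebraModel odd τ c) :
    CosimplicialModel (X := fun n => TensorPow k C n) odd (coface τ) (codegeneracy k C)
      (wordCoord odd c) where
  isCoord := isCoord_wordCoord h.isCoord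
  coface n i z x a b y hx _ := by
    simp only [CoHochschild.coface, Fin.lastCases_castSucc]
    exact h.wordCoord_comulAt n i x a b y z hx
  lastCoface n z a x l _ := h.wordCoord_lastCoface n z a x l
  codegeneracy n i z a x y hx hxy := h.wordCoord_codegeneracy n i z a x y hx hxy

theorem wordCoord_frontMap (h : CoalgebraModel odd τ c) (p q : ℕ) (z : TensorPow k C p)
    (w : List (ι →₀ ℕ)) : wordCoord odd c (p + q) w (frontMap τ p q z) =
      (lastFace odd)^[q] (fun v => wordCoord odd c p v z) w := by
  induction q generalizing w with
  | zero => rfl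
  | succ q ih =>
    rw [Function.iterate_succ', Function.comp_apply, ← funext ih]
    change wordCoord odd c (p + q + 1) w (coface τ (p + q) (Fin.last _) (frontMap τ p q z)) = _
    rcases w with _ | ⟨a, x⟩
    · rw [wordCoord_eq_zero (by simp)]
      simp
    rcases List.eq_nil_or_concat' x with rfl | ⟨x, l, rfl⟩
    · rw [wordCoord_eq_zero (by simp)]
      simp
    rw [h.wordCoord_lastCoface, lastFace_append]

theorem wordCoord_backMap (h : CoalgebraModel odd τ c) (q p : ℕ) (z : TensorPow k C q)
    (w : List (ι →₀ ℕ)) : wordCoord odd c (q + p) w (backMap τ q p z) =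
      zeroFace^[p] (fun v => wordCoord odd c q v z) w := by
  induction p generalizing w with
  | zero => rfl
  | succ p ih =>
    rw [Function.iterate_succ', Function.comp_apply, ← funext ih]
    change wordCoord odd c (q + p + 1) w (coface τ (q + p) 0 (backMap τ q p z)) = _
    rcases w with _ | ⟨a, _ | ⟨b, x⟩⟩
    · rw [wordCoord_eq_zero (by simp)]
      simp [zeroFace]
    · rw [wordCoord_eq_zero (by simp)]
      simp [zeroFace, addHead]
    · rw [zeroFace_cons_cons, ← h.wordCoord_comulAt_zero, ← Fin.castSucc_zero, coface,
        Fin.lastCases_castSucc]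

/-- The coordinates on `C^{⊗ (n+1)} ⊗ C^{⊗ (n+1)}`. -/
def _root_.CoHochschild.pairCoord (odd : Bool) (c : (ι →₀ ℕ) → C →ₗ[k] k) (n : ℕ)
    (W : List (ι ⊕ₗ ι →₀ ℕ)) : TensorPow k C n ⊗[k] TensorPow k C n →ₗ[k] k :=
  box (wordCoord odd c n (W.map leftPart)) (wordCoord odd c n (W.map rightPart))

theorem pairCoord_alexanderWhitney (h : CoalgebraModel odd τ c) (p q : ℕ) (x : TensorPow k C p)
    (y : TensorPow k C q) (W : List (ι ⊕ₗ ι →₀ ℕ)) :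
    pairCoord odd c (p + q) W (alexanderWhitney τ p q (x ⊗ₜ y)) =
      awFun odd p q (fun w => wordCoord odd c p w x) (fun w => wordCoord odd c q w y) W := by
  rw [pairCoord, alexanderWhitney, TensorProduct.map_tmul, box_tmul, h.wordCoord_frontMap,
    LinearMap.comp_apply, wordCoord_castPow, h.wordCoord_backMap]
  rfl

theorem pairCoord_comulPow (h : CoalgebraModel odd τ c) (n : ℕ) (W : List (ι ⊕ₗ ι →₀ ℕ))
    (z : TensorPow k C n) : pairCoord odd c n W (comulPow τ n z) =
      comulFun odd (fun w => wordCoord odd c n w z) W := by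
  induction n generalizing W with
  | zero =>
    by_cases hW : W.length = 1
    · obtain ⟨v, rfl⟩ := List.length_eq_one_iff.mp hW
      change C at z
      change box (c (leftPart v)) (c (rightPart v)) (CoalgebraStruct.comul (R := k) z) =
        chiOdd k odd (leftPart [v].sum) (rightPart [v].sum) * sigma k odd ^ crossings [v] *
          c (mergeParts v) z
      rw [h.comul, List.sum_singleton, mergeParts_apply]
      simp [crossings]
    · rw [pairCoord, wordCoord_eq_zero (by simpa using hW), comulFun,
        wordCoord_eq_zero (w := W.map mergeParts) (by simpa using hW)]
      simp
  | succ n ih =>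
    rcases W with _ | ⟨v, W⟩
    · rw [pairCoord, wordCoord_eq_zero (by simp), comulFun,
        wordCoord_eq_zero (w := ([] : List (ι ⊕ₗ ι →₀ ℕ)).map mergeParts) (by simp)]
      simp
    · have e1 : box (wordCoord odd c n (W.map leftPart)) (c (rightPart v)) ∘ₗ braidPast τ n =
          swapSign k odd (W.map leftPart).sum (rightPart v) •
            box (c (rightPart v)) (wordCoord odd c n (W.map leftPart)) :=
        LinearMap.ext fun t => h.box_braidPast n _ _ t
      have e2 : box (c (leftPart v)) (c (rightPart v)) ∘ₗ
          (CoalgebraStruct.comul : C →ₗ[k] C ⊗[k] C) =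
          chiOdd k odd (leftPart v) (rightPart v) • c (leftPart v + rightPart v) :=
        LinearMap.ext fun z => h.comul _ _ z
      have e3 : box (wordCoord odd c n (W.map leftPart)) (wordCoord odd c n (W.map rightPart)) ∘ₗ
          comulPow τ n = (chiOdd k odd (leftPart W.sum) (rightPart W.sum) *
            sigma k odd ^ crossings W) • wordCoord odd c n (W.map mergeParts) :=
        LinearMap.ext fun z => ih W z
      change C ⊗[k] TensorPow k C n at z
      change box (chiOdd k odd (leftPart v) (W.map leftPart).sum •
          box (c (leftPart v)) (wordCoord odd c n (W.map leftPart)))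
        (chiOdd k odd (rightPart v) (W.map rightPart).sum •
          box (c (rightPart v)) (wordCoord odd c n (W.map rightPart)))
        (interchange (braidPast τ n) (TensorProduct.map
          (CoalgebraStruct.comul : C →ₗ[k] C ⊗[k] C) (comulPow τ n) z)) =
        chiOdd k odd (leftPart (v :: W).sum) (rightPart (v :: W).sum) *
          sigma k odd ^ (dot (rightPart v) (leftPart W.sum) + crossings W) *
            (chiOdd k odd (leftPart v + rightPart v) (W.map mergeParts).sum *
              box (c (leftPart v + rightPart v)) (wordCoord odd c n (W.map mergeParts)) z)
      rw [box_smul_left, box_smul_right, LinearMap.smul_apply, LinearMap.smul_apply,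
        box_interchange e1, box_map, e2, e3, box_smul_left, box_smul_right, LinearMap.smul_apply,
        LinearMap.smul_apply, ← map_list_sum, ← map_list_sum, ← map_list_sum, mergeParts_apply,
        List.sum_cons]
      have e4 := chiOdd_mul_self (k := k) odd (leftPart v) (rightPart W.sum)
      simp only [smul_eq_mul, swapSign, map_add, chiOdd_add_left, chiOdd_add_right, pow_add]
      rw [dotSign_comm odd (leftPart W.sum), dotSign]
      generalize chiOdd k odd (leftPart v) (rightPart W.sum) = u at *
      ring_nf
      rw [pow_two, e4]
      ring

/-- The diagonal of `X ⊗ X` looks like the coHochschild object of a coalgebra of the same type on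
twice as many generators. All results on cosimplicial models then apply to it. -/
theorem pairModel (h : CoalgebraModel odd τ c) :
    CosimplicialModel (X := fun n => TensorPow k C n ⊗[k] TensorPow k C n) odd
      (fun n i => TensorProduct.map (coface τ n i) (coface τ n i))
      (fun n i => TensorProduct.map (codegeneracy k C n i) (codegeneracy k C n i))
      (pairCoord odd c) where
  isCoord n := by
    have h1 := (isCoord_wordCoord h.isCoord n).tensor (isCoord_wordCoord h.isCoord n)
    -- Words in the doubled alphabet correspond to pairs of words of equal length.
    have key : ∀ w w' : List (ι →₀ ℕ), w.length = w'.length →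
        (List.zipWith joinParts w w').map leftPart = w ∧
          (List.zipWith joinParts w w').map rightPart = w' := by
      intro w
      induction w with
      | nil =>
        intro w' hw
        obtain rfl := List.length_eq_zero_iff.mp hw.symm
        simp
      | cons a w ih =>
        rintro (_ | ⟨b, w'⟩) hw
        · simp at hw
        · obtain ⟨h1, h2⟩ := ih w' (by simpa using hw)
          simp [h1, h2]
    have e : wordSet (ι ⊕ₗ ι) odd n =
        (fun p : List (ι →₀ ℕ) × List (ι →₀ ℕ) => List.zipWith joinParts p.1 p.2) ''
          (wordSet ι odd n ×ˢ wordSet ι odd n) := by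
      ext W
      constructor
      · rintro ⟨h1, h2⟩
        refine ⟨(W.map leftPart, W.map rightPart), ⟨⟨by simpa using h1, ?_⟩, by simpa using h1, ?_⟩,
          ?_⟩
        · simpa using fun v hv => (admissible_iff_parts.mp (h2 v hv)).1
        · simpa using fun v hv => (admissible_iff_parts.mp (h2 v hv)).2
        · clear h1 h2
          induction W with
          | nil => rfl
          | cons v W ih => simp [joinParts_parts]
      · rintro ⟨⟨w, w'⟩, ⟨⟨h1, h2⟩, h3, h4⟩, rfl⟩
        obtain ⟨k1, k2⟩ := key w w' (by rw [h1, h3])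
        simp only at h1 h2 h3 h4
        refine ⟨by simp [h1, h3], fun v hv => admissible_iff_parts.mpr ⟨h2 _ ?_, h4 _ ?_⟩⟩
        · exact k1 ▸ List.mem_map_of_mem hv
        · exact k2 ▸ List.mem_map_of_mem hv
    rw [e]
    refine h1.reindex (u := fun _ => 1) (fun _ _ => one_ne_zero) (fun p hp => ?_) fun W hW => ?_
    · obtain ⟨k1, k2⟩ := key p.1 p.2 (by rw [hp.1.1, hp.2.1])
      rw [one_smul, pairCoord, k1, k2]
    · rw [← e] at hW
      by_contra hne
      refine hW ⟨?_, fun v hv => admissible_iff_parts.mpr ⟨?_, ?_⟩⟩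
      · by_contra hl
        exact hne (by rw [pairCoord, wordCoord_eq_zero (by simpa using hl), box_zero_left])
      · by_contra ha
        refine hne ?_
        rw [pairCoord, (isCoord_wordCoord h.isCoord n).eq_zero, box_zero_left]
        exact fun hc => ha (hc.2 _ (List.mem_map_of_mem hv))
      · by_contra ha
        refine hne ?_
        rw [pairCoord, (isCoord_wordCoord h.isCoord n).eq_zero (a := W.map rightPart),
          box_zero_right]
        exact fun hc => ha (hc.2 _ (List.mem_map_of_mem hv))
  coface n i z x a b y hx hl := by
    rw [pairCoord, box_map, pairCoord]
    congr 2
    · refine LinearMap.ext fun z => ?_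
      rw [List.map_append, List.map_append, List.map_cons, List.map_cons, List.map_cons, map_add]
      exact h.cosimplicialModel.coface n i z _ _ _ _ (by simpa using hx) (by simpa using hl)
    · refine LinearMap.ext fun z => ?_
      rw [List.map_append, List.map_append, List.map_cons, List.map_cons, List.map_cons, map_add]
      exact h.cosimplicialModel.coface n i z _ _ _ _ (by simpa using hx) (by simpa using hl)
  lastCoface n z a x l hx := by
    have e : ∀ f : (ι ⊕ₗ ι →₀ ℕ) →+ (ι →₀ ℕ),
        wordCoord odd c (n + 1) ((a :: (x ++ [l])).map f) ∘ₗ coface τ n (Fin.last _) =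
          dotSign k odd (f l) (f x.sum) • wordCoord odd c n (((l + a) :: x).map f) := by
      intro f
      refine LinearMap.ext fun z => ?_
      rw [List.map_cons, List.map_append, List.map_cons, List.map_nil, List.map_cons, map_add,
        map_list_sum]
      exact h.wordCoord_lastCoface n z _ _ _
    rw [pairCoord, box_map, e, e, box_smul_left, box_smul_right, LinearMap.smul_apply,
      LinearMap.smul_apply, dotSign_parts, smul_eq_mul, smul_eq_mul, mul_assoc]
    rfl
  codegeneracy n i z a x y hx hl := by
    rw [pairCoord, box_map, pairCoord]
    congr 2
    · refine LinearMap.ext fun z => ?_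
      rw [List.map_cons, List.map_cons, List.map_append, List.map_append, List.map_cons, map_zero]
      exact h.wordCoord_codegeneracy n i z _ _ _ (by simpa using hx) (by simpa using hl)
    · refine LinearMap.ext fun z => ?_
      rw [List.map_cons, List.map_cons, List.map_append, List.map_append, List.map_cons, map_zero]
      exact h.wordCoord_codegeneracy n i z _ _ _ (by simpa using hx) (by simpa using hl)

end CoalgebraModel

end Words

/-! ### Comparison of coHochschild homology with the target coalgebra -/

section Comparison

universe u v

variable {k : Type u} [Field k] {C : Type v} [AddCommGroup C] [Module k C] [Coalgebra k C]
  {𝒞 : ℕ → Submodule k C} [DirectSum.Decomposition 𝒞] {ι : Type*} [LinearOrder ι] {odd : Bool}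
  {c : (ι →₀ ℕ) → C →ₗ[k] k} {T : Type*} [AddCommGroup T] [Module k T]
  {cT : (ι →₀ ℕ) × (ι →₀ ℕ) → T →ₗ[k] k}

/-- The coordinates `cT` on the bigraded coalgebra `T` are those of the tensor product of a divided
power and an exterior coalgebra (`odd = false`) or of an exterior and a polynomial coalgebra
(`odd = true`), rescaled by signs. -/
structure TargetModel (odd : Bool) (deg : ι → ℕ) (cT : (ι →₀ ℕ) × (ι →₀ ℕ) → T →ₗ[k] k)
    (ΔT : T →ₗ[k] T ⊗[k] T) (εT : T →ₗ[k] k) (𝒯 : ℕ × ℕ → Submodule k T) : Prop where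
  isCoord : IsCoord cT {p | Admissible odd p.1 ∧ Admissible (!odd) p.2}
  comul : ∀ a s a' s' t, box (cT (a, s)) (cT (a', s')) (ΔT t) =
    chiOdd k odd a a' * chiOdd k odd a s' * chiOdd k odd s a' * dotSign k odd a' s *
      (dualCoeff k odd s s' * cT (a + a', s + s') t)
  counit : ∀ t, εT t = cT (0, 0) t
  degree : ∀ d t, t ∈ 𝒯 d ↔ ∀ a s, cT (a, s) t ≠ 0 → (s.degree, Finsupp.weight deg (a + s)) = d

/-- The maps `g n` read off the coordinates `evalMap`. -/
structure IsEvalFamily (odd : Bool) (c : (ι →₀ ℕ) → C →ₗ[k] k)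
    (cT : (ι →₀ ℕ) × (ι →₀ ℕ) → T →ₗ[k] k) (g : ∀ n, TensorPow k C n →ₗ[k] T) : Prop where
  eval : ∀ n a s z, Admissible (!odd) s → s.degree = n →
    cT (a, s) (g n z) = evalMap (wordCoord odd c n) n a s z
  eval_of_ne : ∀ n a s z, s.degree ≠ n → cT (a, s) (g n z) = 0

variable (𝒞) in
/-- The map induced on sums of cocycles. -/
def onCocycles (g : ∀ n, TensorPow k C n →ₗ[k] T) : (⨁ n, Cocycles 𝒞 n) →ₗ[k] T :=
  DirectSum.toModule k ℕ T fun n => g n ∘ₗ (Cocycles 𝒞 n).subtype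

@[simp] theorem onCocycles_lof (g : ∀ n, TensorPow k C n →ₗ[k] T) (n : ℕ) (x : Cocycles 𝒞 n) :
    onCocycles 𝒞 g (DirectSum.lof k ℕ (fun n => Cocycles 𝒞 n) n x) = g n x := by
  simp [onCocycles]

theorem classOf_eq_zero_iff (z : ⨁ n, Cocycles 𝒞 n) :
    classOf 𝒞 z = 0 ↔ ∀ n, (z n : TensorPow k C n) ∈ Coboundaries 𝒞 n := by
  refine DFinsupp.ext_iff.trans (forall_congr' fun n => ?_)
  rw [classOf, DirectSum.lmap_apply, Submodule.mkQ_apply]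
  exact Submodule.Quotient.mk_eq_zero _

theorem classOf_surjective : Function.Surjective (classOf 𝒞) :=
  DFinsupp.mapRange_surjective _ (fun _ => map_zero _) |>.mpr
    fun _ => Submodule.mkQ_surjective _

theorem cocyclesAW_lof_tmul_lof (p q : ℕ) (x : Cocycles 𝒞 p) (y : Cocycles 𝒞 q) :
    cocyclesAW 𝒞 (DirectSum.lof k ℕ (fun n => Cocycles 𝒞 n) p x ⊗ₜ
        DirectSum.lof k ℕ (fun n => Cocycles 𝒞 n) q y) =
      DirectSum.lof k ℕ (fun n => TensorPow k C n ⊗[k] TensorPow k C n) (p + q)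
        (alexanderWhitney (koszul 𝒞) p q ((x : TensorPow k C p) ⊗ₜ (y : TensorPow k C q))) := by
  simp only [cocyclesAW, LinearMap.comp_apply, LinearEquiv.coe_coe,
    TensorProduct.directSum_lof_tmul_lof, DirectSum.toModule_lof, TensorProduct.map_tmul,
    Submodule.subtype_apply]

namespace IsEvalFamily

variable {g : ∀ n, TensorPow k C n →ₗ[k] T}

theorem coord_onCocycles (hg : IsEvalFamily odd c cT g) (a : ι →₀ ℕ) {s : ι →₀ ℕ}
    (hs : Admissible (!odd) s) (z : ⨁ n, Cocycles 𝒞 n) : cT (a, s) (onCocycles 𝒞 g z) =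
      evalMap (wordCoord odd c s.degree) s.degree a s (z s.degree : TensorPow k C s.degree) := by
  have key : cT (a, s) ∘ₗ onCocycles 𝒞 g =
      evalMap (wordCoord odd c s.degree) s.degree a s ∘ₗ (Cocycles 𝒞 s.degree).subtype ∘ₗ
        DirectSum.component k ℕ (fun n => Cocycles 𝒞 n) s.degree := by
    refine DirectSum.linearMap_ext _ fun n => LinearMap.ext fun x => ?_
    simp only [LinearMap.comp_apply, onCocycles_lof]
    by_cases hn : s.degree = n
    · subst hn
      rw [hg.eval _ a s _ hs rfl, DirectSum.component.lof_self]
      rfl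
    · rw [hg.eval_of_ne n a s _ hn]
      rw [DirectSum.component.of, dif_neg (Ne.symm hn), map_zero, map_zero]
  exact LinearMap.congr_fun key z

/-- By bilinearity it suffices to treat two cocycles of degrees `p` and `q`, where `evalAlt_awFun`
gives the product of their evaluations. If the degrees do not match those of the parts of `v`, both
sides vanish. -/
theorem coord_cocyclesAW (hg : IsEvalFamily odd c cT g) (h : CoalgebraModel odd (koszul 𝒞) c)
    (v₀ : ι ⊕ₗ ι →₀ ℕ) {v : ι ⊕ₗ ι →₀ ℕ} {n : ℕ} (hv : Admissible (!odd) v) (hn : v.degree = n)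
    (z : (⨁ n, Cocycles 𝒞 n) ⊗[k] (⨁ n, Cocycles 𝒞 n)) :
    evalMap (pairCoord odd c n) n v₀ v (cocyclesAW 𝒞 z n) =
      box (cT (leftPart v₀, leftPart v)) (cT (rightPart v₀, rightPart v))
        (TensorProduct.map (onCocycles 𝒞 g) (onCocycles 𝒞 g) z) := by
  obtain ⟨hl, hr⟩ := admissible_iff_parts.mp hv
  have key : evalMap (pairCoord odd c n) n v₀ v ∘ₗ
      DirectSum.component k ℕ (fun n => TensorPow k C n ⊗[k] TensorPow k C n) n ∘ₗ cocyclesAW 𝒞 =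
      box (cT (leftPart v₀, leftPart v)) (cT (rightPart v₀, rightPart v)) ∘ₗ
        TensorProduct.map (onCocycles 𝒞 g) (onCocycles 𝒞 g) := by
    refine TensorProduct.ext (DirectSum.linearMap_ext _ fun p => LinearMap.ext fun x =>
      DirectSum.linearMap_ext _ fun q => LinearMap.ext fun y => ?_)
    change evalMap (pairCoord odd c n) n v₀ v (DirectSum.component k ℕ
        (fun n => TensorPow k C n ⊗[k] TensorPow k C n) n (cocyclesAW 𝒞
          (DirectSum.lof k ℕ (fun n => Cocycles 𝒞 n) p x ⊗ₜ
            DirectSum.lof k ℕ (fun n => Cocycles 𝒞 n) q y))) =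
      box (cT (leftPart v₀, leftPart v)) (cT (rightPart v₀, rightPart v))
        (TensorProduct.map (onCocycles 𝒞 g) (onCocycles 𝒞 g)
          (DirectSum.lof k ℕ (fun n => Cocycles 𝒞 n) p x ⊗ₜ
            DirectSum.lof k ℕ (fun n => Cocycles 𝒞 n) q y))
    rw [cocyclesAW_lof_tmul_lof, TensorProduct.map_tmul, onCocycles_lof, onCocycles_lof, box_tmul]
    have hdeg := degree_parts v
    by_cases hpq : n = p + q
    · subst hpq
      rw [DirectSum.component.lof_self, evalMap_apply]
      simp only [h.pairCoord_alexanderWhitney]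
      rw [evalAlt_awFun odd ((h.cosimplicialModel.mem_cocycles_iff p x).mp x.2).1
        ((h.cosimplicialModel.mem_cocycles_iff q y).mp y.2).1 v₀ hn]
      split_ifs with hp
      · rw [hg.eval p _ _ _ hl hp, hg.eval q _ _ _ hr (by omega)]
        rfl
      · rw [hg.eval_of_ne p _ _ _ hp, zero_mul]
    · rw [DirectSum.component.of, dif_neg (Ne.symm hpq), map_zero]
      by_cases hp : (leftPart v).degree = p
      · rw [hg.eval_of_ne q _ _ _ (by omega), mul_zero]
      · rw [hg.eval_of_ne p _ _ _ hp, zero_mul]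
  exact LinearMap.congr_fun key z

theorem ker_eq (hg : IsEvalFamily odd c cT g) (h : CoalgebraModel odd (koszul 𝒞) c)
    (hT : IsCoord cT {p | Admissible odd p.1 ∧ Admissible (!odd) p.2}) :
    LinearMap.ker (classOf 𝒞) = LinearMap.ker (onCocycles 𝒞 g) := by
  ext z
  rw [LinearMap.mem_ker, LinearMap.mem_ker, classOf_eq_zero_iff]
  constructor
  · intro hz
    refine hT.ext_zero _ ?_
    rintro ⟨a, s⟩
    by_cases hs : Admissible (!odd) s
    · rw [hg.coord_onCocycles a hs]
      exact h.cosimplicialModel.eval_eq_zero_of_mem (hz s.degree) a hs rfl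
    · rw [hT.eq_zero fun hc => hs hc.2, LinearMap.zero_apply]
  · intro hz n
    obtain ⟨h1, h2⟩ := (h.cosimplicialModel.mem_cocycles_iff n _).mp (z n).2
    refine h.cosimplicialModel.mem_coboundaries h1 h2 fun a s hs hn => ?_
    subst hn
    rw [← hg.coord_onCocycles a hs, hz, map_zero]

/-- Cocycles dual to the coordinates `cT`. -/
theorem exists_dual (hg : IsEvalFamily odd c cT g) (h : CoalgebraModel odd (koszul 𝒞) c)
    (hT : IsCoord cT {p | Admissible odd p.1 ∧ Admissible (!odd) p.2}) {a s : ι →₀ ℕ}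
    (ha : Admissible odd a) (hs : Admissible (!odd) s) :
    ∃ (L : List ι) (x : Cocycles 𝒞 L.length) (r : (ι →₀ ℕ) → k), L.length = s.degree ∧
      (L.map gen).sum = s ∧ (∀ b, r b ≠ 0 ↔ b = a) ∧
      (∀ w, wordCoord odd c L.length w (x : TensorPow k C L.length) =
        insertGens odd (single₁ r) L w) ∧
      ∀ p, cT p (g L.length x) ≠ 0 ↔ p = (a, s) := by
  obtain ⟨L, z, r, hL, hsum, hr, hz⟩ := h.cosimplicialModel.exists_cocycle ha s
  have hadm : ∀ b, r b ≠ 0 → Admissible odd b := fun b hb => (hr b).mp hb ▸ ha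
  have hmem : z ∈ Cocycles 𝒞 L.length := by
    refine (h.cosimplicialModel.mem_cocycles_iff _ z).mpr ?_
    rw [funext hz]
    exact ⟨insertGens_normalized odd r L, hochD_insertGens hadm L⟩
  refine ⟨L, ⟨z, hmem⟩, r, hL, hsum, hr, hz, ?_⟩
  rintro ⟨b, t⟩
  by_cases ht : Admissible (!odd) t
  · by_cases hdeg : t.degree = L.length
    · rw [hg.eval _ b t _ ht hdeg, evalMap_apply]
      simp only [hz]
      obtain ⟨ε, hε, he⟩ := evalAlt_insertGens odd r L b
      rw [he t hdeg, hsum]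
      split_ifs with hts
      · rw [mul_ne_zero_iff, hr b]
        simp [hts, hε]
      · simp [hts]
    · rw [hg.eval_of_ne _ b t _ hdeg]
      simp only [ne_eq, not_true_eq_false, Prod.mk.injEq, false_iff, not_and]
      rintro - rfl
      exact hdeg hL.symm
  · rw [hT.eq_zero fun hc => ht hc.2]
    simp only [LinearMap.zero_apply, ne_eq, not_true_eq_false, Prod.mk.injEq, false_iff, not_and]
    rintro - rfl
    exact ht hs

theorem onCocycles_surjective (hg : IsEvalFamily odd c cT g)
    (h : CoalgebraModel odd (koszul 𝒞) c)
    (hT : IsCoord cT {p | Admissible odd p.1 ∧ Admissible (!odd) p.2}) :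
    Function.Surjective (onCocycles 𝒞 g) := by
  intro t
  refine hT.mem_submodule (LinearMap.range (onCocycles 𝒞 g)) t ?_
  rintro ⟨a, s⟩ hp
  obtain ⟨ha, hs⟩ := hT.mem _ t hp
  obtain ⟨L, x, r, -, -, -, -, hx⟩ := hg.exists_dual h hT ha hs
  refine ⟨_, ⟨DirectSum.lof k ℕ (fun n => Cocycles 𝒞 n) L.length x, rfl⟩, ?_, fun q hq => ?_⟩
  · rw [onCocycles_lof, hx]
  · rw [onCocycles_lof]
    by_contra h0
    exact hq ((hx q).mp h0)

/-- Cocycles of the diagonal cosimplicial vector space. -/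
abbrev _root_.CoHochschild.DiagonalCocycles (𝒞 : ℕ → Submodule k C) [DirectSum.Decomposition 𝒞]
    (n : ℕ) : Submodule k (TensorPow k C n ⊗[k] TensorPow k C n) :=
  cocycles (X := fun n => TensorPow k C n ⊗[k] TensorPow k C n)
    (fun n i => TensorProduct.map (coface (koszul 𝒞) n i) (coface (koszul 𝒞) n i))
    (fun n i => TensorProduct.map (codegeneracy k C n i) (codegeneracy k C n i)) n

/-- It is enough to represent the coordinate vectors of `T ⊗ T`. Products of the dual cocycles do
so, and their Alexander-Whitney images are cocycles by `awFun_insertGens`. -/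
theorem exists_map_eq (hg : IsEvalFamily odd c cT g) (h : CoalgebraModel odd (koszul 𝒞) c)
    (hT : IsCoord cT {p | Admissible odd p.1 ∧ Admissible (!odd) p.2}) (t : T ⊗[k] T) :
    ∃ z, TensorProduct.map (onCocycles 𝒞 g) (onCocycles 𝒞 g) z = t ∧
      ∀ n, cocyclesAW 𝒞 z n ∈ DiagonalCocycles 𝒞 n := by
  -- Being a submodule, `P` reduces the claim to one representative for each coordinate of `t`.
  let P : Submodule k ((⨁ n, Cocycles 𝒞 n) ⊗[k] (⨁ n, Cocycles 𝒞 n)) :=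
    ⨅ n, (DiagonalCocycles 𝒞 n).comap
      (DirectSum.component k ℕ (fun n => TensorPow k C n ⊗[k] TensorPow k C n) n ∘ₗ cocyclesAW 𝒞)
  have hP : ∀ z, z ∈ P ↔ ∀ n, cocyclesAW 𝒞 z n ∈ DiagonalCocycles 𝒞 n := fun z => by
    simp only [P, Submodule.mem_iInf]
    rfl
  suffices ht : t ∈ P.map (TensorProduct.map (onCocycles 𝒞 g) (onCocycles 𝒞 g)) by
    obtain ⟨z, hz, rfl⟩ := ht
    exact ⟨z, rfl, (hP z).mp hz⟩
  refine (hT.tensor hT).mem_submodule _ t ?_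
  rintro ⟨⟨a, s⟩, ⟨a', s'⟩⟩ hp
  obtain ⟨⟨ha, hs⟩, ha', hs'⟩ := (hT.tensor hT).mem _ t hp
  obtain ⟨L, x, r, -, -, hr, hx1, hx2⟩ := hg.exists_dual h hT ha hs
  obtain ⟨L', x', r', -, -, hr', hx1', hx2'⟩ := hg.exists_dual h hT ha' hs'
  refine ⟨_, ⟨DirectSum.lof k ℕ (fun n => Cocycles 𝒞 n) L.length x ⊗ₜ
    DirectSum.lof k ℕ (fun n => Cocycles 𝒞 n) L'.length x', ?_, rfl⟩, ?_, ?_⟩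
  · refine (hP _).mpr fun n => ?_
    rw [cocyclesAW_lof_tmul_lof]
    by_cases hn : n = L.length + L'.length
    · subst hn
      rw [DirectSum.lof_apply]
      refine (h.pairModel.mem_cocycles_iff _ _).mpr ?_
      have hadm : ∀ b, r b ≠ 0 → Admissible odd b := fun b hb => (hr b).mp hb ▸ ha
      have hadm' : ∀ b, r' b ≠ 0 → Admissible odd b := fun b hb => (hr' b).mp hb ▸ ha'
      rw [funext (h.pairCoord_alexanderWhitney _ _ _ _), funext hx1, funext hx1',
        awFun_insertGens hadm]
      refine ⟨insertGens_normalized odd _ _, hochD_insertGens (fun v hv => ?_) _⟩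
      rw [mul_ne_zero_iff] at hv
      exact admissible_iff_parts.mpr ⟨hadm _ hv.1, hadm' _ hv.2⟩
    · have : DirectSum.lof k ℕ (fun n => TensorPow k C n ⊗[k] TensorPow k C n)
          (L.length + L'.length) (alexanderWhitney (koszul 𝒞) L.length L'.length
            ((x : TensorPow k C L.length) ⊗ₜ (x' : TensorPow k C L'.length))) n = 0 :=
        DirectSum.of_eq_of_ne _ _ _ hn
      rw [this]
      exact zero_mem _
  · rw [TensorProduct.map_tmul, onCocycles_lof, onCocycles_lof, box_tmul, mul_ne_zero_iff, hx2,
      hx2']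
    exact ⟨rfl, rfl⟩
  · rintro ⟨p, q⟩ hpq
    rw [TensorProduct.map_tmul, onCocycles_lof, onCocycles_lof, box_tmul]
    by_contra h0
    rw [← ne_eq, mul_ne_zero_iff, hx2, hx2'] at h0
    exact hpq (Prod.ext h0.1 h0.2)

end IsEvalFamily

theorem CoalgebraModel.cocyclesComul_mem (h : CoalgebraModel odd (koszul 𝒞) c)
    (z : ⨁ n, Cocycles 𝒞 n) (n : ℕ) : cocyclesComul 𝒞 z n ∈ DiagonalCocycles 𝒞 n := by
  obtain ⟨h1, h2⟩ := (h.cosimplicialModel.mem_cocycles_iff n _).mp (z n).2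
  refine (h.pairModel.mem_cocycles_iff n _).mpr ?_
  have e : ∀ W, pairCoord odd c n W (cocyclesComul 𝒞 z n) =
      comulFun odd (fun w => wordCoord odd c n w (z n : TensorPow k C n)) W := fun W =>
    h.pairCoord_comulPow n W _
  rw [funext e]
  refine ⟨h1.comulFun, fun W => ?_⟩
  rw [hochD_comulFun (h.cosimplicialModel.admissibleFun _), comulFun, h2, mul_zero]

theorem IsEvalFamily.coord_cocyclesComul {g : ∀ n, TensorPow k C n →ₗ[k] T} {deg : ι → ℕ}
    {ΔT : T →ₗ[k] T ⊗[k] T} {εT : T →ₗ[k] k} {𝒯 : ℕ × ℕ → Submodule k T}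
    (hg : IsEvalFamily odd c cT g) (h : CoalgebraModel odd (koszul 𝒞) c)
    (hT : TargetModel odd deg cT ΔT εT 𝒯) (v₀ : ι ⊕ₗ ι →₀ ℕ) {v : ι ⊕ₗ ι →₀ ℕ} {n : ℕ}
    (hv : Admissible (!odd) v) (hn : v.degree = n) (z : ⨁ n, Cocycles 𝒞 n) :
    evalMap (pairCoord odd c n) n v₀ v (cocyclesComul 𝒞 z n) =
      box (cT (leftPart v₀, leftPart v)) (cT (rightPart v₀, rightPart v))
        (ΔT (onCocycles 𝒞 g z)) := by
  have e : ∀ W, pairCoord odd c n W (cocyclesComul 𝒞 z n) =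
      comulFun odd (fun w => wordCoord odd c n w (z n : TensorPow k C n)) W := fun W =>
    h.pairCoord_comulPow n W _
  have hdeg : (leftPart v + rightPart v).degree = n := by rw [map_add, ← degree_parts, hn]
  rw [evalMap_apply]
  simp only [e]
  rw [comulFun_eq_of_sum n hn, evalAlt_comulFun _ hv hn, hT.comul]
  congr 1
  by_cases hs : Admissible (!odd) (leftPart v + rightPart v)
  · rw [hg.coord_onCocycles _ hs]
    subst hdeg
    rfl
  -- Inadmissibility of the sum occurs only in the even case, where it means a repeated exterior
  -- generator.
  · have : dualCoeff k odd (leftPart v) (rightPart v) = 0 := by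
      cases odd
      · rw [Bool.not_false] at hs
        rw [dualCoeff, if_neg (by simp), if_neg hs]
      · exact absurd (fun h0 => by simp at h0) hs
    rw [this, zero_mul, zero_mul]

/-- Taking classes and reading off evaluations are both surjective on cocycles and have the same
kernel, namely the coboundaries; this gives the linear isomorphism. The rest compares evaluations.
-/
theorem coHHIsomorphicTo_of_model {deg : ι → ℕ} {ΔT : T →ₗ[k] T ⊗[k] T} {εT : T →ₗ[k] k}
    {𝒯 : ℕ × ℕ → Submodule k T} (h : CoalgebraModel odd (koszul 𝒞) c)
    (h𝒞 : ∀ x t, x ∈ 𝒞 t ↔ ∀ a, c a x ≠ 0 → Finsupp.weight deg a = t)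
    (hT : TargetModel odd deg cT ΔT εT 𝒯) : CoHHIsomorphicTo 𝒞 ΔT εT 𝒯 := by
  choose g hg1 hg2 using h.cosimplicialModel.exists_eval hT.isCoord
  have hg : IsEvalFamily odd c cT g := ⟨hg1, hg2⟩
  obtain ⟨Φ, hΦ⟩ := exists_equiv_of_ker_eq (U := ⨁ n, Cocycles 𝒞 n) (V := CoHH 𝒞) (W := T)
    (π := classOf 𝒞) (g := onCocycles 𝒞 g) classOf_surjective (hg.onCocycles_surjective h hT.isCoord) (hg.ker_eq h hT.isCoord)
  have hmap : ∀ z, TensorProduct.map Φ.toLinearMap Φ.toLinearMap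
      (TensorProduct.map (classOf 𝒞) (classOf 𝒞) z) =
        TensorProduct.map (onCocycles 𝒞 g) (onCocycles 𝒞 g) z := by
    intro z
    rw [← LinearMap.comp_apply, ← TensorProduct.map_comp]
    congr 2 <;> exact LinearMap.ext hΦ
  have hinj : Function.Injective (TensorProduct.map Φ.toLinearMap Φ.toLinearMap) :=
    (TensorProduct.congr Φ Φ).injective
  -- The comultiplication of the target transported along `Φ`.
  let ψ : CoHH 𝒞 →ₗ[k] CoHH 𝒞 ⊗[k] CoHH 𝒞 :=
    (TensorProduct.congr Φ Φ).symm.toLinearMap ∘ₗ ΔT ∘ₗ Φ.toLinearMap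
  have hψ : ∀ x, TensorProduct.map Φ.toLinearMap Φ.toLinearMap (ψ x) = ΔT (Φ x) := fun x =>
    (TensorProduct.congr Φ Φ).apply_symm_apply _
  refine ⟨ψ, fun z => ?_, fun ψ' hψ' => ?_, Φ, fun x => (hψ x).symm, fun x => ?_, fun d => ?_⟩
  -- Existence: choose representatives `y` of the target coproduct. The difference of `AW y` and the
  -- coproduct of `z` is a diagonal cocycle with vanishing evaluations, hence a coboundary.
  · obtain ⟨y, hy1, hy2⟩ := hg.exists_map_eq h hT.isCoord (ΔT (onCocycles 𝒞 g z))
    refine ⟨y, hinj ?_, fun n => ?_⟩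
    · rw [hmap, hy1, hψ, hΦ]
    · have hmem : (cocyclesAW 𝒞 y - cocyclesComul 𝒞 z) n ∈ DiagonalCocycles 𝒞 n :=
        sub_mem (hy2 n) (h.cocyclesComul_mem z n)
      obtain ⟨h1, h2⟩ := (h.pairModel.mem_cocycles_iff n _).mp hmem
      refine h.pairModel.mem_coboundaries h1 h2 fun v₀ v hv hn => ?_
      rw [DirectSum.sub_apply, map_sub, hg.coord_cocyclesAW h v₀ hv hn, hy1,
        hg.coord_cocyclesComul h hT v₀ hv hn, sub_self]
  -- Uniqueness: diagonal coboundaries have zero evaluations, so any admissible `ψ'` has its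
  -- coordinates prescribed by the coproduct of cocycles.
  · refine LinearMap.ext fun x => hinj ?_
    obtain ⟨z, rfl⟩ := classOf_surjective x
    obtain ⟨y, hy1, hy2⟩ := hψ' z
    rw [hψ, ← hy1, hmap, hΦ, (hT.isCoord.tensor hT.isCoord).ext_iff]
    rintro ⟨⟨a, s⟩, ⟨a', s'⟩⟩
    by_cases hs : Admissible (!odd) s
    · by_cases hs' : Admissible (!odd) s'
      · have hv : Admissible (!odd) (joinParts s s') :=
          admissible_iff_parts.mpr (by simpa using ⟨hs, hs'⟩)
        have e1 := hg.coord_cocyclesAW h (joinParts a a') hv rfl y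
        have e2 := hg.coord_cocyclesComul h hT (joinParts a a') hv rfl z
        have e3 := h.pairModel.eval_eq_zero_of_mem (hy2 _) (joinParts a a') hv rfl
        rw [DirectSum.sub_apply, map_sub, e1, e2, sub_eq_zero] at e3
        simpa using e3
      · rw [hT.isCoord.eq_zero (a := (a', s')) fun hc => hs' hc.2]
        simp
    · rw [hT.isCoord.eq_zero (a := (a, s)) fun hc => hs hc.2]
      simp
  · obtain ⟨z, rfl⟩ := classOf_surjective x
    rw [hΦ, hT.counit]
    have key : cT (0, 0) ∘ₗ onCocycles 𝒞 g = coHHCounit 𝒞 ∘ₗ classOf 𝒞 := by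
      refine DirectSum.linearMap_ext _ fun n => LinearMap.ext fun x => ?_
      simp only [LinearMap.comp_apply, onCocycles_lof, classOf, DirectSum.lmap_lof, coHHCounit,
        DirectSum.toModule_lof]
      rcases n with _ | n
      · rw [hg.eval 0 0 0 _ (admissible_zero _) (map_zero _)]
        exact (h.counit _).symm
      · rw [hg.eval_of_ne (n + 1) 0 0 _ (by simp)]
        rfl
    exact LinearMap.congr_fun key z
  · have himage : ∀ t, t ∈ (coHHDegree 𝒞 d).map Φ.toLinearMap ↔
        ∃ x : Cocycles 𝒞 d.1, (x : TensorPow k C d.1) ∈ internalDegree 𝒞 d.1 d.2 ∧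
          g d.1 x = t := by
      intro t
      constructor
      · rintro ⟨_, ⟨x, hx, rfl⟩, rfl⟩
        refine ⟨x, hx, ?_⟩
        rw [LinearMap.comp_apply, LinearEquiv.coe_coe, hΦ, onCocycles_lof]
      · rintro ⟨x, hx, rfl⟩
        refine ⟨_, ⟨x, hx, rfl⟩, ?_⟩
        rw [LinearMap.comp_apply, LinearEquiv.coe_coe, hΦ, onCocycles_lof]
    ext t
    rw [hT.degree]
    constructor
    · intro ht a s hp
      obtain ⟨x, hx, rfl⟩ := (himage t).mp ht
      have hs := (hT.isCoord.mem _ _ hp).2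
      have hdeg : s.degree = d.1 := by
        by_contra h0
        exact hp (hg.eval_of_ne _ a s _ h0)
      refine Prod.ext hdeg ?_
      rw [hg.eval _ a s _ hs hdeg, evalMap_apply] at hp
      by_contra h0
      refine hp (evalAlt_eq_zero hdeg fun L _ hL => ?_)
      refine wordCoord_eq_zero_of_internalDegree h𝒞 hx ?_
      rwa [List.sum_cons, hL]
    -- Conversely, each coordinate vector of bidegree `d` is hit by a dual cocycle, all of whose
    -- words have the same sum and therefore the right internal degree.
    · intro ht
      refine hT.isCoord.mem_submodule _ t ?_
      rintro ⟨a, s⟩ hp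
      obtain ⟨ha, hs⟩ := hT.isCoord.mem _ _ hp
      obtain ⟨L, x, r, hL, hsum, hr, hx1, hx2⟩ := hg.exists_dual h hT.isCoord ha hs
      have hd := ht a s hp
      have hd1 : L.length = d.1 := by rw [hL, ← hd]
      obtain ⟨d₁, d₂⟩ := d
      simp only at hd1
      subst hd1
      refine ⟨g L.length x, (himage _).mpr ⟨x, ?_, rfl⟩, (hx2 _).mpr rfl, fun q hq => ?_⟩
      · rw [mem_internalDegree_iff h.isCoord h𝒞]
        intro w hw
        rw [hx1] at hw
        rw [(insertGens_support (fun b hb => (hr b).mp hb) L hw).2, hsum]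
        exact congrArg Prod.snd hd
      · by_contra h0
        exact hq ((hx2 q).mp h0)

end Comparison

/-! ### Coordinates of a homogeneous basis -/

section MonomialBasis

variable {k : Type*} [Field k] {V W : Type*} [AddCommGroup V] [Module k V]
  [AddCommGroup W] [Module k W] {I J α β D E : Type*}

/-- The functionals `c a` are the coordinates of the basis `b`, reindexed along `e : I → α`, and
vanish for `a` outside the range of `e`. -/
structure IsBasisCoord (b : Module.Basis I k V) (e : I → α) (c : α → V →ₗ[k] k) : Prop where
  eq_coord : ∀ i, c (e i) = b.coord i
  eq_zero : ∀ a, a ∉ Set.range e → c a = 0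

namespace IsBasisCoord

variable {b : Module.Basis I k V} {e : I → α} {c : α → V →ₗ[k] k}
  {b' : Module.Basis J k W} {e' : J → β} {c' : β → W →ₗ[k] k}

theorem isCoord (h : IsBasisCoord b e c) : IsCoord c (Set.range e) :=
  .of_basis b (fun i v => by rw [h.eq_coord]; rfl) h.eq_zero

theorem mem_homogeneous [DecidableEq D] (h : IsBasisCoord b e c) {deg : I → D} {wt : α → D}
    (hd : ∀ i, wt (e i) = deg i) (d : D) (v : V) :
    v ∈ homogeneous b deg d ↔ ∀ a, c a v ≠ 0 → wt a = d := by
  rw [mem_homogeneous_iff]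
  refine ⟨fun hv a ha => ?_, fun hv i hi => ?_⟩
  · by_cases hr : a ∈ Set.range e
    · obtain ⟨i, rfl⟩ := hr
      rw [hd]
      exact hv i (by simpa [h.eq_coord] using ha)
    · simp [h.eq_zero a hr] at ha
  · rw [← hd]
    exact hv _ (by simpa [h.eq_coord] using hi)

theorem box_symmetry [DecidableEq D] [DecidableEq E] (h : IsBasisCoord b e c)
    (h' : IsBasisCoord b' e' c') (sgn : D → E → ℤˣ) {deg : I → D} {deg' : J → E} {wt : α → D}
    {wt' : β → E} (hd : ∀ i, wt (e i) = deg i) (hd' : ∀ j, wt' (e' j) = deg' j) (a : α) (s : β)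
    (t : V ⊗[k] W) :
    box (c' s) (c a) (symmetry sgn (homogeneous b deg) (homogeneous b' deg') t) =
      ((sgn (wt a) (wt' s) : ℤ) : k) * box (c a) (c' s) t := by
  by_cases hr : a ∈ Set.range e
  · by_cases hr' : s ∈ Set.range e'
    · obtain ⟨i, rfl⟩ := hr
      obtain ⟨j, rfl⟩ := hr'
      rw [h.eq_coord, h'.eq_coord, hd, hd']
      exact CoHochschild.box_symmetry sgn b deg b' deg' i j t
    · simp [h'.eq_zero s hr']
  · simp [h.eq_zero a hr]

theorem tensor (h : IsBasisCoord b e c) (h' : IsBasisCoord b' e' c') :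
    IsBasisCoord (b.tensorProduct b') (Prod.map e e')
      (fun p : α × β => box (c p.1) (c' p.2)) where
  eq_coord p := by
    refine TensorProduct.ext' fun x y => ?_
    obtain ⟨i, j⟩ := p
    rw [Module.Basis.coord_apply, Module.Basis.tensorProduct_repr_tmul_apply]
    simp [h.eq_coord, h'.eq_coord, mul_comm]
  eq_zero p hp := by
    rw [Set.range_prodMap, Set.mem_prod, not_and_or] at hp
    rcases hp with hp | hp
    · simp [h.eq_zero _ hp]
    · simp [h'.eq_zero _ hp]

end IsBasisCoord

end MonomialBasis

/-! ### Sign bookkeeping for tensor products of coalgebras -/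

section TensorProductModel

variable {k : Type*} [Field k] {ι : Type*} [LinearOrder ι] {odd : Bool}
  {A Q : Type*} [AddCommGroup A] [Module k A] [AddCommGroup Q] [Module k Q]

/-- Compares the rescaling factors of `(a, s)` and `(a', s')`, together with the sign of exchanging
`s` and `a'`, with the rescaling factor of the sums. -/
theorem swapSign_mul_chiOdd (a s a' s' : ι →₀ ℕ) :
    chiOdd k odd a s * chiOdd k odd a' s' * swapSign k odd a' s =
      chiOdd k odd a s' * chiOdd k odd s a' * dotSign k odd a' s *
        chiOdd k odd (a + a') (s + s') := by
  simp only [swapSign, chiOdd_add_left, chiOdd_add_right]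
  linear_combination (-(chiOdd k odd a s * chiOdd k odd a' s' * chiOdd k odd a' s *
    chiOdd k odd s a' * dotSign k odd a' s)) * chiOdd_mul_self (k := k) odd a s'

/-- The coordinates on a tensor product, rescaled by signs. -/
def tensorCoord (odd : Bool) (c : (ι →₀ ℕ) → A →ₗ[k] k) (cq : (ι →₀ ℕ) → Q →ₗ[k] k)
    (p : (ι →₀ ℕ) × (ι →₀ ℕ)) : A ⊗[k] Q →ₗ[k] k :=
  chiOdd k odd p.1 p.2 • box (c p.1) (cq p.2)

theorem chiOdd_ne_zero (a s : ι →₀ ℕ) : chiOdd k odd a s ≠ 0 := fun h => by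
  simpa [h] using chiOdd_mul_self (k := k) odd a s

theorem isCoord_tensorCoord {c : (ι →₀ ℕ) → A →ₗ[k] k} {cq : (ι →₀ ℕ) → Q →ₗ[k] k}
    {S T : Set (ι →₀ ℕ)} (hc : IsCoord c S) (hcq : IsCoord cq T) :
    IsCoord (tensorCoord odd c cq) (S ×ˢ T) := by
  have e := (hc.tensor hcq).reindex (f := id) (d := tensorCoord odd c cq)
    (u := fun p => chiOdd k odd p.1 p.2) (fun p _ => chiOdd_ne_zero p.1 p.2) (fun p _ => rfl)
    fun p hp => by
      rw [Set.image_id] at hp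
      have := (hc.tensor hcq).eq_zero hp
      rw [tensorCoord, this, smul_zero]
  rwa [Set.image_id] at e

theorem box_tensorCoord {c : (ι →₀ ℕ) → A →ₗ[k] k} {cq : (ι →₀ ℕ) → Q →ₗ[k] k}
    {ΔA : A →ₗ[k] A ⊗[k] A} {ΔQ : Q →ₗ[k] Q ⊗[k] Q} {τ : A ⊗[k] Q →ₗ[k] Q ⊗[k] A}
    (hΔA : ∀ a b z, box (c a) (c b) (ΔA z) = chiOdd k odd a b * c (a + b) z)
    (hΔQ : ∀ s t z, box (cq s) (cq t) (ΔQ z) = dualCoeff k odd s t * cq (s + t) z)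
    (hτ : ∀ a s t, box (cq s) (c a) (τ t) = swapSign k odd a s * box (c a) (cq s) t)
    (a s a' s' : ι →₀ ℕ) (t : A ⊗[k] Q) :
    box (tensorCoord odd c cq (a, s)) (tensorCoord odd c cq (a', s'))
        (interchange τ (TensorProduct.map ΔA ΔQ t)) =
      chiOdd k odd a a' * chiOdd k odd a s' * chiOdd k odd s a' * dotSign k odd a' s *
        (dualCoeff k odd s s' * tensorCoord odd c cq (a + a', s + s') t) := by
  have e1 : box (c a) (c a') ∘ₗ ΔA = chiOdd k odd a a' • c (a + a') :=
    LinearMap.ext fun z => hΔA a a' z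
  have e2 : box (cq s) (cq s') ∘ₗ ΔQ = dualCoeff k odd s s' • cq (s + s') :=
    LinearMap.ext fun z => hΔQ s s' z
  have e3 : box (cq s) (c a') ∘ₗ τ = swapSign k odd a' s • box (c a') (cq s) :=
    LinearMap.ext fun z => hτ a' s z
  rw [tensorCoord, tensorCoord, tensorCoord, box_smul_left, box_smul_right, LinearMap.smul_apply,
    LinearMap.smul_apply, LinearMap.smul_apply, box_interchange e3, box_map, e1, e2, box_smul_left,
    box_smul_right, LinearMap.smul_apply, LinearMap.smul_apply]
  simp only [smul_eq_mul]
  generalize box (c (a + a')) (cq (s + s')) t = r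
  linear_combination (chiOdd k odd a a' * dualCoeff k odd s s' * r) *
    swapSign_mul_chiOdd (k := k) (odd := odd) a s a' s'

theorem targetModel_of_tensor {deg : ι → ℕ} {c : (ι →₀ ℕ) → A →ₗ[k] k}
    {cq : (ι →₀ ℕ) → Q →ₗ[k] k} {ΔA : A →ₗ[k] A ⊗[k] A} {ΔQ : Q →ₗ[k] Q ⊗[k] Q}
    {εA : A →ₗ[k] k} {εQ : Q →ₗ[k] k} {τ : A ⊗[k] Q →ₗ[k] Q ⊗[k] A}
    {𝒯 : ℕ × ℕ → Submodule k (A ⊗[k] Q)}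
    (hc : IsCoord c {a | Admissible odd a}) (hcq : IsCoord cq {s | Admissible (!odd) s})
    (hΔA : ∀ a b z, box (c a) (c b) (ΔA z) = chiOdd k odd a b * c (a + b) z)
    (hΔQ : ∀ s t z, box (cq s) (cq t) (ΔQ z) = dualCoeff k odd s t * cq (s + t) z)
    (hεA : ∀ z, εA z = c 0 z) (hεQ : ∀ z, εQ z = cq 0 z)
    (hτ : ∀ a s t, box (cq s) (c a) (τ t) = swapSign k odd a s * box (c a) (cq s) t)
    (h𝒯 : ∀ d t, t ∈ 𝒯 d ↔ ∀ p : (ι →₀ ℕ) × (ι →₀ ℕ), box (c p.1) (cq p.2) t ≠ 0 →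
      (p.2.degree, Finsupp.weight deg (p.1 + p.2)) = d) :
    TargetModel odd deg (tensorCoord odd c cq)
      (interchange τ ∘ₗ TensorProduct.map ΔA ΔQ) (tensorCounit εA εQ) 𝒯 where
  isCoord := isCoord_tensorCoord hc hcq
  comul a s a' s' t := box_tensorCoord hΔA hΔQ hτ a s a' s' t
  counit t := by
    have e1 : εA = c 0 := LinearMap.ext hεA
    have e2 : εQ = cq 0 := LinearMap.ext hεQ
    rw [e1, e2, tensorCoord, chiOdd_zero_left, one_smul]
    rfl
  degree d t := by
    rw [h𝒯]
    simp only [tensorCoord, LinearMap.smul_apply, smul_eq_mul, mul_ne_zero_iff, ne_eq,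
      chiOdd_ne_zero, not_false_eq_true, true_and, Prod.forall]

end TensorProductModel

/-! ### Koszul signs in terms of exponent vectors -/

section Parity

variable {k : Type*} [Field k] {ι : Type*} {deg : ι → ℕ}

theorem even_weight (h : ∀ i, Even (deg i)) (a : ι →₀ ℕ) : Even (Finsupp.weight deg a) := by
  induction a using Finsupp.induction_linear with
  | zero => simp
  | add f g hf hg => rw [map_add]; exact hf.add hg
  | single i m => rw [Finsupp.weight_single, smul_eq_mul]; exact (h i).mul_left m

/-- For generators of odd degree the weight and the number of factors have the same parity, so
Koszul signs can be computed from the latter. -/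
theorem even_weight_iff (h : ∀ i, Odd (deg i)) (a : ι →₀ ℕ) :
    Even (Finsupp.weight deg a) ↔ Even a.degree := by
  induction a using Finsupp.induction_linear with
  | zero => simp
  | add f g hf hg => rw [map_add, map_add, Nat.even_add, Nat.even_add, hf, hg]
  | single i m =>
    rw [Finsupp.weight_single, smul_eq_mul, Finsupp.degree_single, Nat.even_mul]
    simp [Nat.not_even_iff_odd.mpr (h i)]

theorem neg_one_pow_weight_mul_weight (h : ∀ i, Even (deg i)) (a b : ι →₀ ℕ) :
    (-1 : ℤˣ) ^ (Finsupp.weight deg a * Finsupp.weight deg b) = 1 :=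
  ((even_weight h a).mul_right _).neg_one_pow

variable [LinearOrder ι]

theorem swapSign_false (a b : ι →₀ ℕ) : swapSign k false a b = 1 := by
  simp [swapSign, chiOdd, dotSign, sigma]

/-- `dotSign` supplies the pairs of equal generators, which are not inversions in either order, and
the full Koszul sign results. -/
theorem swapSign_true (a b : ι →₀ ℕ) : swapSign k true a b = (-1) ^ (a.degree * b.degree) := by
  simp only [swapSign, chiOdd, if_true, chi_mul_chi, dotSign, sigma]
  rw [mul_assoc, ← mul_pow]
  simp

theorem neg_one_pow_weight_mul_weight_eq_swapSign (h : ∀ i, Odd (deg i)) (a b : ι →₀ ℕ) :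
    ((((-1 : ℤˣ) ^ (Finsupp.weight deg a * Finsupp.weight deg b) : ℤˣ) : ℤ) : k) =
      swapSign k true a b := by
  rw [swapSign_true]
  push_cast
  refine neg_one_pow_congr ?_
  rw [Nat.even_mul, Nat.even_mul, even_weight_iff h, even_weight_iff h]

end Parity

/-! ### The divided power coalgebra -/

section DividedPowerModel

variable {k : Type*} [Field k] {ι : Type*} {deg : ι → ℕ}

theorem isBasisCoord_γ : IsBasisCoord (γ k ι) id fun a => (γ k ι).coord a where
  eq_coord _ := rfl
  eq_zero a ha := absurd (Set.mem_range_self (f := id) a) ha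

theorem range_id_eq_admissible : Set.range (id : (ι →₀ ℕ) → ι →₀ ℕ) = {a | Admissible false a} := by
  ext a
  simp [Admissible]

theorem coalgebraModel_dividedPower [LinearOrder ι] (h : ∀ i, Even (deg i)) :
    CoalgebraModel false (koszul (dividedPowerGrading k deg)) fun a => (γ k ι).coord a where
  isCoord := by
    rw [← range_id_eq_admissible]
    exact isBasisCoord_γ.isCoord
  comul a b z := by
    simp only [chiOdd, Bool.false_eq_true, if_false, one_mul]
    rw [← LinearMap.comp_apply]
    congr 1
    refine (γ k ι).ext fun e => ?_
    rw [LinearMap.comp_apply, DividedPower.comul_γ, map_sum]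
    simp only [box_tmul, Module.Basis.coord_apply, Module.Basis.repr_self]
    have key : ∀ p : (ι →₀ ℕ) × (ι →₀ ℕ), (Finsupp.single p.1 (1 : k) a * Finsupp.single p.2 (1 : k) b)
        = if p = (a, b) then 1 else 0 := fun p => by
      simp only [Finsupp.single_apply, Prod.ext_iff]
      by_cases h1 : p.1 = a <;> by_cases h2 : p.2 = b <;> simp [h1, h2]
    rw [Finset.sum_congr rfl fun p _ => key p, Finset.sum_ite_eq', Finsupp.single_apply]
    simp only [Finset.HasAntidiagonal.mem_antidiagonal, @eq_comm _ e]
  counit z := by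
    congr 1
    refine (γ k ι).ext fun e => ?_
    rw [DividedPower.counit_γ, Module.Basis.coord_apply, Module.Basis.repr_self,
      Finsupp.single_apply]
  symm a b t := by
    rw [swapSign_false]
    refine (isBasisCoord_γ.box_symmetry isBasisCoord_γ koszulSign (wt := Finsupp.weight deg)
      (wt' := Finsupp.weight deg) (fun _ => rfl) (fun _ => rfl) b a t).trans ?_
    rw [koszulSign, neg_one_pow_weight_mul_weight h, Units.val_one, Int.cast_one]

end DividedPowerModel

/-! ### The exterior coalgebra -/

section ExteriorModel

variable {k : Type*} [Field k] {ι : Type*} {deg : ι → ℕ}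

/-- The generator `y_i` of the exterior algebra. -/
def exteriorGen (k : Type*) [Field k] {ι : Type*} (i : ι) : ExteriorAlgebra k (ι →₀ k) :=
  ExteriorAlgebra.ι k (Finsupp.single i 1)

theorem exteriorGen_mul_self (i : ι) : exteriorGen k i * exteriorGen k i = 0 :=
  ExteriorAlgebra.ι_sq_zero _

theorem exteriorGen_mul_comm (i j : ι) :
    exteriorGen k i * exteriorGen k j = - (exteriorGen k j * exteriorGen k i) :=
  eq_neg_of_add_eq_zero_left (ExteriorAlgebra.ι_add_mul_swap _ _)

/-- The indicator of a finite set as an exponent vector. -/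
def indVec (S : Finset ι) : ι →₀ ℕ := ∑ i ∈ S, gen i

theorem degree_indVec (S : Finset ι) : (indVec S).degree = S.card := by
  simp [indVec]

theorem weight_indVec (S : Finset ι) : Finsupp.weight deg (indVec S) = ∑ i ∈ S, deg i := by
  simp [indVec, Finsupp.weight_single]

variable [LinearOrder ι]

theorem exteriorBasis_eq_prod (S : Finset ι) :
    exteriorBasis k ι S = (S.sort.map (exteriorGen k)).prod := by
  rw [exteriorBasis, ExteriorAlgebra.basis_apply_ofCard _ rfl]
  simp only [ExteriorAlgebra.ιMulti_family, ExteriorAlgebra.ιMulti_apply]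
  rw [← S.listMap_orderEmbOfFin_finRange rfl, List.map_map, List.ofFn_eq_map]
  congr 1

theorem exteriorBasis_empty : exteriorBasis k ι ∅ = 1 := by
  rw [exteriorBasis_eq_prod, Finset.sort_empty, List.map_nil, List.prod_nil]

theorem exteriorBasis_insert {i : ι} {S : Finset ι} (h : ∀ j ∈ S, i < j) :
    exteriorBasis k ι (insert i S) = exteriorGen k i * exteriorBasis k ι S := by
  rw [exteriorBasis_eq_prod, exteriorBasis_eq_prod,
    Finset.sort_insert _ (fun j hj => (h j hj).le) (fun hi => (h i hi).false), List.map_cons,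
    List.prod_cons]

theorem indVec_apply (S : Finset ι) (i : ι) : indVec S i = if i ∈ S then 1 else 0 := by
  simp [indVec, Finsupp.finsetSum_apply, Finsupp.single_apply]

theorem indVec_insert {i : ι} {S : Finset ι} (h : i ∉ S) :
    indVec (insert i S) = gen i + indVec S := Finset.sum_insert h

theorem support_indVec (S : Finset ι) : (indVec S).support = S := by
  ext i
  simp [indVec_apply]

theorem range_indVec : Set.range (indVec : Finset ι → ι →₀ ℕ) = {a | Admissible true a} := by
  ext a
  constructor
  · rintro ⟨S, rfl⟩ _ i
    rw [indVec_apply]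
    split <;> omega
  · intro h
    refine ⟨a.support, Finsupp.ext fun i => ?_⟩
    have := h rfl i
    rw [indVec_apply]
    simp only [Finsupp.mem_support_iff]
    split <;> omega

/-- To reach its place in the increasing product, `y_i` passes exactly the smaller generators, each
at the cost of a sign; a second copy of `y_i` gives zero. -/
theorem exteriorGen_mul_basis (i : ι) (S : Finset ι) :
    exteriorGen k i * exteriorBasis k ι S =
      if i ∈ S then 0 else chi k (gen i) (indVec S) • exteriorBasis k ι (insert i S) := by
  induction S using Finset.induction_on_min with
  | empty => simp [← exteriorBasis_insert, indVec]
  | insert j S hj ih =>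
    have hjS : j ∉ S := fun h => (hj j h).false
    rcases lt_trichotomy i j with h | rfl | h
    · have h1 : ∀ l ∈ insert j S, i < l := fun l hl => by
        rcases Finset.mem_insert.mp hl with rfl | hl
        · exact h
        · exact h.trans (hj l hl)
      rw [if_neg fun hi => (h1 i hi).false, exteriorBasis_insert h1, chi_gen_of_le, one_smul]
      intro l hl
      rw [support_indVec] at hl
      exact (h1 l hl).le
    · rw [if_pos (Finset.mem_insert_self _ _), exteriorBasis_insert hj, ← mul_assoc,
        exteriorGen_mul_self, zero_mul]
    · rw [exteriorBasis_insert hj, ← mul_assoc, exteriorGen_mul_comm, neg_mul, mul_assoc, ih]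
      simp only [Finset.mem_insert, h.ne', false_or]
      split_ifs with hi
      · simp
      · have h1 : ∀ l ∈ insert i S, j < l := fun l hl => by
          rcases Finset.mem_insert.mp hl with rfl | hl
          · exact h
          · exact hj l hl
        rw [mul_smul_comm, ← exteriorBasis_insert h1, Finset.insert_comm, ← neg_smul,
          indVec_insert hjS, chi_add_right]
        congr 1
        simp [chi, inversions_single, h]

open Classical in
/-- The coordinates on the exterior algebra, indexed by exponent vectors. -/
def exteriorCoord (k : Type*) [Field k] {ι : Type*} [LinearOrder ι] (a : ι →₀ ℕ) :
    ExteriorAlgebra k (ι →₀ k) →ₗ[k] k :=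
  if Admissible true a then (exteriorBasis k ι).coord a.support else 0

theorem exteriorCoord_of_not_admissible {a : ι →₀ ℕ} (h : ¬ Admissible true a) :
    exteriorCoord k a = 0 := if_neg h

theorem exteriorCoord_indVec (S : Finset ι) :
    exteriorCoord k (indVec S) = (exteriorBasis k ι).coord S := by
  have h : Admissible true (indVec S) := (Set.ext_iff.mp range_indVec _).mp (Set.mem_range_self S)
  rw [exteriorCoord, if_pos h, support_indVec]

theorem exteriorCoord_basis (S T : Finset ι) :
    exteriorCoord k (indVec S) (exteriorBasis k ι T) = if T = S then 1 else 0 := by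
  rw [exteriorCoord_indVec, Module.Basis.coord_apply, Module.Basis.repr_self, Finsupp.single_apply]

theorem exteriorCoord_gen_mul {a : ι →₀ ℕ} (ha : Admissible true a) (i : ι)
    (x : ExteriorAlgebra k (ι →₀ k)) : exteriorCoord k a (exteriorGen k i * x) =
      if i ∈ a.support then chi k (gen i) (a - gen i) * exteriorCoord k (a - gen i) x else 0 := by
  obtain ⟨S, rfl⟩ : a ∈ Set.range indVec := by rw [range_indVec]; exact ha
  rw [support_indVec]
  have key : exteriorCoord k (indVec S) ∘ₗ LinearMap.mulLeft k (exteriorGen k i) =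
      if i ∈ S then chi k (gen i) (indVec S - gen i) • exteriorCoord k (indVec S - gen i)
      else 0 := by
    refine (exteriorBasis k ι).ext fun T => ?_
    rw [LinearMap.comp_apply, LinearMap.mulLeft_apply, exteriorGen_mul_basis]
    by_cases hi : i ∈ S
    · have e : indVec S - gen i = indVec (S.erase i) := by
        conv_lhs => rw [← Finset.insert_erase hi, indVec_insert (Finset.notMem_erase i S)]
        exact add_tsub_cancel_left _ _
      rw [if_pos hi, e, LinearMap.smul_apply, exteriorCoord_basis]
      by_cases hT : i ∈ T
      · rw [if_pos hT, map_zero, if_neg, smul_zero]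
        rintro rfl
        exact Finset.notMem_erase i S hT
      · rw [if_neg hT, map_smul, exteriorCoord_basis]
        by_cases hTS : T = S.erase i
        · subst hTS
          rw [if_pos (Finset.insert_erase hi), if_pos rfl]
        · rw [if_neg hTS, if_neg, smul_zero, smul_zero]
          rintro rfl
          exact hTS (Finset.erase_insert hT).symm
    · rw [if_neg hi, LinearMap.zero_apply]
      by_cases hT : i ∈ T
      · rw [if_pos hT, map_zero]
      · rw [if_neg hT, map_smul, exteriorCoord_basis, if_neg, smul_zero]
        rintro rfl
        exact hi (Finset.mem_insert_self _ _)
  have := LinearMap.congr_fun key x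
  rw [LinearMap.comp_apply, LinearMap.mulLeft_apply] at this
  rw [this]
  split_ifs <;> rfl

theorem exteriorBasis_mem (S : Finset ι) :
    exteriorBasis k ι S ∈ wordGrading k (ι →₀ k) S.card := by
  induction S using Finset.induction_on_min with
  | empty => rw [exteriorBasis_empty]; simp
  | insert j S hj ih =>
    rw [exteriorBasis_insert hj, Finset.card_insert_of_notMem fun h => (hj j h).false]
    simp only [wordGrading, ExteriorAlgebra.exteriorPower, pow_succ'] at ih ⊢
    exact Submodule.mul_mem_mul ⟨_, rfl⟩ ih

theorem exteriorCoord_gradeInvolution (a : ι →₀ ℕ) (x : ExteriorAlgebra k (ι →₀ k)) :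
    exteriorCoord k a (gradeInvolution x) = (-1) ^ a.degree * exteriorCoord k a x := by
  by_cases ha : Admissible true a
  · obtain ⟨S, rfl⟩ : a ∈ Set.range indVec := by rw [range_indVec]; exact ha
    have key : exteriorCoord k (indVec S) ∘ₗ gradeInvolution.toLinearMap =
        (-1 : k) ^ (indVec S).degree • exteriorCoord k (indVec S) := by
      refine (exteriorBasis k ι).ext fun T => ?_
      rw [LinearMap.comp_apply, AlgHom.toLinearMap_apply,
        gradeInvolution_of_mem (exteriorBasis_mem T), LinearMap.smul_apply, Units.smul_def,
        map_zsmul, exteriorCoord_basis, degree_indVec]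
      by_cases h : T = S
      · subst h; simp
      · simp [h]
    exact LinearMap.congr_fun key x
  · simp [exteriorCoord_of_not_admissible ha]

theorem exteriorCoord_one (a : ι →₀ ℕ) :
    exteriorCoord k a (1 : ExteriorAlgebra k (ι →₀ k)) = if a = 0 then 1 else 0 := by
  by_cases ha : Admissible true a
  · obtain ⟨S, rfl⟩ : a ∈ Set.range indVec := by rw [range_indVec]; exact ha
    rw [← exteriorBasis_empty, exteriorCoord_basis]
    have : indVec S = 0 ↔ ∅ = S := by
      rw [← Finsupp.support_eq_empty, support_indVec, eq_comm]
    simp only [this]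
  · rw [exteriorCoord_of_not_admissible ha, if_neg, LinearMap.zero_apply]
    rintro rfl
    exact ha (admissible_zero _)

/-- Multiplying by the smallest generator `y_i` applies `y_i ⊗ 1 + 1 ⊗ y_i` to the coproduct, so the
coefficients satisfy the recursion of `dualCoeff_step`, the one that also governs the evaluations of
the coproduct in the even case. -/
theorem box_exteriorComul_of_admissible {a b : ι →₀ ℕ} (ha : Admissible true a)
    (hb : Admissible true b) (S : Finset ι) :
    box (exteriorCoord k a) (exteriorCoord k b) (exteriorComulLinear (exteriorBasis k ι S)) =
      dualCoeff k false a b * exteriorCoord k (a + b) (exteriorBasis k ι S) := by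
  induction S using Finset.induction_on_min generalizing a b with
  | empty =>
    rw [exteriorBasis_empty, exteriorComul_one, box_tmul]
    simp only [exteriorCoord_one, add_eq_zero]
    by_cases h1 : a = 0 <;> by_cases h2 : b = 0 <;>
      simp [h1, h2, dualCoeff, admissible_zero]
  | insert i S hi ih =>
    rw [exteriorBasis_insert hi]
    generalize exteriorBasis k ι S = x at ih ⊢
    have e1 : exteriorCoord k a ∘ₗ LinearMap.mulLeft k (exteriorGen k i) =
        if i ∈ a.support then chi k (gen i) (a - gen i) • exteriorCoord k (a - gen i) else 0 := by
      refine LinearMap.ext fun y => ?_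
      rw [LinearMap.comp_apply, LinearMap.mulLeft_apply, exteriorCoord_gen_mul ha]
      split_ifs <;> rfl
    have e2 : exteriorCoord k b ∘ₗ LinearMap.mulLeft k (exteriorGen k i) =
        if i ∈ b.support then chi k (gen i) (b - gen i) • exteriorCoord k (b - gen i) else 0 := by
      refine LinearMap.ext fun y => ?_
      rw [LinearMap.comp_apply, LinearMap.mulLeft_apply, exteriorCoord_gen_mul hb]
      split_ifs <;> rfl
    have e3 : exteriorCoord k a ∘ₗ gradeInvolution.toLinearMap =
        (-1 : k) ^ a.degree • exteriorCoord k a :=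
      LinearMap.ext fun y => exteriorCoord_gradeInvolution a y
    have ha' : Admissible true (a - gen i) := ha.of_le tsub_le_self
    have hb' : Admissible true (b - gen i) := hb.of_le tsub_le_self
    have step : box (exteriorCoord k a) (exteriorCoord k b)
        (exteriorComulLinear (exteriorGen k i * x)) =
        (if i ∈ a.support then chi k (gen i) (a - gen i) * (dualCoeff k false (a - gen i) b *
          exteriorCoord k (a - gen i + b) x) else 0) +
        (if i ∈ b.support then (-1) ^ a.degree * (chi k (gen i) (b - gen i) *
          (dualCoeff k false a (b - gen i) * exteriorCoord k (a + (b - gen i)) x)) else 0) := by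
      rw [exteriorGen, exteriorComul_mul, exteriorStep, LinearMap.add_apply, map_add, box_rTensor,
        box_map]
      change box (_ ∘ₗ LinearMap.mulLeft k (exteriorGen k i)) _ _ +
        box _ (_ ∘ₗ LinearMap.mulLeft k (exteriorGen k i)) _ = _
      rw [e1, e2, e3]
      congr 1
      · split_ifs
        · rw [box_smul_left, LinearMap.smul_apply, smul_eq_mul, ih ha' hb]
        · simp
      · split_ifs
        · rw [box_smul_left, box_smul_right, LinearMap.smul_apply, LinearMap.smul_apply,
            smul_eq_mul, smul_eq_mul, ih ha hb']
        · simp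
    rw [step]
    have l1 : i ∈ a.support → a - gen i + b = a + b - gen i := fun h => by
      rw [tsub_add_eq_add_tsub]
      rw [Finsupp.single_le_iff]
      exact Nat.one_le_iff_ne_zero.mpr (Finsupp.mem_support_iff.mp h)
    have l2 : i ∈ b.support → a + (b - gen i) = a + b - gen i := fun h => by
      rw [add_tsub_assoc_of_le]
      rw [Finsupp.single_le_iff]
      exact Nat.one_le_iff_ne_zero.mpr (Finsupp.mem_support_iff.mp h)
    have e4 : dualCoeff k false a b * exteriorCoord k (a + b) (exteriorGen k i * x) =
        if i ∈ (a + b).support then chi k (gen i) (a + b - gen i) * dualCoeff k false a b *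
          exteriorCoord k (a + b - gen i) x else 0 := by
      by_cases h : Admissible true (a + b)
      · rw [exteriorCoord_gen_mul h]
        split_ifs <;> ring
      · simp [dualCoeff, h]
    rw [e4]
    by_cases hi : i ∈ (a + b).support
    · rw [if_pos hi, ← dualCoeff_step (odd := false) ha hb hi, add_mul]
      congr 1
      · split_ifs with h
        · rw [l1 h]; simp [chiOdd]; ring
        · rw [zero_mul]
      · split_ifs with h
        · rw [l2 h]; simp [chiOdd, sigma]; ring
        · rw [zero_mul]
    · have h1 : i ∉ a.support := fun h => hi (by simp at h ⊢; omega)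
      have h2 : i ∉ b.support := fun h => hi (by simp at h ⊢; omega)
      rw [if_neg hi, if_neg h1, if_neg h2, add_zero]

theorem box_exteriorComul (a b : ι →₀ ℕ) (x : ExteriorAlgebra k (ι →₀ k)) :
    box (exteriorCoord k a) (exteriorCoord k b) (CoalgebraStruct.comul (R := k) x) =
      dualCoeff k false a b * exteriorCoord k (a + b) x := by
  by_cases ha : Admissible true a
  · by_cases hb : Admissible true b
    · have key : box (exteriorCoord k a) (exteriorCoord k b) ∘ₗ exteriorComulLinear =
          dualCoeff k false a b • exteriorCoord k (a + b) :=
        (exteriorBasis k ι).ext fun S => box_exteriorComul_of_admissible ha hb S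
      exact LinearMap.congr_fun key x
    · have h : ¬ Admissible true (a + b) := fun h => hb h.right
      simp [exteriorCoord_of_not_admissible hb, dualCoeff, h]
  · have h : ¬ Admissible true (a + b) := fun h => ha h.left
    simp [exteriorCoord_of_not_admissible ha, dualCoeff, h]

theorem dualCoeff_false_mul_exteriorCoord (a b : ι →₀ ℕ) (x : ExteriorAlgebra k (ι →₀ k)) :
    dualCoeff k false a b * exteriorCoord k (a + b) x =
      chi k a b * exteriorCoord k (a + b) x := by
  by_cases h : Admissible true (a + b)
  · simp [dualCoeff, h]
  · simp [exteriorCoord_of_not_admissible h]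

theorem exteriorCounit_eq (x : ExteriorAlgebra k (ι →₀ k)) :
    CoalgebraStruct.counit (R := k) x = exteriorCoord k 0 x := by
  congr 1
  refine (exteriorBasis k ι).ext fun S => ?_
  induction S using Finset.induction_on_min with
  | empty => rw [exteriorBasis_empty, exteriorCounit_one, exteriorCoord_one, if_pos rfl]
  | insert i S hi _ =>
    rw [exteriorBasis_insert hi, exteriorCoord_gen_mul (admissible_zero _), exteriorGen,
      exteriorCounit_mul]
    simp

end ExteriorModel

/-! ### The polynomial coalgebra -/

section PolynomialModel

variable {k : Type*} [Field k] {ι : Type*}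

theorem polynomialCounit_eq (p : MvPolynomial ι k) :
    polynomialCounit k ι p = MvPolynomial.lcoeff k 0 p := by
  rw [polynomialCounit, MvPolynomial.aeval_zero']
  rfl

variable [LinearOrder ι]

theorem box_mul_X_tmul_one (s t : ι →₀ ℕ) (i : ι) (z : MvPolynomial ι k ⊗[k] MvPolynomial ι k) :
    box (MvPolynomial.lcoeff k s) (MvPolynomial.lcoeff k t) (z * (MvPolynomial.X i ⊗ₜ 1)) =
      if i ∈ s.support then
        box (MvPolynomial.lcoeff k (s - gen i)) (MvPolynomial.lcoeff k t) z else 0 := by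
  induction z using TensorProduct.induction_on with
  | zero => simp
  | add x y hx hy => rw [add_mul, map_add, map_add, hx, hy]; split_ifs <;> simp
  | tmul p q =>
    simp only [Algebra.TensorProduct.tmul_mul_tmul, mul_one, box_tmul, MvPolynomial.lcoeff_apply,
      MvPolynomial.coeff_mul_X', ite_mul, zero_mul]

theorem box_mul_one_tmul_X (s t : ι →₀ ℕ) (i : ι) (z : MvPolynomial ι k ⊗[k] MvPolynomial ι k) :
    box (MvPolynomial.lcoeff k s) (MvPolynomial.lcoeff k t) (z * (1 ⊗ₜ MvPolynomial.X i)) =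
      if i ∈ t.support then
        box (MvPolynomial.lcoeff k s) (MvPolynomial.lcoeff k (t - gen i)) z else 0 := by
  induction z using TensorProduct.induction_on with
  | zero => simp
  | add x y hx hy => rw [add_mul, map_add, map_add, hx, hy]; split_ifs <;> simp
  | tmul p q =>
    simp only [Algebra.TensorProduct.tmul_mul_tmul, mul_one, box_tmul, MvPolynomial.lcoeff_apply,
      MvPolynomial.coeff_mul_X', mul_ite, mul_zero]

/-- Multiplication by a variable adds it on the left or on the right, and the binomial coefficients
follow by Pascal's rule. -/
theorem box_polynomialComul (s t : ι →₀ ℕ) (p : MvPolynomial ι k) :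
    box (MvPolynomial.lcoeff k s) (MvPolynomial.lcoeff k t) (polynomialComul k ι p) =
      dualCoeff k true s t * MvPolynomial.lcoeff k (s + t) p := by
  induction p using MvPolynomial.induction_on generalizing s t with
  | C r =>
    rw [MvPolynomial.C_eq_smul_one, map_smul, map_one, map_smul, map_smul,
      Algebra.TensorProduct.one_def, box_tmul]
    simp only [MvPolynomial.lcoeff_apply, MvPolynomial.coeff_one, smul_eq_mul,
      @eq_comm _ (0 : ι →₀ ℕ), add_eq_zero]
    by_cases h1 : s = 0 <;> by_cases h2 : t = 0 <;> simp [h1, h2, dualCoeff]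
  | add p q hp hq => rw [map_add, map_add, map_add, hp, hq, mul_add]
  | mul_X p i ih =>
    have e : polynomialComul k ι (MvPolynomial.X i) =
        MvPolynomial.X i ⊗ₜ 1 + 1 ⊗ₜ MvPolynomial.X i := MvPolynomial.aeval_X _ i
    rw [map_mul, e, mul_add, map_add, box_mul_X_tmul_one, box_mul_one_tmul_X, ih, ih]
    have e' : MvPolynomial.lcoeff k (s + t) (p * MvPolynomial.X i) =
        if i ∈ (s + t).support then MvPolynomial.lcoeff k (s + t - gen i) p else 0 :=
      MvPolynomial.coeff_mul_X' _ _ _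
    rw [e']
    have l1 : i ∈ s.support → s - gen i + t = s + t - gen i := fun h => by
      rw [tsub_add_eq_add_tsub]
      rw [Finsupp.single_le_iff]
      exact Nat.one_le_iff_ne_zero.mpr (Finsupp.mem_support_iff.mp h)
    have l2 : i ∈ t.support → s + (t - gen i) = s + t - gen i := fun h => by
      rw [add_tsub_assoc_of_le]
      rw [Finsupp.single_le_iff]
      exact Nat.one_le_iff_ne_zero.mpr (Finsupp.mem_support_iff.mp h)
    by_cases hi : i ∈ (s + t).support
    · rw [if_pos hi, ← dualCoeff_true_add hi, add_mul]
      congr 1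
      · split_ifs with h
        · rw [l1 h]
        · rw [zero_mul]
      · split_ifs with h
        · rw [l2 h]
        · rw [zero_mul]
    · have h1 : i ∉ s.support := fun h => hi (by simp at h ⊢; omega)
      have h2 : i ∉ t.support := fun h => hi (by simp at h ⊢; omega)
      rw [if_neg hi, if_neg h1, if_neg h2, add_zero, mul_zero]

end PolynomialModel

/-! ### The two coalgebras and their targets as models -/

section Models

variable {k : Type*} [Field k] {ι : Type*} {deg : ι → ℕ}

theorem isBasisCoord_polynomial :
    IsBasisCoord (MvPolynomial.basisMonomials ι k) id (MvPolynomial.lcoeff k) where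
  eq_coord _ := rfl
  eq_zero a ha := absurd (Set.mem_range_self (f := id) a) ha

theorem isCoord_lcoeff :
    IsCoord (MvPolynomial.lcoeff k : (ι →₀ ℕ) → _) {a | Admissible false a} := by
  rw [← range_id_eq_admissible]
  exact isBasisCoord_polynomial.isCoord

variable [LinearOrder ι]

theorem isBasisCoord_exterior :
    IsBasisCoord (exteriorBasis k ι) indVec (exteriorCoord k) where
  eq_coord := exteriorCoord_indVec
  eq_zero a ha := exteriorCoord_of_not_admissible fun h =>
    ha ((Set.ext_iff.mp range_indVec a).mpr h)

theorem isCoord_exteriorCoord :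
    IsCoord (exteriorCoord k : (ι →₀ ℕ) → _) {a | Admissible true a} := by
  rw [← range_indVec]
  exact isBasisCoord_exterior.isCoord

theorem coalgebraModel_exterior (h : ∀ i, Odd (deg i)) :
    CoalgebraModel true (koszul (exteriorGrading k deg)) (exteriorCoord k) where
  isCoord := isCoord_exteriorCoord
  comul a b x := (box_exteriorComul a b x).trans (dualCoeff_false_mul_exteriorCoord a b x)
  counit := exteriorCounit_eq
  symm a b t := by
    refine (isBasisCoord_exterior.box_symmetry isBasisCoord_exterior koszulSign
      (wt := Finsupp.weight deg) (wt' := Finsupp.weight deg) weight_indVec weight_indVec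
      b a t).trans ?_
    rw [koszulSign, mul_comm (Finsupp.weight deg b), neg_one_pow_weight_mul_weight_eq_swapSign h]

/-- No sign arises in exchanging the factors: the `x_i` have cohomological degree zero and all
internal degrees are even. -/
theorem targetModel_dividedExterior (h : ∀ i, Even (deg i)) :
    TargetModel false deg (tensorCoord false (fun a => (γ k ι).coord a) (exteriorCoord k))
      (dividedExteriorComul k deg) (dividedExteriorCounit k ι) (dividedExteriorDegree k deg) := by
  refine targetModel_of_tensor (coalgebraModel_dividedPower h).isCoord isCoord_exteriorCoord
    (coalgebraModel_dividedPower h).comul box_exteriorComul (coalgebraModel_dividedPower h).counit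
    exteriorCounit_eq (fun a s t => ?_) ?_
  · refine (isBasisCoord_γ.box_symmetry isBasisCoord_exterior bigradedSign (wt := bideg₀ deg)
      (wt' := fun s => (s.degree, Finsupp.weight deg s)) (fun _ => rfl)
      (fun S => by rw [degree_indVec, weight_indVec]) a s t).trans ?_
    rw [swapSign_false, bigradedSign, zero_mul, zero_add, neg_one_pow_weight_mul_weight h,
      Units.val_one, Int.cast_one]
  · refine fun d => (isBasisCoord_γ.tensor isBasisCoord_exterior).mem_homogeneous (fun p => ?_) d
    simp only [Prod.map_fst, Prod.map_snd, degree_indVec, map_add, weight_indVec, id, Prod.mk_add_mk,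
      zero_add]

theorem mem_exteriorPolynomialDegree_iff (d : ℕ × ℕ)
    (t : ExteriorAlgebra k (ι →₀ k) ⊗[k] MvPolynomial ι k) :
    t ∈ exteriorPolynomialDegree k deg d ↔ ∀ p : (ι →₀ ℕ) × (ι →₀ ℕ),
      box (exteriorCoord k p.1) (MvPolynomial.lcoeff k p.2) t ≠ 0 →
        (p.2.degree, Finsupp.weight deg (p.1 + p.2)) = d := by
  rw [exteriorPolynomialDegree]
  refine (isBasisCoord_exterior.tensor isBasisCoord_polynomial).mem_homogeneous
    (wt := fun p => (p.2.degree, Finsupp.weight deg (p.1 + p.2))) (fun p => ?_) d t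
  simp only [Prod.map_fst, Prod.map_snd, map_add, weight_indVec, id, Prod.mk_add_mk,
    zero_add, Finsupp.degree_eq_weight_one]

/-- The exterior factor has cohomological degree zero, so only the internal degrees contribute, and
their parities are those of the exponent vectors. -/
theorem box_symmetry_exteriorPolynomial (h : ∀ i, Odd (deg i)) (a s : ι →₀ ℕ)
    (t : ExteriorAlgebra k (ι →₀ k) ⊗[k] MvPolynomial ι k) :
    box (MvPolynomial.lcoeff k s) (exteriorCoord k a)
        (symmetry bigradedSign (homogeneous (exteriorBasis k ι) (extBideg₀ deg))
          (homogeneous (MvPolynomial.basisMonomials ι k) (bideg₁ deg)) t) =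
      swapSign k true a s * box (exteriorCoord k a) (MvPolynomial.lcoeff k s) t := by
  rw [isBasisCoord_exterior.box_symmetry isBasisCoord_polynomial bigradedSign
    (deg := extBideg₀ deg) (deg' := bideg₁ deg) (wt := bideg₀ deg) (wt' := bideg₁ deg)
    (fun S => Prod.ext rfl (weight_indVec S)) (fun _ => rfl) a s t, bigradedSign, zero_mul, zero_add, neg_one_pow_weight_mul_weight_eq_swapSign h]

theorem targetModel_exteriorPolynomial (h : ∀ i, Odd (deg i)) :
    TargetModel true deg (tensorCoord true (exteriorCoord k) (MvPolynomial.lcoeff k))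
      (exteriorPolynomialComul k deg) (exteriorPolynomialCounit k ι)
      (exteriorPolynomialDegree k deg) := by
  rw [exteriorPolynomialComul, exteriorPolynomialCounit, bigradedComul]
  exact targetModel_of_tensor isCoord_exteriorCoord isCoord_lcoeff
    (coalgebraModel_exterior h).comul (fun s t p => box_polynomialComul s t p) exteriorCounit_eq
    polynomialCounit_eq (box_symmetry_exteriorPolynomial h) mem_exteriorPolynomialDegree_iff

end Models

end
end CoHochschild

theorem mainTheorem5 {k : Type*} [Field k] {ι : Type*} [LinearOrder ι] (deg : ι → ℕ)
    (hfin : ∀ n, {i | deg i = n}.Finite) :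
    ((∀ i, Even (deg i)) →
      CoHochschild.CoHHIsomorphicTo (CoHochschild.dividedPowerGrading k deg)
        (CoHochschild.dividedExteriorComul k deg)
        (CoHochschild.dividedExteriorCounit k ι)
        (CoHochschild.dividedExteriorDegree k deg)) ∧
    ((∀ i, Odd (deg i)) →
      CoHochschild.CoHHIsomorphicTo (CoHochschild.exteriorGrading k deg)
        (CoHochschild.exteriorPolynomialComul k deg)
        (CoHochschild.exteriorPolynomialCounit k ι)
        (CoHochschild.exteriorPolynomialDegree k deg)) :=
  ⟨fun h => CoHochschild.coHHIsomorphicTo_of_model (CoHochschild.coalgebraModel_dividedPower h)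
      (fun x t => CoHochschild.isBasisCoord_γ.mem_homogeneous (fun _ => rfl) t x)
      (CoHochschild.targetModel_dividedExterior h),
    fun h => CoHochschild.coHHIsomorphicTo_of_model (CoHochschild.coalgebraModel_exterior h)
      (fun x t => CoHochschild.isBasisCoord_exterior.mem_homogeneous CoHochschild.weight_indVec t x)
      (CoHochschild.targetModel_exteriorPolynomial h)⟩
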